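/- **Setting.** Let $X\in\mathbb R^{n\times p}$, $D\in\mathbb R^{m\times p}$, $\beta^\star\in\mathbb R^p$, $y=X\beta^\star+\epsilon$, where $\epsilon_1,\dots,\epsilon_n$ are i.i.d. with $\mathbb E\exp(t\epsilon_i)\le\exp(\sigma^2t^2/2)$ for all $t$ ($\sigma>0$). Let $\gamma^\star=D\beta^\star$, $S=\mathrm{supp}(\gamma^\star)$, $s=|S|\ge 1$, $X^*=X^T/n$; let $D_{S}$, $D_{S^c}$ be the submatrices of rows of $D$ in $S$, $S^c$. Put $\mathcal L=(\ker X\cap\ker D)^\perp$, $\mathcal M=\ker D_{S^c}$, and assume $\beta^\star\in\mathcal L$. For $\nu>0$ let $$\ell(\beta,\gamma)=\tfrac1{2n}\|y-X\beta\|_2^2+\tfrac1{2\nu}\|\gamma-D\beta\|_2^2,\qquad H=H(\nu)=\nabla^2\ell=\begin{pmatrix}X^*X+D^TD/\nu&-D^T/\nu\\-D/\nu&I_m/\nu\end{pmatrix}.$$ For $\kappa,\alpha>0$ the Split LBI iteration is $\beta_0=0$, $z_0=\gamma_0=0$, $$\beta_{k+1}=\beta_k-\kappa\alpha\nabla_\beta\ell(\beta_k,\gamma_k),\quad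 z_{k+1}=z_k-\alpha\nabla_\gamma\ell(\beta_k,\gamma_k),\quad \gamma_{k+1}=\kappa\,\mathcal S(z_{k+1},1),$$ where $\mathcal S(z,1)=\mathrm{sign}(z)\max(|z|-1,0)$ coordinatewise. Let $\lambda_D,\Lambda_D,\Lambda_X>0$ be constants such that all nonzero singular values of $D$ and of $D_{S^c}$ are $\ge\lambda_D$, the largest singular value of $D$ is $\le\Lambda_D$, and that of $X^*X$ is $\le\Lambda_X^2$. Let $\lambda_1\in(0,+\infty]$ be the smallest nonzero singular value of the restriction of $X/\sqrt n$ to $\ker D$ ($\lambda_1=+\infty$, $1/\lambda_1=0$, if $X$ vanishes on $\ker D$; the quotients below are then read as limits), and let $r'=\dim\{X\beta:\beta\in\ker D\}$. **Assumptions.** (RSC) There is $\lambda>0$ with $\beta^TX^*X\beta\ge\lambda\|\beta\|_2^2$ for all $\beta\in\mathcal L\cap\mathcal M$. (IRR($\nu$)) There is $\eta\in(0,1]$ with $$\sup_{\rho\in[-1,1]^s}\Big\|H_{S^c,(\beta,S)}H_{(\beta,S),(\beta,S)}^\dagger\begin{pmatrix}0_p\\\rho\end{pmatrix}\Big\|_\infty\le1-\eta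 .$$ **Theorem (Consistency of Split LBI).** Under these assumptions there is $C>0$ such that, for all $\nu'>0$, $\beta\in\mathcal L$, $\gamma_S\in\mathbb R^s$, $$(\beta^T,\gamma_S^T)\,H_{(\beta,S),(\beta,S)}(\nu')\begin{pmatrix}\beta\\\gamma_S\end{pmatrix}\ge\frac{C}{1+\nu'}\Big\|\begin{pmatrix}\beta\\\gamma_S\end{pmatrix}\Big\|_2^2. \tag{1}$$ Let $C>0$ be any constant for which (1) holds at $\nu'=\nu$, put $\lambda_H=C/(1+\nu)$, and suppose $\kappa\alpha\|H\|_2<2$. Let $\lambda_H'=\lambda_H(1-\kappa\alpha\|H\|_2/2)>0$ and $$\bar\tau=\frac{\eta}{8\sigma}\cdot\frac{\lambda_D}{\Lambda_X}\sqrt{\frac{n}{\log m}},\qquad \bar k=\lfloor\bar\tau/\alpha\rfloor .$$ Suppose also $5\alpha<\bar\tau$ and $$\kappa\ge\frac4\eta\Big(1+\frac1{\lambda_D}+\frac{\Lambda_X}{\lambda_1\lambda_D}\Big)\Big(1+\sqrt{\tfrac{2(1+\nu\Lambda_X^2+\Lambda_D^2)}{\lambda_H'\nu}}\Big)\Big((1+\Lambda_D)\|\beta^\star\|_2+\frac{2\sigma}{\lambda_H'}\Big(\frac{\Lambda_X}{\lambda_D}+\frac{\Lambda_X}{\lambda_D^2}+\frac{\lambda_H'\lambda_D^2+\Lambda_X^2}{\lambda_1\lambda_D^2}\Big)\Big).$$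 Then with probability at least $1-6/m-3\exp(-4n/5)$ all of the following hold. 1. (No false positive) $\mathrm{supp}(\gamma_k)\subseteq S$ for all $k$ with $0\le k\alpha\le\bar\tau$. 2. (Sign consistency) If $$\min_{j\in S}|(D\beta^\star)_j|\ge\frac{16\sigma}{\eta\lambda_H'(1-5\alpha/\bar\tau)}\cdot\frac{\Lambda_X\Lambda_D}{\lambda_D^2}\big(2\log s+5+\max\{0,\log(8\Lambda_D)\}\big)\sqrt{\frac{\log m}{n}},$$ then $\mathrm{sign}(\gamma_{\bar k})=\mathrm{sign}(D\beta^\star)$. 3. $$\|\gamma_{\bar k}-D\beta^\star\|_2\le\frac{42\sigma}{\eta\lambda_H'(1-\alpha/\bar\tau)}\cdot\frac{\Lambda_X}{\lambda_D}\sqrt{\frac{s\log m}{n}}.$$ 4. $$\|\beta_{\bar k}-\beta^\star\|_2\le\frac{42\sigma}{\eta\lambda_H'(1-\alpha/\bar\tau)}\cdot\frac{\lambda_1\Lambda_X(1+\lambda_D)+\Lambda_X^2}{\lambda_1\lambda_D^2}\sqrt{\frac{s\log m}{n}}+\frac{2\sigma}{\lambda_1}\sqrt{\frac{r'\log m}{n}}+\nu\cdot2\sigma\cdot\frac{\lambda_1\Lambda_X+\Lambda_X^2}{\lambda_1\lambda_D^2}.$$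 -/

import Mathlib

open Matrix MeasureTheory ProbabilityTheory
open scoped ENNReal RealInnerProductSpace

namespace SplitLBI

section Linear

/-- `X* = Xᵀ / n` for a matrix with `n` rows. -/
noncomputable def starMat {n p : ℕ} (X : Matrix (Fin n) (Fin p) ℝ) : Matrix (Fin p) (Fin n) ℝ :=
  (1 / (n : ℝ)) • Xᵀ

/-- The four Penrose equations: `P` is the Moore-Penrose pseudoinverse of `A`. -/
def IsMoorePenrose {ι κ : Type*} [Fintype ι] [Fintype κ]
    (A : Matrix ι κ ℝ) (P : Matrix κ ι ℝ) : Prop :=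
  A * P * A = A ∧ P * A * P = P ∧ (A * P)ᵀ = A * P ∧ (P * A)ᵀ = P * A

theorem exists_isMoorePenrose {ι κ : Type*} [Fintype ι] [Fintype κ]
    (A : Matrix ι κ ℝ) : ∃ P : Matrix κ ι ℝ, IsMoorePenrose A P := by
  classical
  have hG : (Aᵀ * A).IsHermitian := by
    simp [Matrix.IsHermitian, Matrix.conjTranspose_eq_transpose_of_trivial]
  set G := Aᵀ * A with hGdef
  set U : Matrix κ κ ℝ := (hG.eigenvectorUnitary : Matrix κ κ ℝ) with hU
  set d : κ → ℝ := hG.eigenvalues with hd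
  have hUU : Uᵀ * U = 1 := by
    have h := Unitary.coe_star_mul_self hG.eigenvectorUnitary
    simpa [Matrix.star_eq_conjTranspose, Matrix.conjTranspose_eq_transpose_of_trivial] using h
  have hspec : G = U * diagonal d * Uᵀ := by
    have h := hG.spectral_theorem
    rw [Unitary.conjStarAlgAut_apply] at h
    simpa [Matrix.star_eq_conjTranspose, Matrix.conjTranspose_eq_transpose_of_trivial,
      Function.comp_def] using h
  set K : Matrix κ κ ℝ := U * diagonal (fun i => (d i)⁻¹) * Uᵀ with hK
  have hconj : ∀ a b : κ → ℝ, (U * diagonal a * Uᵀ) * (U * diagonal b * Uᵀ)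
      = U * diagonal (fun i => a i * b i) * Uᵀ := by
    intro a b
    calc (U * diagonal a * Uᵀ) * (U * diagonal b * Uᵀ)
        = U * diagonal a * (Uᵀ * U) * diagonal b * Uᵀ := by simp only [Matrix.mul_assoc]
      _ = _ := by rw [hUU, Matrix.mul_one, Matrix.mul_assoc U, diagonal_mul_diagonal]
  have hsym : ∀ a : κ → ℝ, (U * diagonal a * Uᵀ)ᵀ = U * diagonal a * Uᵀ := by
    intro a
    simp [Matrix.transpose_mul, Matrix.mul_assoc]
  have hKG : K * G = U * diagonal (fun i => (d i)⁻¹ * d i) * Uᵀ := by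
    rw [hK, hspec, hconj]
  have hKsym : Kᵀ = K := hsym _
  have hKGsym : (K * G)ᵀ = K * G := by rw [hKG, hsym]
  have hKGK : K * G * K = K := by
    rw [hKG, hK, hconj]
    congr 3
    funext i
    rcases eq_or_ne (d i) 0 with h | h
    · simp [h]
    · field_simp
  have hGKG : G * (K * G) = G := by
    rw [hKG, hspec, hconj]
    congr 3
    funext i
    rcases eq_or_ne (d i) 0 with h | h
    · simp [h]
    · field_simp
  have hAKG : A * (K * G) = A := by
    have h0 : (A * (K * G) - A)ᵀ * (A * (K * G) - A) = 0 := by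
      have h1 : Aᵀ * (A * (K * G) - A) = 0 := by
        rw [Matrix.mul_sub, ← Matrix.mul_assoc, ← hGdef, hGKG, sub_self]
      have h2 : (A * (K * G) - A)ᵀ = ((K * G)ᵀ - 1) * Aᵀ := by
        rw [Matrix.transpose_sub, Matrix.transpose_mul, Matrix.sub_mul, Matrix.one_mul]
      rw [h2, Matrix.mul_assoc, h1, Matrix.mul_zero]
    rw [← Matrix.conjTranspose_eq_transpose_of_trivial,
      Matrix.conjTranspose_mul_self_eq_zero, sub_eq_zero] at h0
    exact h0
  refine ⟨K * Aᵀ, ?_, ?_, ?_, ?_⟩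
  · rw [Matrix.mul_assoc, Matrix.mul_assoc, ← hGdef, hAKG]
  · calc K * Aᵀ * A * (K * Aᵀ) = K * (Aᵀ * A) * K * Aᵀ := by simp only [Matrix.mul_assoc]
      _ = K * Aᵀ := by rw [← hGdef, hKGK]
  · simp [Matrix.transpose_mul, hKsym, Matrix.mul_assoc]
  · rw [Matrix.mul_assoc, ← hGdef, hKGsym]

theorem IsMoorePenrose.unique {ι κ : Type*} [Fintype ι] [Fintype κ]
    {A : Matrix ι κ ℝ} {P Q : Matrix κ ι ℝ} (hP : IsMoorePenrose A P)
    (hQ : IsMoorePenrose A Q) : P = Q := by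
  obtain ⟨p1, p2, p3, p4⟩ := hP
  obtain ⟨q1, q2, q3, q4⟩ := hQ
  have e1 : A * P = A * Q := by
    calc A * P = (A * Q * A) * P := by rw [q1]
      _ = (A * Q) * (A * P) := by simp only [Matrix.mul_assoc]
      _ = (A * Q)ᵀ * (A * P)ᵀ := by rw [q3, p3]
      _ = ((A * P) * (A * Q))ᵀ := (Matrix.transpose_mul _ _).symm
      _ = ((A * P * A) * Q)ᵀ := by simp only [Matrix.mul_assoc]
      _ = A * Q := by rw [p1, q3]
  have e2 : P * A = Q * A := by
    calc P * A = P * (A * Q * A) := by rw [q1]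
      _ = (P * A) * (Q * A) := by simp only [Matrix.mul_assoc]
      _ = (P * A)ᵀ * (Q * A)ᵀ := by rw [q4, p4]
      _ = ((Q * A) * (P * A))ᵀ := (Matrix.transpose_mul _ _).symm
      _ = (Q * (A * P * A))ᵀ := by simp only [Matrix.mul_assoc]
      _ = Q * A := by rw [p1, q4]
  calc P = P * A * P := p2.symm
    _ = Q * (A * P) := by rw [e2, Matrix.mul_assoc]
    _ = Q := by rw [e1, ← Matrix.mul_assoc, q2]

/-- The Moore-Penrose pseudoinverse `A†`. -/
noncomputable def pinv {ι κ : Type*} [Fintype ι] [Fintype κ] (A : Matrix ι κ ℝ) : Matrix κ ι ℝ :=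
  Classical.choose (exists_isMoorePenrose A)

theorem pinv_spec {ι κ : Type*} [Fintype ι] [Fintype κ] (A : Matrix ι κ ℝ) :
    IsMoorePenrose A (pinv A) :=
  Classical.choose_spec (exists_isMoorePenrose A)

/-- The smallest nonzero singular value of a linear map, with the convention that it is `+∞`
when there is none (that is, for the zero map). -/
noncomputable def minPosSingularValue {E F : Type*}
    [NormedAddCommGroup E] [InnerProductSpace ℝ E] [FiniteDimensional ℝ E]
    [NormedAddCommGroup F] [InnerProductSpace ℝ F] [FiniteDimensional ℝ F]
    (T : E →ₗ[ℝ] F) : ℝ≥0∞ :=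
  ⨅ i ∈ T.singularValues.support, ENNReal.ofReal (T.singularValues i)

/-- The largest singular value of a linear map. -/
noncomputable def maxSingularValue {E F : Type*}
    [NormedAddCommGroup E] [InnerProductSpace ℝ E] [FiniteDimensional ℝ E]
    [NormedAddCommGroup F] [InnerProductSpace ℝ F] [FiniteDimensional ℝ F]
    (T : E →ₗ[ℝ] F) : ℝ :=
  T.singularValues 0

end Linear

section Model

variable {n p m : ℕ}

/-- The support of a vector. -/
noncomputable def supp (γ : EuclideanSpace ℝ (Fin m)) : Finset (Fin m) := by
  classical exact Finset.univ.filter (fun j => γ j ≠ 0)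

/-- The loss `ℓ(β, γ) = ‖y - X β‖² / (2 n) + ‖γ - D β‖² / (2 ν)`. -/
noncomputable def loss (X : Matrix (Fin n) (Fin p) ℝ) (D : Matrix (Fin m) (Fin p) ℝ)
    (y : EuclideanSpace ℝ (Fin n)) (ν : ℝ)
    (β : EuclideanSpace ℝ (Fin p)) (γ : EuclideanSpace ℝ (Fin m)) : ℝ :=
  1 / (2 * (n : ℝ)) * ‖y - X.toEuclideanLin β‖ ^ 2
    + 1 / (2 * ν) * ‖γ - D.toEuclideanLin β‖ ^ 2

/-- The partial gradient of `loss` in `β`. -/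
noncomputable def gradBeta (X : Matrix (Fin n) (Fin p) ℝ) (D : Matrix (Fin m) (Fin p) ℝ)
    (y : EuclideanSpace ℝ (Fin n)) (ν : ℝ)
    (β : EuclideanSpace ℝ (Fin p)) (γ : EuclideanSpace ℝ (Fin m)) : EuclideanSpace ℝ (Fin p) :=
  (starMat X).toEuclideanLin (X.toEuclideanLin β - y)
    + (1 / ν) • Dᵀ.toEuclideanLin (D.toEuclideanLin β - γ)

/-- The partial gradient of `loss` in `γ`. -/
noncomputable def gradGamma (D : Matrix (Fin m) (Fin p) ℝ) (ν : ℝ)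
    (β : EuclideanSpace ℝ (Fin p)) (γ : EuclideanSpace ℝ (Fin m)) : EuclideanSpace ℝ (Fin m) :=
  (1 / ν) • (γ - D.toEuclideanLin β)

/-- The (constant) Hessian `H(ν)` of `loss`. -/
noncomputable def hessian (X : Matrix (Fin n) (Fin p) ℝ) (D : Matrix (Fin m) (Fin p) ℝ) (ν : ℝ) :
    Matrix (Fin p ⊕ Fin m) (Fin p ⊕ Fin m) ℝ :=
  Matrix.fromBlocks
    (starMat X * X + (1 / ν) • (Dᵀ * D)) (-((1 / ν) • Dᵀ))
    (-((1 / ν) • D)) ((1 / ν) • (1 : Matrix (Fin m) (Fin m) ℝ))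

theorem inner_transpose_toEuclideanLin {ι κ : Type*} [Fintype ι] [Fintype κ] [DecidableEq ι]
    [DecidableEq κ] (A : Matrix ι κ ℝ) (u : EuclideanSpace ℝ ι) (v : EuclideanSpace ℝ κ) :
    ⟪Aᵀ.toEuclideanLin u, v⟫ = ⟪u, A.toEuclideanLin v⟫ := by
  rw [← Matrix.conjTranspose_eq_transpose_of_trivial, Matrix.toEuclideanLin_conjTranspose_eq_adjoint,
    LinearMap.adjoint_inner_left]

/-- The exact second order expansion of `loss`: it certifies `gradBeta`, `gradGamma` as its
gradients and `hessian` as its Hessian matrix. -/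
theorem loss_expansion (X : Matrix (Fin n) (Fin p) ℝ) (D : Matrix (Fin m) (Fin p) ℝ)
    (y : EuclideanSpace ℝ (Fin n)) (ν : ℝ)
    (β u : EuclideanSpace ℝ (Fin p)) (γ w : EuclideanSpace ℝ (Fin m)) :
    loss X D y ν (β + u) (γ + w) = loss X D y ν β γ
      + ⟪gradBeta X D y ν β γ, u⟫ + ⟪gradGamma D ν β γ, w⟫
      + 1 / 2 * ((Sum.elim u.ofLp w.ofLp) ⬝ᵥ (hessian X D ν *ᵥ (Sum.elim u.ofLp w.ofLp))) := by
  have hH : (Sum.elim u.ofLp w.ofLp) ⬝ᵥ (hessian X D ν *ᵥ (Sum.elim u.ofLp w.ofLp))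
      = 1 / (n : ℝ) * ‖X.toEuclideanLin u‖ ^ 2 + 1 / ν * ‖w - D.toEuclideanLin u‖ ^ 2 := by
    have hX : u.ofLp ⬝ᵥ (Xᵀ *ᵥ (X *ᵥ u.ofLp)) = ‖X.toEuclideanLin u‖ ^ 2 := by
      rw [← real_inner_self_eq_norm_sq, ← inner_transpose_toEuclideanLin]
      simp [EuclideanSpace.inner_eq_star_dotProduct, Matrix.toLpLin_apply]
    have hD : u.ofLp ⬝ᵥ (Dᵀ *ᵥ (D *ᵥ u.ofLp)) = ‖D.toEuclideanLin u‖ ^ 2 := by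
      rw [← real_inner_self_eq_norm_sq, ← inner_transpose_toEuclideanLin]
      simp [EuclideanSpace.inner_eq_star_dotProduct, Matrix.toLpLin_apply]
    have hw : w.ofLp ⬝ᵥ w.ofLp = ‖w‖ ^ 2 := by
      rw [← real_inner_self_eq_norm_sq, EuclideanSpace.inner_eq_star_dotProduct, star_trivial]
    have hwD : w.ofLp ⬝ᵥ (D *ᵥ u.ofLp) = ⟪w, D.toEuclideanLin u⟫ := by
      simp [EuclideanSpace.inner_eq_star_dotProduct, Matrix.toLpLin_apply, dotProduct_comm]
    have huD : u.ofLp ⬝ᵥ (Dᵀ *ᵥ w.ofLp) = ⟪w, D.toEuclideanLin u⟫ := by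
      rw [← inner_transpose_toEuclideanLin]
      simp [EuclideanSpace.inner_eq_star_dotProduct, Matrix.toLpLin_apply]
    rw [hessian, Matrix.fromBlocks_mulVec, sumElim_dotProduct_sumElim, norm_sub_sq_real]
    simp only [Sum.elim_comp_inl, Sum.elim_comp_inr, starMat, Matrix.add_mulVec,
      Matrix.smul_mulVec, Matrix.neg_mulVec, ← Matrix.mulVec_mulVec, Matrix.smul_mul,
      dotProduct_add, dotProduct_neg, dotProduct_smul, Matrix.one_mulVec, smul_eq_mul,
      hX, hD, hw, hwD, huD]
    ring
  have hgX : ⟪(starMat X).toEuclideanLin (X.toEuclideanLin β - y), u⟫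
      = 1 / (n : ℝ) * ⟪X.toEuclideanLin β - y, X.toEuclideanLin u⟫ := by
    rw [starMat, map_smul, LinearMap.smul_apply, real_inner_smul_left,
      inner_transpose_toEuclideanLin]
  have e1 : y - X.toEuclideanLin (β + u)
      = -((X.toEuclideanLin β - y) + X.toEuclideanLin u) := by
    rw [map_add]; abel
  have e2 : γ + w - D.toEuclideanLin (β + u)
      = (γ - D.toEuclideanLin β) + (w - D.toEuclideanLin u) := by
    rw [map_add]; abel
  have e3 : D.toEuclideanLin β - γ = -(γ - D.toEuclideanLin β) := by abel
  rw [hH, gradBeta, gradGamma, inner_add_left, hgX, real_inner_smul_left, real_inner_smul_left,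
    inner_transpose_toEuclideanLin, loss, loss, e1, e2, e3, norm_neg, norm_add_sq_real,
    norm_add_sq_real (γ - D.toEuclideanLin β), norm_sub_rev y, inner_neg_left,
    inner_sub_right _ w]
  ring

/-- The shrinkage operator `sign(z) max(|z| - t, 0)`, applied coordinatewise. -/
noncomputable def shrink (z : EuclideanSpace ℝ (Fin m)) (t : ℝ) : EuclideanSpace ℝ (Fin m) :=
  WithLp.toLp 2 (fun j => Real.sign (z j) * max (|z j| - t) 0)

/-- The pair `(β_k, z_k)` of the Split LBI iteration with `β_0 = 0`, `z_0 = 0`; here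
`γ_k = κ • shrink z_k 1` (in particular `γ_0 = 0`). -/
noncomputable def state (X : Matrix (Fin n) (Fin p) ℝ) (D : Matrix (Fin m) (Fin p) ℝ)
    (y : EuclideanSpace ℝ (Fin n)) (ν κ α : ℝ) :
    ℕ → EuclideanSpace ℝ (Fin p) × EuclideanSpace ℝ (Fin m)
  | 0 => (0, 0)
  | k + 1 =>
    ((state X D y ν κ α k).1 - (κ * α) •
        gradBeta X D y ν (state X D y ν κ α k).1 (κ • shrink (state X D y ν κ α k).2 1),
      (state X D y ν κ α k).2 - α •
        gradGamma D ν (state X D y ν κ α k).1 (κ • shrink (state X D y ν κ α k).2 1))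

/-- The iterate `β_k` of Split LBI. -/
noncomputable def iterBeta (X : Matrix (Fin n) (Fin p) ℝ) (D : Matrix (Fin m) (Fin p) ℝ)
    (y : EuclideanSpace ℝ (Fin n)) (ν κ α : ℝ) (k : ℕ) : EuclideanSpace ℝ (Fin p) :=
  (state X D y ν κ α k).1

/-- The iterate `γ_k` of Split LBI. -/
noncomputable def iterGamma (X : Matrix (Fin n) (Fin p) ℝ) (D : Matrix (Fin m) (Fin p) ℝ)
    (y : EuclideanSpace ℝ (Fin n)) (ν κ α : ℝ) (k : ℕ) : EuclideanSpace ℝ (Fin m) :=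
  κ • shrink (state X D y ν κ α k).2 1

/-- The observation `y = X β* + ε`. -/
noncomputable def observation (X : Matrix (Fin n) (Fin p) ℝ) (βs : EuclideanSpace ℝ (Fin p))
    (e : Fin n → ℝ) : EuclideanSpace ℝ (Fin n) :=
  X.toEuclideanLin βs + WithLp.toLp 2 e

/-- `𝓛 = (ker X ∩ ker D)ᗮ`. -/
noncomputable def subL (X : Matrix (Fin n) (Fin p) ℝ) (D : Matrix (Fin m) (Fin p) ℝ) :
    Submodule ℝ (EuclideanSpace ℝ (Fin p)) :=
  (LinearMap.ker X.toEuclideanLin ⊓ LinearMap.ker D.toEuclideanLin)ᗮ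

/-- The submatrix `D_{Sᶜ}` of the rows of `D` outside `S`. -/
def rowsCompl (D : Matrix (Fin m) (Fin p) ℝ) (S : Finset (Fin m)) :
    Matrix {j // j ∉ S} (Fin p) ℝ :=
  D.submatrix Subtype.val id

/-- The model subspace `𝓜 = ker D_{Sᶜ}`. -/
noncomputable def subM (D : Matrix (Fin m) (Fin p) ℝ) (S : Finset (Fin m)) :
    Submodule ℝ (EuclideanSpace ℝ (Fin p)) :=
  LinearMap.ker (rowsCompl D S).toEuclideanLin

/-- `H_{(β,S),(β,S)}(ν)`. -/
noncomputable def hessianSS (X : Matrix (Fin n) (Fin p) ℝ) (D : Matrix (Fin m) (Fin p) ℝ)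
    (S : Finset (Fin m)) (ν : ℝ) : Matrix (Fin p ⊕ {j // j ∈ S}) (Fin p ⊕ {j // j ∈ S}) ℝ :=
  (hessian X D ν).submatrix (Sum.map id Subtype.val) (Sum.map id Subtype.val)

/-- `H_{Sᶜ,(β,S)}(ν)`. -/
noncomputable def hessianCS (X : Matrix (Fin n) (Fin p) ℝ) (D : Matrix (Fin m) (Fin p) ℝ)
    (S : Finset (Fin m)) (ν : ℝ) : Matrix {j // j ∉ S} (Fin p ⊕ {j // j ∈ S}) ℝ :=
  (hessian X D ν).submatrix (fun j => Sum.inr j.val) (Sum.map id Subtype.val)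

/-- The constants `lamD`, `LamD`, `LamX > 0` bound the singular values of `D`, `D_{Sᶜ}`
and `X* X`. -/
structure IsSpectralBound (X : Matrix (Fin n) (Fin p) ℝ) (D : Matrix (Fin m) (Fin p) ℝ)
    (S : Finset (Fin m)) (lamD LamD LamX : ℝ) : Prop where
  lamD_pos : 0 < lamD
  LamD_pos : 0 < LamD
  LamX_pos : 0 < LamX
  le_min : ENNReal.ofReal lamD ≤ min (minPosSingularValue D.toEuclideanLin)
    (minPosSingularValue (rowsCompl D S).toEuclideanLin)
  D_le : maxSingularValue D.toEuclideanLin ≤ LamD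
  X_le : maxSingularValue (starMat X * X).toEuclideanLin ≤ LamX ^ 2

/-- Restricted strong convexity. -/
def RSC (X : Matrix (Fin n) (Fin p) ℝ) (D : Matrix (Fin m) (Fin p) ℝ)
    (S : Finset (Fin m)) : Prop :=
  ∃ lam : ℝ, 0 < lam ∧ ∀ β ∈ subL X D ⊓ subM D S,
    lam * ‖β‖ ^ 2 ≤ ⟪β, (starMat X * X).toEuclideanLin β⟫

/-- The quadratic form of `H_{(β,S),(β,S)}(ν)` is at least `C / (1 + ν)` on `𝓛 ⊕ ℝ^S`. -/
def RSCNu (X : Matrix (Fin n) (Fin p) ℝ) (D : Matrix (Fin m) (Fin p) ℝ)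
    (S : Finset (Fin m)) (ν C : ℝ) : Prop :=
  ∀ β ∈ subL X D, ∀ g : EuclideanSpace ℝ {j // j ∈ S},
    C / (1 + ν) * (‖β‖ ^ 2 + ‖g‖ ^ 2) ≤
      (Sum.elim β.ofLp g.ofLp) ⬝ᵥ (hessianSS X D S ν *ᵥ (Sum.elim β.ofLp g.ofLp))

/-- The irrepresentable condition `IRR(ν)` with constant `η`. -/
def IRR (X : Matrix (Fin n) (Fin p) ℝ) (D : Matrix (Fin m) (Fin p) ℝ)
    (S : Finset (Fin m)) (ν η : ℝ) : Prop :=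
  ∀ ρ : {j // j ∈ S} → ℝ, (∀ i, ρ i ∈ Set.Icc (-1 : ℝ) 1) →
    ‖(hessianCS X D S ν * pinv (hessianSS X D S ν)) *ᵥ (Sum.elim 0 ρ)‖ ≤ 1 - η

/-- `λ₁`: the smallest nonzero singular value of the restriction of `X / √n` to `ker D`
(equivalently, of `X V / √n`, where the columns of `V` are an orthonormal basis of `ker D`);
it is `+∞` if `X` vanishes on `ker D`. -/
noncomputable def lamOne (X : Matrix (Fin n) (Fin p) ℝ) (D : Matrix (Fin m) (Fin p) ℝ) : ℝ≥0∞ :=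
  minPosSingularValue
    (((Real.sqrt n)⁻¹ • X.toEuclideanLin).domRestrict (LinearMap.ker D.toEuclideanLin))

/-- The real number `1 / λ₁` (which is `0` if `λ₁ = +∞`). -/
noncomputable def invLamOne (X : Matrix (Fin n) (Fin p) ℝ) (D : Matrix (Fin m) (Fin p) ℝ) : ℝ :=
  ((lamOne X D)⁻¹).toReal

/-- `r' = dim {X β : β ∈ ker D}`. -/
noncomputable def rPrime (X : Matrix (Fin n) (Fin p) ℝ) (D : Matrix (Fin m) (Fin p) ℝ) : ℕ :=
  Module.finrank ℝ
    (Submodule.map X.toEuclideanLin (LinearMap.ker D.toEuclideanLin))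

/-- The spectral norm `‖H(ν)‖₂`. -/
noncomputable def hessianNorm (X : Matrix (Fin n) (Fin p) ℝ) (D : Matrix (Fin m) (Fin p) ℝ)
    (ν : ℝ) : ℝ :=
  ‖Matrix.toEuclideanCLM (𝕜 := ℝ) (hessian X D ν)‖

/-- The stopping time `τ̄ = (η / (8 σ)) (λ_D / Λ_X) √(n / log m)`. -/
noncomputable def tauBar (n m : ℕ) (σ η lamD LamX : ℝ) : ℝ :=
  η / (8 * σ) * (lamD / LamX) * Real.sqrt ((n : ℝ) / Real.log m)

/-- The lower bound required of `κ`, as a function of `λ_H`; `i1` stands for `1 / λ₁` and `b` for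
`‖β*‖₂`. -/
noncomputable def kappaLower (σ η ν lamD LamD LamX i1 b lamH : ℝ) : ℝ :=
  4 / η * (1 + 1 / lamD + LamX * i1 / lamD)
    * (1 + Real.sqrt (2 * (1 + ν * LamX ^ 2 + LamD ^ 2) / (lamH * ν)))
    * ((1 + LamD) * b
      + 2 * σ / lamH *
        (LamX / lamD + LamX / lamD ^ 2 + (lamH * lamD ^ 2 + LamX ^ 2) * i1 / lamD ^ 2))

end Model

end SplitLBI

open SplitLBI

set_option linter.unusedSectionVars false

/-! Write B = X/√n, P = `mask S`, e = ε/√n. Minimising the loss over γ supported in S gives an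
oracle estimator (β* + x, P D(β* + x)), where x solves the Schur equation A x = B†e with A = B†B +
D†(1 - P)D/ν. The proof studies an auxiliary iteration in which γ is projected onto S at each step.
It coincides with Split LBI up to time τ̄, it approaches the oracle, and the oracle is close to the
truth.

Coincidence. Summing the updates gives A(∑ α(b₀ - b_i)) = D†P z_k + b_k/κ, with b₀ the oracle
(`OraclePath.schur_sum`), and off S the dual variable z_k is read off from b₀ and this sum
(`OraclePath.off_sum`). On S, z_k is a subgradient with entries in [-1, 1] plus γ_k/κ. The
irrepresentable condition charges the subgradient at most 1 - η, the terms of order 1/κ cost at most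
3η/4 because κ dominates a uniform bound on the iterates, and the noise costs at most η/4 up to time
τ̄. Hence |z_k| ≤ 1 off S, thresholding returns zero there, and the projection never acts
(`Regime.abs_z_le`, `state_eq_oracleState`).

Convergence. The iteration is mirror descent on a convex quadratic. The Bregman divergence Ψ to the
oracle drops at each step by at least α λ_H' q, where q, the Hessian energy of the error divided by
λ_H, is nonincreasing (`Regime.breg_step`, `OraclePath.energy_step`). Since Ψ² ≤ (17/8)² s q, a
discrete Bihari argument (`bihari_bound`) gives the ℓ² rates. If the oracle coordinates on S are at
least c, then also c Ψ ≤ (17/8) q, and harmonic, exponential and linear decay in turn force q below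
c² (`lt_of_three_phases`), which fixes the signs.

Noise. How x depends on e is deterministic linear algebra (section on `Design`). Noise enters only
through ‖ε‖, its projection on X(ker D), and m linear functionals. Sub-Gaussian tails bound the
failure probability by exp(-4n/5) + 3/m. -/

namespace SplitLBI

/-! ### Singular values as two-sided bounds for a linear map. -/

section SingularValues

variable {E F : Type*}
    [NormedAddCommGroup E] [InnerProductSpace ℝ E] [FiniteDimensional ℝ E]
    [NormedAddCommGroup F] [InnerProductSpace ℝ F] [FiniteDimensional ℝ F]

/-- Expansion in an eigenbasis of T†T; the bounds below compare it term by term with Parseval's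
identity. -/
theorem norm_sq_apply_eq_sum (T : E →ₗ[ℝ] F) (x : E) :
    ‖T x‖ ^ 2 = ∑ i : Fin (Module.finrank ℝ E), T.singularValues i ^ 2 *
      ⟪T.isSymmetric_adjoint_comp_self.eigenvectorBasis rfl i, x⟫ ^ 2 := by
  set hT := T.isSymmetric_adjoint_comp_self
  set b := hT.eigenvectorBasis rfl with hb
  have h1 : ‖T x‖ ^ 2 = ⟪x, (T.adjoint ∘ₗ T) x⟫ := by
    rw [LinearMap.comp_apply, LinearMap.adjoint_inner_right, real_inner_self_eq_norm_sq]
  rw [h1, ← b.sum_inner_mul_inner]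
  refine Finset.sum_congr rfl fun i _ => ?_
  rw [hb, ← T.isSymmetric_adjoint_comp_self (T.isSymmetric_adjoint_comp_self.eigenvectorBasis rfl i) x,
    LinearMap.IsSymmetric.apply_eigenvectorBasis, T.sq_singularValues_fin rfl i, inner_smul_left,
    real_inner_comm]
  simp
  ring

theorem norm_apply_le_maxSingularValue (T : E →ₗ[ℝ] F) (x : E) :
    ‖T x‖ ≤ maxSingularValue T * ‖x‖ := by
  have h0 : 0 ≤ maxSingularValue T := T.singularValues_nonneg 0
  refine le_of_sq_le_sq ?_ (by positivity)
  rw [norm_sq_apply_eq_sum, mul_pow,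
    ← (T.isSymmetric_adjoint_comp_self.eigenvectorBasis rfl).sum_sq_inner_right x, Finset.mul_sum]
  refine Finset.sum_le_sum fun i _ => ?_
  refine mul_le_mul_of_nonneg_right ?_ (sq_nonneg _)
  exact pow_le_pow_left₀ (T.singularValues_nonneg i) (T.singularValues_antitone (Nat.zero_le i)) 2

theorem mul_norm_le_norm_apply (T : E →ₗ[ℝ] F) {c : ℝ} (hc : 0 ≤ c)
    (h : ∀ i ∈ T.singularValues.support, c ≤ T.singularValues i) {x : E}
    (hx : x ∈ (LinearMap.ker T)ᗮ) : c * ‖x‖ ≤ ‖T x‖ := by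
  refine le_of_sq_le_sq ?_ (by positivity)
  rw [norm_sq_apply_eq_sum, mul_pow,
    ← (T.isSymmetric_adjoint_comp_self.eigenvectorBasis rfl).sum_sq_inner_right x, Finset.mul_sum]
  refine Finset.sum_le_sum fun i _ => ?_
  by_cases hi : T.singularValues i = 0
  -- An eigenvector with singular value zero lies in the kernel, so x has no component along it.
  · have h2 : T.isSymmetric_adjoint_comp_self.eigenvectorBasis rfl i ∈ LinearMap.ker T := by
      rw [← LinearMap.ker_adjoint_comp_self, LinearMap.mem_ker,
        LinearMap.IsSymmetric.apply_eigenvectorBasis, ← T.sq_singularValues_fin rfl i, hi]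
      simp
    rw [Submodule.inner_right_of_mem_orthogonal h2 hx]
    simp
  · exact mul_le_mul_of_nonneg_right
      (pow_le_pow_left₀ hc (h i (Finsupp.mem_support_iff.2 hi)) 2) (sq_nonneg _)

theorem mul_norm_le_of_ofReal_le_minPosSingularValue (T : E →ₗ[ℝ] F) {c : ℝ} (hc : 0 ≤ c)
    (h : ENNReal.ofReal c ≤ minPosSingularValue T) {x : E}
    (hx : x ∈ (LinearMap.ker T)ᗮ) : c * ‖x‖ ≤ ‖T x‖ := by
  refine mul_norm_le_norm_apply T hc (fun i hi => ?_) hx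
  have := h.trans (iInf₂_le i hi)
  exact (ENNReal.ofReal_le_ofReal_iff (T.singularValues_nonneg i)).1 this

theorem minPosSingularValue_ne_zero (T : E →ₗ[ℝ] F) : minPosSingularValue T ≠ 0 := by
  intro h0
  rcases T.singularValues.support.eq_empty_or_nonempty with h | h
  · rw [minPosSingularValue, h] at h0
    simp at h0
  · obtain ⟨i, hi, hmin⟩ := Finset.exists_min_image _ (fun i => T.singularValues i) h
    have h1 : ENNReal.ofReal (T.singularValues i) ≤ minPosSingularValue T :=
      le_iInf₂ fun j hj => ENNReal.ofReal_le_ofReal (hmin j hj)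
    rw [h0, nonpos_iff_eq_zero, ENNReal.ofReal_eq_zero] at h1
    exact absurd ((T.singularValues_pos_iff_ne_zero i).2 (Finsupp.mem_support_iff.1 hi))
      (not_lt.2 h1)

theorem norm_le_inv_minPosSingularValue_mul (T : E →ₗ[ℝ] F) {x : E}
    (hx : x ∈ (LinearMap.ker T)ᗮ) : ‖x‖ ≤ ((minPosSingularValue T)⁻¹).toReal * ‖T x‖ := by
  by_cases htop : minPosSingularValue T = ⊤
  · rw [htop]
    simp only [ENNReal.inv_top, ENNReal.toReal_zero, zero_mul, norm_le_zero_iff]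
    by_contra hne
    have hpos : 0 < ‖x‖ := norm_pos_iff.2 hne
    -- With no nonzero singular value every constant is admissible; this one would give ‖T x‖ + 1 ≤
    -- ‖T x‖.
    have h1 := mul_norm_le_of_ofReal_le_minPosSingularValue T
      (c := (‖T x‖ + 1) / ‖x‖) (by positivity) (by rw [htop]; exact le_top) hx
    rw [div_mul_cancel₀ _ hpos.ne'] at h1
    linarith
  · have hne := minPosSingularValue_ne_zero T
    have hpos : 0 < (minPosSingularValue T).toReal := ENNReal.toReal_pos hne htop
    have := mul_norm_le_of_ofReal_le_minPosSingularValue T hpos.le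
      (by rw [ENNReal.ofReal_toReal htop]) hx
    rw [ENNReal.toReal_inv, ← div_eq_inv_mul, le_div_iff₀ hpos, mul_comm]
    exact this

/-- If `T` is bounded below by `1 / k` off its kernel, then its adjoint has preimages of norm
at most `k` times the norm of the target. -/
theorem exists_adjoint_preimage (T : E →ₗ[ℝ] F) {k : ℝ}
    (h : ∀ x ∈ (LinearMap.ker T)ᗮ, ‖x‖ ≤ k * ‖T x‖) {y : E} (hy : y ∈ (LinearMap.ker T)ᗮ) :
    ∃ c, T.adjoint c = y ∧ ‖c‖ ≤ k * ‖y‖ := by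
  -- T†T has range (ker T)ᗮ, so y = T†T u. The preimage is T u, and the kernel part of u is removed
  -- so that `h` applies.
  have hy' : y ∈ LinearMap.range (T.adjoint ∘ₗ T) := by
    rw [LinearMap.range_adjoint_comp_self, ← LinearMap.orthogonal_ker]; exact hy
  obtain ⟨u, hu⟩ := hy'
  set v := u - (LinearMap.ker T).starProjection u with hv
  have hv1 : v ∈ (LinearMap.ker T)ᗮ := Submodule.sub_starProjection_mem_orthogonal u
  have hTv : T v = T u := by
    rw [hv, map_sub, sub_eq_self, ← LinearMap.mem_ker]
    exact Submodule.starProjection_apply_mem _ _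
  refine ⟨T v, by rw [hTv]; exact hu, ?_⟩
  have h1 : ‖T v‖ ^ 2 = ⟪v, y⟫ := by
    rw [← hu, LinearMap.comp_apply, LinearMap.adjoint_inner_right, hTv, real_inner_self_eq_norm_sq]
  have h2 : ‖T v‖ ^ 2 ≤ k * ‖T v‖ * ‖y‖ := by
    rw [h1]
    exact (real_inner_le_norm _ _).trans (mul_le_mul_of_nonneg_right (h v hv1) (norm_nonneg _))
  rcases (norm_nonneg (T v)).eq_or_lt with h0 | h0
  · rw [← h0]
    have := h y hy
    rcases (norm_nonneg y).eq_or_lt with h3 | h3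
    · rw [← h3]; simp
    · have : 0 < k * ‖T y‖ := h3.trans_le this
      exact (mul_pos (pos_of_mul_pos_left this (norm_nonneg _)) h3).le
  · nlinarith

/-- The adjoint of `T` is bounded below on the range of `T`. -/
theorem norm_le_mul_norm_adjoint (T : E →ₗ[ℝ] F) {k : ℝ}
    (h : ∀ x ∈ (LinearMap.ker T)ᗮ, ‖x‖ ≤ k * ‖T x‖) (u : E) :
    ‖T u‖ ≤ k * ‖T.adjoint (T u)‖ := by
  set v := u - (LinearMap.ker T).starProjection u with hv
  have hv1 : v ∈ (LinearMap.ker T)ᗮ := Submodule.sub_starProjection_mem_orthogonal u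
  have hTv : T v = T u := by
    rw [hv, map_sub, sub_eq_self, ← LinearMap.mem_ker]
    exact Submodule.starProjection_apply_mem _ _
  rw [← hTv]
  have h1 : ‖T v‖ ^ 2 = ⟪v, T.adjoint (T v)⟫ := by
    rw [LinearMap.adjoint_inner_right, real_inner_self_eq_norm_sq]
  have h2 : ‖T v‖ ^ 2 ≤ k * ‖T v‖ * ‖T.adjoint (T v)‖ := by
    rw [h1]
    exact (real_inner_le_norm _ _).trans (mul_le_mul_of_nonneg_right (h v hv1) (norm_nonneg _))
  rcases (norm_nonneg (T v)).eq_or_lt with h0 | h0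
  · have h3 : T v = 0 := norm_eq_zero.1 h0.symm
    simp [h3]
  · nlinarith

end SingularValues

/-! ### The Schur complement and the response of the oracle to noise. -/

section Oracle

variable {E F G : Type*}
    [NormedAddCommGroup E] [InnerProductSpace ℝ E] [FiniteDimensional ℝ E]
    [NormedAddCommGroup F] [InnerProductSpace ℝ F] [FiniteDimensional ℝ F]
    [NormedAddCommGroup G] [InnerProductSpace ℝ G] [FiniteDimensional ℝ G]

/-- The part of `D` outside the range of the projection `P`. -/
noncomputable def offPart (D : E →ₗ[ℝ] F) (P : F →ₗ[ℝ] F) : E →ₗ[ℝ] F := D - P ∘ₗ D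

/-- The Schur complement `B† B + D† (1 - P) D / ν`. -/
noncomputable def schur (B : E →ₗ[ℝ] G) (D : E →ₗ[ℝ] F) (P : F →ₗ[ℝ] F) (ν : ℝ) : E →ₗ[ℝ] E :=
  B.adjoint ∘ₗ B + (1 / ν) • ((offPart D P).adjoint ∘ₗ offPart D P)

/-- A regression operator `B`, an analysis operator `D` and a coordinate projection `P`, with the
spectral constants and the restricted strong convexity used for Split LBI. -/
structure Design (B : E →ₗ[ℝ] G) (D : E →ₗ[ℝ] F) (P : F →ₗ[ℝ] F)
    (ν lamD LamX lamH i1 : ℝ) : Prop where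
  nu_pos : 0 < ν
  lamD_pos : 0 < lamD
  LamX_pos : 0 < LamX
  lamH_pos : 0 < lamH
  i1_nonneg : 0 ≤ i1
  symm : P.IsSymmetric
  idem : ∀ f, P (P f) = P f
  B_le : ∀ x, ‖B x‖ ≤ LamX * ‖x‖
  D_ge : ∀ x ∈ (LinearMap.ker D)ᗮ, ‖x‖ ≤ lamD⁻¹ * ‖D x‖
  off_ge : ∀ x ∈ (LinearMap.ker (offPart D P))ᗮ, ‖x‖ ≤ lamD⁻¹ * ‖offPart D P x‖
  ker_ge : ∀ x ∈ LinearMap.ker D, x ∈ (LinearMap.ker B ⊓ LinearMap.ker D)ᗮ → ‖x‖ ≤ i1 * ‖B x‖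
  coercive : ∀ x ∈ (LinearMap.ker B ⊓ LinearMap.ker D)ᗮ, ∀ g, P g = g →
    lamH * (‖x‖ ^ 2 + ‖g‖ ^ 2) ≤ ‖B x‖ ^ 2 + 1 / ν * ‖g - D x‖ ^ 2
  lamH_mul_nu : lamH * ν ≤ 1

section Basic

variable (B : E →ₗ[ℝ] G) (D : E →ₗ[ℝ] F) (P : F →ₗ[ℝ] F) (ν : ℝ)

theorem offPart_apply (x : E) : offPart D P x = D x - P (D x) := rfl

theorem schur_apply (x : E) :
    schur B D P ν x = B.adjoint (B x) + (1 / ν) • (offPart D P).adjoint (offPart D P x) := rfl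

theorem inner_schur_left (x y : E) : ⟪schur B D P ν x, y⟫
    = ⟪B x, B y⟫ + 1 / ν * ⟪offPart D P x, offPart D P y⟫ := by
  rw [schur_apply, inner_add_left, real_inner_smul_left, LinearMap.adjoint_inner_left,
    LinearMap.adjoint_inner_left]

theorem inner_schur_self (x : E) : ⟪schur B D P ν x, x⟫
    = ‖B x‖ ^ 2 + 1 / ν * ‖offPart D P x‖ ^ 2 := by
  rw [inner_schur_left, real_inner_self_eq_norm_sq, real_inner_self_eq_norm_sq]

theorem schur_isSymmetric : (schur B D P ν).IsSymmetric := by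
  intro x y
  rw [inner_schur_left, real_inner_comm (schur B D P ν y), inner_schur_left, real_inner_comm (B y),
    real_inner_comm (offPart D P y)]

theorem adjoint_apply_norm_le {B : E →ₗ[ℝ] G} {c : ℝ} (hc : 0 ≤ c) (h : ∀ x, ‖B x‖ ≤ c * ‖x‖)
    (w : G) : ‖B.adjoint w‖ ≤ c * ‖w‖ := by
  have h1 : ‖B.adjoint w‖ ^ 2 ≤ c * ‖B.adjoint w‖ * ‖w‖ := by
    rw [← real_inner_self_eq_norm_sq, LinearMap.adjoint_inner_left, real_inner_comm]
    exact (real_inner_le_norm _ _).trans (mul_le_mul_of_nonneg_right (h _) (norm_nonneg _))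
  rcases (norm_nonneg (B.adjoint w)).eq_or_lt with h0 | h0
  · rw [← h0]; positivity
  · nlinarith

end Basic

namespace Design

variable {B : E →ₗ[ℝ] G} {D : E →ₗ[ℝ] F} {P : F →ₗ[ℝ] F} {ν lamD LamX lamH i1 : ℝ}
  (h : Design B D P ν lamD LamX lamH i1)

include h

theorem P_offPart (x : E) : P (offPart D P x) = 0 := by
  rw [offPart_apply, map_sub, h.idem, sub_self]

theorem norm_sq_D (x : E) : ‖D x‖ ^ 2 = ‖P (D x)‖ ^ 2 + ‖offPart D P x‖ ^ 2 := by
  have h1 : D x = P (D x) + offPart D P x := by rw [offPart_apply]; abel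
  have h2 : ⟪P (D x), offPart D P x⟫ = 0 := by
    rw [h.symm, h.P_offPart, inner_zero_right]
  conv_lhs => rw [h1]
  rw [norm_add_sq_real, h2]; ring

theorem norm_sq_P (f : F) : ‖f‖ ^ 2 = ‖P f‖ ^ 2 + ‖f - P f‖ ^ 2 := by
  have h1 : f = P f + (f - P f) := by abel
  have h2 : ⟪P f, f - P f⟫ = 0 := by
    rw [h.symm, map_sub, h.idem, sub_self, inner_zero_right]
  conv_lhs => rw [h1]
  rw [norm_add_sq_real, h2]; ring

theorem norm_P_le (f : F) : ‖P f‖ ≤ ‖f‖ := by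
  refine le_of_sq_le_sq ?_ (norm_nonneg _)
  rw [h.norm_sq_P f]; nlinarith [sq_nonneg ‖f - P f‖]

theorem adjoint_offPart (f : F) : (offPart D P).adjoint f = D.adjoint (f - P f) := by
  refine ext_inner_right ℝ fun v => ?_
  rw [LinearMap.adjoint_inner_left, LinearMap.adjoint_inner_left, offPart_apply, inner_sub_right,
    inner_sub_left, h.symm f]

theorem adjoint_D_eq (f : F) : D.adjoint f = D.adjoint (P f) + (offPart D P).adjoint f := by
  rw [h.adjoint_offPart, map_sub]; abel

theorem eq_zero_of_schur_eq_zero {x : E} (hx : schur B D P ν x = 0) :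
    B x = 0 ∧ offPart D P x = 0 := by
  have h1 := inner_schur_self B D P ν x
  rw [hx, inner_zero_left] at h1
  have hν := h.nu_pos
  have h2 : 0 ≤ 1 / ν * ‖offPart D P x‖ ^ 2 := by positivity
  have h3 : ‖B x‖ ^ 2 = 0 := by nlinarith [sq_nonneg ‖B x‖]
  have h4 : 1 / ν * ‖offPart D P x‖ ^ 2 = 0 := by nlinarith [sq_nonneg ‖B x‖]
  refine ⟨by simpa using h3, ?_⟩
  rcases mul_eq_zero.1 h4 with h5 | h5
  · exact absurd h5 (by positivity)
  · simpa using h5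

/-- The Schur complement may be singular, but this part of a solution is determined by the
right-hand side. -/
theorem offPart_eq_of_schur_eq {x y : E} (hxy : schur B D P ν x = schur B D P ν y) :
    offPart D P x = offPart D P y := by
  have := (h.eq_zero_of_schur_eq_zero (x := x - y) (by rw [map_sub, hxy, sub_self])).2
  rwa [map_sub, sub_eq_zero] at this

theorem sub_starProjection_mem (x : E) :
    B (((LinearMap.ker B ⊓ LinearMap.ker D)ᗮ).starProjection x) = B x ∧
    D (((LinearMap.ker B ⊓ LinearMap.ker D)ᗮ).starProjection x) = D x := by
  have h1 := Submodule.sub_starProjection_mem_orthogonal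
    (K := (LinearMap.ker B ⊓ LinearMap.ker D)ᗮ) x
  rw [Submodule.orthogonal_orthogonal] at h1
  obtain ⟨h2, h3⟩ := h1
  rw [SetLike.mem_coe, LinearMap.mem_ker, map_sub, sub_eq_zero] at h2 h3
  exact ⟨h2.symm, h3.symm⟩

/-- Coercivity holds for every g in the range of P. Taking g = t P(D x) and optimising over t
transfers the constant to D x without loss. -/
theorem lamH_mul_norm_sq_D_le (x : E) :
    lamH * ‖D x‖ ^ 2 ≤ ‖B x‖ ^ 2 + 1 / ν * ‖offPart D P x‖ ^ 2 := by
  have hν := h.nu_pos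
  set e := ‖offPart D P x‖ ^ 2 with he
  set d := ‖P (D x)‖ ^ 2 with hd
  set b := ‖B x‖ ^ 2 with hb
  have he0 : 0 ≤ e := by positivity
  have hd0 : 0 ≤ d := by positivity
  have hb0 : 0 ≤ b := by positivity
  have key : ∀ t : ℝ, lamH * (t ^ 2 * d) ≤ b + 1 / ν * ((t - 1) ^ 2 * d + e) := by
    intro t
    obtain ⟨hB, hD⟩ := h.sub_starProjection_mem x
    have h1 := h.coercive _ (Submodule.starProjection_apply_mem
      (LinearMap.ker B ⊓ LinearMap.ker D)ᗮ x) (t • P (D x)) (by rw [map_smul, h.idem])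
    rw [hB, hD] at h1
    have h2 : ‖t • P (D x)‖ ^ 2 = t ^ 2 * d := by rw [norm_smul, mul_pow, Real.norm_eq_abs, sq_abs]
    have h3 : ‖t • P (D x) - D x‖ ^ 2 = (t - 1) ^ 2 * d + e := by
      have h4 : t • P (D x) - D x = (t - 1) • P (D x) - offPart D P x := by
        rw [offPart_apply, sub_smul, one_smul]; abel
      have h5 : ⟪P (D x), offPart D P x⟫ = 0 := by
        rw [h.symm, h.P_offPart, inner_zero_right]
      rw [h4, norm_sub_sq_real, real_inner_smul_left, h5, norm_smul, mul_pow, Real.norm_eq_abs,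
        sq_abs]
      ring
    rw [h2, h3] at h1
    refine le_trans ?_ h1
    have := h.lamH_pos
    nlinarith [sq_nonneg ‖(LinearMap.ker B ⊓ LinearMap.ker D)ᗮ.starProjection x‖]
  rw [h.norm_sq_D x, ← hd, ← he]
  have hμ := h.lamH_mul_nu
  have hlam := h.lamH_pos
  have hmulν : ∀ t : ℝ, lamH * ν * (t ^ 2 * d) ≤ ν * b + ((t - 1) ^ 2 * d + e) := by
    intro t
    have := mul_le_mul_of_nonneg_left (key t) hν.le
    have h6 : ν * (b + 1 / ν * ((t - 1) ^ 2 * d + e)) = ν * b + ((t - 1) ^ 2 * d + e) := by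
      field_simp
    linarith
  have goal' : lamH * ν * (d + e) ≤ ν * b + e := by
    set μ := lamH * ν
    rcases hμ.eq_or_lt with h1 | h1
    -- At μ = 1 the family reads (2t - 1) d ≤ ν b + e for all t, which forces d = 0.
    · have h2 : d = 0 := by
        by_contra hne
        have hdpos : 0 < d := lt_of_le_of_ne hd0 (Ne.symm hne)
        have h3 := hmulν ((ν * b + e + 2 * d) / d)
        rw [h1] at h3
        have h4 : (ν * b + e + 2 * d) / d * d = ν * b + e + 2 * d := by field_simp
        nlinarith [mul_nonneg hν.le hb0]
      rw [h2, h1]; nlinarith [mul_nonneg hν.le hb0]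
    · have h1' : 0 < 1 - μ := by linarith
      have hμ0 : 0 < μ := mul_pos hlam hν
      -- This t maximises μ t² - (t - 1)², with maximum μ / (1 - μ).
      have h2 := hmulν (1 / (1 - μ))
      have h3 : μ * d ≤ (1 - μ) * (ν * b + e) := by
        have h4 : μ * ((1 / (1 - μ)) ^ 2 * d) - (1 / (1 - μ) - 1) ^ 2 * d = μ * d / (1 - μ) := by
          field_simp; ring
        have h5 : μ * d / (1 - μ) ≤ ν * b + e := by linarith
        rw [div_le_iff₀ h1'] at h5
        linarith
      nlinarith [mul_nonneg hν.le hb0, mul_nonneg hμ0.le (mul_nonneg hν.le hb0)]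
  have h7 : ν * (lamH * (d + e)) ≤ ν * (b + 1 / ν * e) := by
    have h6 : ν * (b + 1 / ν * e) = ν * b + e := by field_simp
    linarith
  exact le_of_mul_le_mul_left h7 hν

/-- The map is symmetric with kernel inside ker B ⊓ ker D, so its range contains the orthogonal
complement. Projecting a solution there changes neither B x nor D x. -/
theorem exists_schur_eq {y : E} (hy : y ∈ (LinearMap.ker B ⊓ LinearMap.ker D)ᗮ) :
    ∃ x ∈ (LinearMap.ker B ⊓ LinearMap.ker D)ᗮ, schur B D P ν x = y := by
  have h1 : LinearMap.ker (schur B D P ν) ≤ LinearMap.ker B ⊓ LinearMap.ker D := by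
    intro x hx
    obtain ⟨h2, h3⟩ := h.eq_zero_of_schur_eq_zero (LinearMap.mem_ker.1 hx)
    have h4 := h.lamH_mul_norm_sq_D_le x
    rw [h2, h3] at h4
    simp only [norm_zero, ne_eq, OfNat.ofNat_ne_zero, not_false_eq_true, zero_pow, mul_zero,
      add_zero] at h4
    have h5 : ‖D x‖ ^ 2 ≤ 0 := by
      by_contra hc
      exact absurd h4 (not_le.2 (mul_pos h.lamH_pos (not_le.1 hc)))
    exact ⟨h2, by simpa using le_antisymm h5 (sq_nonneg _)⟩
  have h2 : y ∈ LinearMap.range (schur B D P ν) := by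
    have := Submodule.orthogonal_le h1 hy
    rwa [LinearMap.orthogonal_ker, (schur_isSymmetric B D P ν).adjoint_eq] at this
  obtain ⟨x, hx⟩ := h2
  obtain ⟨hB, hD⟩ := h.sub_starProjection_mem x
  refine ⟨_, Submodule.starProjection_apply_mem (LinearMap.ker B ⊓ LinearMap.ker D)ᗮ x, ?_⟩
  rw [← hx, schur_apply, schur_apply, hB, offPart_apply, hD, ← offPart_apply]

theorem adjoint_B_mem (w : G) : B.adjoint w ∈ (LinearMap.ker B ⊓ LinearMap.ker D)ᗮ := by
  refine Submodule.orthogonal_le (inf_le_left : LinearMap.ker B ⊓ LinearMap.ker D ≤ _) ?_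
  rw [LinearMap.orthogonal_ker]
  exact ⟨w, rfl⟩

theorem adjoint_D_mem (f : F) : D.adjoint f ∈ (LinearMap.ker B ⊓ LinearMap.ker D)ᗮ := by
  refine Submodule.orthogonal_le (inf_le_right : LinearMap.ker B ⊓ LinearMap.ker D ≤ _) ?_
  rw [LinearMap.orthogonal_ker]
  exact ⟨f, rfl⟩

/-- The response of the oracle to noise, outside the support. -/
theorem norm_offPart_le {x : E} {e : G} (hx : schur B D P ν x = B.adjoint e) :
    1 / ν * ‖offPart D P x‖ ≤ LamX / lamD * ‖e‖ := by
  have hν := h.nu_pos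
  have hl := h.lamD_pos
  have hX := h.LamX_pos
  -- The residual e - B x is no longer than e, since ⟪e, B x⟫ is the full energy of x and so at
  -- least ‖B x‖². The adjoint of the off-part is then inverted on its range.
  have h1 : (1 / ν) • (offPart D P).adjoint (offPart D P x) = B.adjoint (e - B x) := by
    rw [map_sub, ← hx, schur_apply]; abel
  have h2 := norm_le_mul_norm_adjoint (offPart D P) h.off_ge x
  have h3 : 1 / ν * ‖(offPart D P).adjoint (offPart D P x)‖ ≤ LamX * ‖e - B x‖ := by
    have h4 := adjoint_apply_norm_le h.LamX_pos.le h.B_le (e - B x)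
    rwa [← h1, norm_smul, Real.norm_of_nonneg (by positivity)] at h4
  have h5 : ‖e - B x‖ ≤ ‖e‖ := by
    refine le_of_sq_le_sq ?_ (norm_nonneg _)
    have h6 : ⟪e, B x⟫ = ‖B x‖ ^ 2 + 1 / ν * ‖offPart D P x‖ ^ 2 := by
      rw [← LinearMap.adjoint_inner_left, ← hx, inner_schur_self]
    have h7 : 0 ≤ 1 / ν * ‖offPart D P x‖ ^ 2 := by positivity
    rw [norm_sub_sq_real, h6]
    nlinarith [sq_nonneg ‖B x‖]
  calc 1 / ν * ‖offPart D P x‖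
      ≤ 1 / ν * (lamD⁻¹ * ‖(offPart D P).adjoint (offPart D P x)‖) := by gcongr
    _ = lamD⁻¹ * (1 / ν * ‖(offPart D P).adjoint (offPart D P x)‖) := by ring
    _ ≤ lamD⁻¹ * (LamX * ‖e‖) := by
        refine mul_le_mul_of_nonneg_left (h3.trans ?_) (by positivity)
        gcongr
    _ = LamX / lamD * ‖e‖ := by ring

/-- Pairing the Schur equation with a vector of ker D kills the off-support term: in those
directions x is an ordinary least squares solution. -/
theorem starProjection_residual {x : E} {e : G} (hx : schur B D P ν x = B.adjoint e) :
    (Submodule.map B (LinearMap.ker D)).starProjection (e - B x) = 0 := by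
  rw [Submodule.starProjection_apply_eq_zero_iff, Submodule.mem_orthogonal]
  rintro _ ⟨k, hk, rfl⟩
  have hk' : D k = 0 := hk
  have h1 : B.adjoint (e - B x) = (1 / ν) • (offPart D P).adjoint (offPart D P x) := by
    rw [map_sub, ← hx, schur_apply]; abel
  rw [real_inner_comm, ← LinearMap.adjoint_inner_left, h1, real_inner_smul_left,
    LinearMap.adjoint_inner_left, offPart_apply (x := k), hk', map_zero, sub_zero,
    inner_zero_right, mul_zero]

/-- The response of the oracle to noise, through the analysis operator. -/
theorem norm_D_le {x : E} {e : G} (hx : schur B D P ν x = B.adjoint e) :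
    lamH * ‖D x‖ ≤ LamX / lamD * ‖e‖ := by
  have hl := h.lamD_pos
  have hX := h.LamX_pos
  set W := Submodule.map B (LinearMap.ker D) with hW
  -- Subtracting k ∈ ker D keeps D x and replaces e by its component orthogonal to W. The right-hand
  -- side becomes orthogonal to ker D, hence of the form D†c with c controlled.
  obtain ⟨k, hk, hkW⟩ : W.starProjection (B x) ∈ W := Submodule.starProjection_apply_mem _ _
  have hk' : D k = 0 := hk
  have hres := h.starProjection_residual hx
  change W.starProjection (e - B x) = 0 at hres
  rw [map_sub, sub_eq_zero] at hres
  have hD : D (x - k) = D x := by rw [map_sub, hk', sub_zero]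
  have hoff : offPart D P (x - k) = offPart D P x := by rw [offPart_apply, hD, offPart_apply]
  have hA : schur B D P ν (x - k) = B.adjoint (e - W.starProjection e) := by
    rw [schur_apply, hoff, map_sub B, map_sub, map_sub, ← hx, schur_apply, hkW, hres]; abel
  have hmem : B.adjoint (e - W.starProjection e) ∈ (LinearMap.ker D)ᗮ := by
    rw [Submodule.mem_orthogonal]
    intro v hv
    rw [LinearMap.adjoint_inner_right]
    exact Submodule.inner_right_of_mem_orthogonal (Submodule.mem_map_of_mem hv)
      (Submodule.sub_starProjection_mem_orthogonal e)
  obtain ⟨c, hc, hcn⟩ := exists_adjoint_preimage D h.D_ge hmem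
  have h1 := h.lamH_mul_norm_sq_D_le (x - k)
  rw [← inner_schur_self, hA, ← hc, LinearMap.adjoint_inner_left, hD] at h1
  have h2 := h1.trans (real_inner_le_norm c (D x))
  have h3 : ‖e - W.starProjection e‖ ≤ ‖e‖ := by
    have := Submodule.norm_sq_eq_add_norm_sq_starProjection e W
    rw [Submodule.starProjection_orthogonal_val] at this
    refine le_of_sq_le_sq ?_ (norm_nonneg _)
    nlinarith [sq_nonneg ‖W.starProjection e‖]
  have h4 : ‖c‖ ≤ LamX / lamD * ‖e‖ := by
    refine hcn.trans ?_
    have := adjoint_apply_norm_le h.LamX_pos.le h.B_le (e - W.starProjection e)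
    calc lamD⁻¹ * ‖B.adjoint (e - W.starProjection e)‖ ≤ lamD⁻¹ * (LamX * ‖e‖) := by
          refine mul_le_mul_of_nonneg_left (this.trans ?_) (by positivity)
          gcongr
      _ = LamX / lamD * ‖e‖ := by ring
  refine le_trans ?_ h4
  rcases (norm_nonneg (D x)).eq_or_lt with h0 | h0
  · rw [← h0]; simp
  · nlinarith

/-- The response of the oracle to noise. -/
theorem norm_le_of_schur_eq {x : E} {e : G} (hx : schur B D P ν x = B.adjoint e)
    (hxL : x ∈ (LinearMap.ker B ⊓ LinearMap.ker D)ᗮ) :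
    ‖x‖ ≤ lamD⁻¹ * ‖D x‖ + i1 * (‖(Submodule.map B (LinearMap.ker D)).starProjection e‖
      + LamX * (lamD⁻¹ * ‖D x‖)) := by
  have hi := h.i1_nonneg
  have hX := h.LamX_pos
  set W := Submodule.map B (LinearMap.ker D) with hW
  set x1 := x - (LinearMap.ker D).starProjection x with hx1
  set x2 := (LinearMap.ker D).starProjection x with hx2
  have hm2 : x2 ∈ LinearMap.ker D := Submodule.starProjection_apply_mem _ _
  have hm1 : x1 ∈ (LinearMap.ker D)ᗮ := Submodule.sub_starProjection_mem_orthogonal x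
  have hm1' : x1 ∈ (LinearMap.ker B ⊓ LinearMap.ker D)ᗮ :=
    Submodule.orthogonal_le inf_le_right hm1
  have hm2' : x2 ∈ (LinearMap.ker B ⊓ LinearMap.ker D)ᗮ := by
    have : x2 = x - x1 := by rw [hx1]; abel
    rw [this]; exact Submodule.sub_mem _ hxL hm1'
  have hD1 : D x1 = D x := by rw [hx1, map_sub, LinearMap.mem_ker.1 hm2, sub_zero]
  have hn1 : ‖x1‖ ≤ lamD⁻¹ * ‖D x‖ := by rw [← hD1]; exact h.D_ge _ hm1
  have hres := h.starProjection_residual hx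
  change W.starProjection (e - B x) = 0 at hres
  rw [map_sub, sub_eq_zero] at hres
  -- The component in ker D sees only the projection of the noise on W; this is the origin of the
  -- dimension r' in the β bound.
  have hB2 : B x2 = W.starProjection e - W.starProjection (B x1) := by
    have h1 : W.starProjection (B x2) = B x2 :=
      Submodule.starProjection_eq_self_iff.2 (Submodule.mem_map_of_mem hm2)
    rw [hres, ← map_sub, ← map_sub, ← h1]
    congr 2
    rw [hx1]; abel
  have hn2 : ‖x2‖ ≤ i1 * (‖W.starProjection e‖ + LamX * (lamD⁻¹ * ‖D x‖)) := by
    refine (h.ker_ge x2 hm2 hm2').trans (mul_le_mul_of_nonneg_left ?_ hi)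
    rw [hB2]
    refine (norm_sub_le _ _).trans (add_le_add le_rfl ?_)
    refine (W.norm_starProjection_apply_le _).trans ((h.B_le x1).trans ?_)
    gcongr
  have hsum : x = x1 + x2 := by rw [hx1]; abel
  rw [hsum]
  refine (norm_add_le _ _).trans ?_
  rw [← hsum]
  exact add_le_add hn1 hn2

end Design

end Oracle

/-! ### The irrepresentable condition for general right-hand sides. -/

section Irrepresentable

variable {E G ι : Type*} [Fintype ι]
    [NormedAddCommGroup E] [InnerProductSpace ℝ E] [FiniteDimensional ℝ E]
    [NormedAddCommGroup G] [InnerProductSpace ℝ G] [FiniteDimensional ℝ G]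

/-- The irrepresentable condition, phrased through the Schur complement. -/
def IrrSchur (B : E →ₗ[ℝ] G) (D : E →ₗ[ℝ] EuclideanSpace ℝ ι)
    (P : EuclideanSpace ℝ ι →ₗ[ℝ] EuclideanSpace ℝ ι) (ν η : ℝ) : Prop :=
  ∀ ρ : EuclideanSpace ℝ ι, (∀ i, |ρ i| ≤ 1) → ∀ x, schur B D P ν x = D.adjoint (P ρ) →
    ∀ j, 1 / ν * |offPart D P x j| ≤ 1 - η

theorem abs_apply_le_norm (f : EuclideanSpace ℝ ι) (i : ι) : |f i| ≤ ‖f‖ := by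
  simpa using PiLp.norm_apply_le f i

namespace Design

variable {B : E →ₗ[ℝ] G} {D : E →ₗ[ℝ] EuclideanSpace ℝ ι}
  {P : EuclideanSpace ℝ ι →ₗ[ℝ] EuclideanSpace ℝ ι} {ν lamD LamX lamH i1 η : ℝ}
  (h : Design B D P ν lamD LamX lamH i1)

include h

/-- Superposition: the solutions need not be unique, but their off-parts are, so bounds for two
right-hand sides add. -/
theorem abs_offPart_le_add {x y : E} {b c : E}
    (hx : schur B D P ν x = b + c) (hc : c ∈ (LinearMap.ker B ⊓ LinearMap.ker D)ᗮ)
    (hy : schur B D P ν y = b) {u v : ℝ} {j : ι} (hu : 1 / ν * |offPart D P y j| ≤ u)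
    (hv : ∀ z, schur B D P ν z = c → 1 / ν * |offPart D P z j| ≤ v) :
    1 / ν * |offPart D P x j| ≤ u + v := by
  obtain ⟨z, -, hz⟩ := h.exists_schur_eq hc
  have h1 : offPart D P x = offPart D P (y + z) :=
    h.offPart_eq_of_schur_eq (by rw [hx, map_add, hy, hz])
  have hν := h.nu_pos
  rw [h1, map_add, PiLp.add_apply]
  calc 1 / ν * |offPart D P y j + offPart D P z j|
      ≤ 1 / ν * (|offPart D P y j| + |offPart D P z j|) := by gcongr; exact abs_add_le _ _
    _ = 1 / ν * |offPart D P y j| + 1 / ν * |offPart D P z j| := by ring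
    _ ≤ u + v := add_le_add hu (hv z hz)

theorem abs_offPart_le_of_P (hη : 0 ≤ η) (hI : IrrSchur B D P ν η) {x : E}
    {f : EuclideanSpace ℝ ι} (hx : schur B D P ν x = D.adjoint (P f)) (j : ι) :
    1 / ν * |offPart D P x j| ≤ ‖f‖ := by
  have hν := h.nu_pos
  rcases (norm_nonneg f).eq_or_lt with h0 | h0
  · have hf : f = 0 := norm_eq_zero.1 h0.symm
    rw [hf, map_zero, map_zero] at hx
    rw [(h.eq_zero_of_schur_eq_zero hx).2]
    simp
  · have h1 := hI (‖f‖⁻¹ • f) (fun i => by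
      rw [PiLp.smul_apply, smul_eq_mul, abs_mul, abs_inv, abs_norm, inv_mul_le_iff₀ h0, mul_one]
      exact abs_apply_le_norm f i) (‖f‖⁻¹ • x) (by
        rw [map_smul, hx, map_smul, map_smul]) j
    rw [map_smul, PiLp.smul_apply, smul_eq_mul, abs_mul, abs_inv, abs_norm] at h1
    have h2 : 1 / ν * (‖f‖⁻¹ * |offPart D P x j|) = ‖f‖⁻¹ * (1 / ν * |offPart D P x j|) := by ring
    rw [h2, inv_mul_le_iff₀ h0] at h1
    nlinarith

/-- No irrepresentability is needed here: pairing the equation with x bounds the energy by ‖c‖ ‖off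
x‖. -/
theorem abs_offPart_le_of_off {x : E} {c : EuclideanSpace ℝ ι}
    (hx : schur B D P ν x = (offPart D P).adjoint c) (j : ι) :
    1 / ν * |offPart D P x j| ≤ ‖c‖ := by
  have hν := h.nu_pos
  have h1 := inner_schur_self B D P ν x
  rw [hx, LinearMap.adjoint_inner_left] at h1
  have h2 := real_inner_le_norm c (offPart D P x)
  have h3 : 1 / ν * ‖offPart D P x‖ ^ 2 ≤ ‖c‖ * ‖offPart D P x‖ := by
    nlinarith [sq_nonneg ‖B x‖]
  have h4 : 1 / ν * ‖offPart D P x‖ ≤ ‖c‖ := by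
    rcases (norm_nonneg (offPart D P x)).eq_or_lt with h0 | h0
    · rw [← h0]; simp
    · have : 1 / ν * ‖offPart D P x‖ * ‖offPart D P x‖ ≤ ‖c‖ * ‖offPart D P x‖ := by linarith
      exact le_of_mul_le_mul_right this h0
  refine le_trans ?_ h4
  gcongr
  exact abs_apply_le_norm _ j

/-- D†d splits along P; one part is bounded by irrepresentability, the other by the energy, whence
the factor 2. -/
theorem abs_offPart_le_of_adjoint (hη : 0 ≤ η) (hI : IrrSchur B D P ν η) {x : E}
    {d : EuclideanSpace ℝ ι} (hx : schur B D P ν x = D.adjoint d) (j : ι) :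
    1 / ν * |offPart D P x j| ≤ 2 * ‖d‖ := by
  rw [h.adjoint_D_eq] at hx
  obtain ⟨y, -, hy⟩ := h.exists_schur_eq (h.adjoint_D_mem (P d))
  rw [two_mul]
  refine h.abs_offPart_le_add hx ?_ hy (h.abs_offPart_le_of_P hη hI hy j)
    fun z hz => h.abs_offPart_le_of_off hz j
  rw [h.adjoint_offPart]
  exact h.adjoint_D_mem _

theorem abs_offPart_le_of_orthogonal (hη : 0 ≤ η) (hI : IrrSchur B D P ν η) {x b : E}
    (hb : b ∈ (LinearMap.ker D)ᗮ) (hx : schur B D P ν x = b) (j : ι) :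
    1 / ν * |offPart D P x j| ≤ 2 * (lamD⁻¹ * ‖b‖) := by
  obtain ⟨c, hc, hcn⟩ := exists_adjoint_preimage D h.D_ge hb
  exact (h.abs_offPart_le_of_adjoint hη hI (hx.trans hc.symm) j).trans (by gcongr)

/-- The adjoint of B restricted to ker D is B† followed by projection onto ker D. A preimage of b
under it therefore matches b up to an error orthogonal to ker D. -/
theorem exists_adjoint_sub_mem {b : E} (hbD : b ∈ LinearMap.ker D)
    (hb : b ∈ (LinearMap.ker B ⊓ LinearMap.ker D)ᗮ) :
    ∃ w, ‖w‖ ≤ i1 * ‖b‖ ∧ B.adjoint w - b ∈ (LinearMap.ker D)ᗮ := by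
  set T := B.domRestrict (LinearMap.ker D) with hT
  have hk : ∀ x ∈ (LinearMap.ker T)ᗮ, ‖x‖ ≤ i1 * ‖T x‖ := by
    intro x hx
    refine h.ker_ge x x.2 ?_
    rw [Submodule.mem_orthogonal]
    rintro v ⟨hv1, hv2⟩
    exact (Submodule.mem_orthogonal _ _).1 hx ⟨v, hv2⟩ hv1
  have hb' : (⟨b, hbD⟩ : LinearMap.ker D) ∈ (LinearMap.ker T)ᗮ := by
    rw [Submodule.mem_orthogonal]
    intro v hv
    exact (Submodule.mem_orthogonal _ _).1 hb v ⟨hv, v.2⟩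
  obtain ⟨w, hw, hwn⟩ := exists_adjoint_preimage T hk hb'
  refine ⟨w, hwn, ?_⟩
  rw [Submodule.mem_orthogonal]
  intro v hv
  have h1 : ⟪T.adjoint w, (⟨v, hv⟩ : LinearMap.ker D)⟫ = ⟪w, B v⟫ := by
    rw [LinearMap.adjoint_inner_left]; rfl
  rw [hw] at h1
  have h2 : ⟪b, v⟫ = ⟪w, B v⟫ := h1
  rw [inner_sub_right, LinearMap.adjoint_inner_right, real_inner_comm, real_inner_comm b, h2,
    sub_self]

/-- Write b = B†w - r with r orthogonal to ker D. The noise bound for w costs one unit and the bound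
for r two, whence the factor 3. -/
theorem abs_offPart_le_of_ker (hη : 0 ≤ η) (hI : IrrSchur B D P ν η) {x b : E}
    (hbD : b ∈ LinearMap.ker D) (hb : b ∈ (LinearMap.ker B ⊓ LinearMap.ker D)ᗮ)
    (hx : schur B D P ν x = b) (j : ι) :
    1 / ν * |offPart D P x j| ≤ 3 * (LamX * i1 / lamD * ‖b‖) := by
  have hX := h.LamX_pos
  have hl := h.lamD_pos
  have hν := h.nu_pos
  have hi := h.i1_nonneg
  obtain ⟨w, hw, hr⟩ := h.exists_adjoint_sub_mem hbD hb
  set r := B.adjoint w - b with hrdef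
  have hBw : ‖B.adjoint w‖ ≤ LamX * ‖w‖ := adjoint_apply_norm_le hX.le h.B_le w
  have hrn : ‖r‖ ≤ ‖B.adjoint w‖ := by
    have h1 : B.adjoint w = b + r := by rw [hrdef]; abel
    have h2 : ⟪b, r⟫ = 0 := Submodule.inner_right_of_mem_orthogonal hbD hr
    refine le_of_sq_le_sq ?_ (norm_nonneg _)
    rw [h1, norm_add_sq_real, h2]
    nlinarith [sq_nonneg ‖b‖]
  have hrL : -r ∈ (LinearMap.ker B ⊓ LinearMap.ker D)ᗮ :=
    Submodule.neg_mem _ (Submodule.orthogonal_le inf_le_right hr)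
  obtain ⟨y, -, hy⟩ := h.exists_schur_eq (h.adjoint_B_mem w)
  have h1 : 1 / ν * |offPart D P y j| ≤ LamX / lamD * ‖w‖ := by
    refine le_trans ?_ (h.norm_offPart_le hy)
    gcongr
    exact abs_apply_le_norm _ j
  have h2 := h.abs_offPart_le_add (b := B.adjoint w) (c := -r) (v := 2 * (lamD⁻¹ * ‖r‖))
    (by rw [hx, hrdef]; abel) hrL hy h1
    (fun z hz => by
      have := h.abs_offPart_le_of_orthogonal hη hI (Submodule.neg_mem _ hr) hz j
      rwa [norm_neg] at this)
  refine h2.trans ?_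
  have h3 : ‖r‖ ≤ LamX * (i1 * ‖b‖) := hrn.trans (hBw.trans (by gcongr))
  calc LamX / lamD * ‖w‖ + 2 * (lamD⁻¹ * ‖r‖)
      ≤ LamX / lamD * (i1 * ‖b‖) + 2 * (lamD⁻¹ * (LamX * (i1 * ‖b‖))) := by gcongr
    _ = 3 * (LamX * i1 / lamD * ‖b‖) := by field_simp; ring

/-- The control of the dual variable outside the support that the irrepresentable condition
gives. -/
theorem abs_offPart_le (hη : 0 ≤ η) (hI : IrrSchur B D P ν η) {x b : E}
    {ρ g : EuclideanSpace ℝ ι} (hρ : ∀ i, |ρ i| ≤ 1)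
    (hb : b ∈ (LinearMap.ker B ⊓ LinearMap.ker D)ᗮ)
    (hx : schur B D P ν x = D.adjoint (P (ρ + g)) + b) (j : ι) :
    1 / ν * |offPart D P x j|
      ≤ (1 - η) + ‖g‖ + 2 * (lamD⁻¹ * ‖b‖) + 3 * (LamX * i1 / lamD * ‖b‖) := by
  have hX := h.LamX_pos
  have hl := h.lamD_pos
  have hi := h.i1_nonneg
  -- The two parts of b are reached through different operators: D† off ker D, B† on it.
  set b2 := (LinearMap.ker D).starProjection b with hb2
  set b1 := b - b2 with hb1
  have hm2 : b2 ∈ LinearMap.ker D := Submodule.starProjection_apply_mem _ _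
  have hm1 : b1 ∈ (LinearMap.ker D)ᗮ := Submodule.sub_starProjection_mem_orthogonal b
  have hm1' : b1 ∈ (LinearMap.ker B ⊓ LinearMap.ker D)ᗮ :=
    Submodule.orthogonal_le inf_le_right hm1
  have hm2' : b2 ∈ (LinearMap.ker B ⊓ LinearMap.ker D)ᗮ := by
    have : b2 = b - b1 := by rw [hb1]; abel
    rw [this]; exact Submodule.sub_mem _ hb hm1'
  have hn2 : ‖b2‖ ≤ ‖b‖ := Submodule.norm_starProjection_apply_le _ b
  have hn1 : ‖b1‖ ≤ ‖b‖ := by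
    have h1 : b = b2 + b1 := by rw [hb1]; abel
    have h2 : ⟪b2, b1⟫ = 0 := Submodule.inner_right_of_mem_orthogonal hm2 hm1
    refine le_of_sq_le_sq ?_ (norm_nonneg _)
    conv_rhs => rw [h1]
    rw [norm_add_sq_real, h2]
    nlinarith [sq_nonneg ‖b2‖]
  obtain ⟨y1, -, hy1⟩ := h.exists_schur_eq (h.adjoint_D_mem (P ρ))
  obtain ⟨y2, -, hy2⟩ := h.exists_schur_eq (h.adjoint_D_mem (P (ρ + g)))
  obtain ⟨y3, -, hy3⟩ := h.exists_schur_eq (Submodule.add_mem _ (h.adjoint_D_mem (P (ρ + g))) hm1')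
  have e2 := h.abs_offPart_le_add (j := j) (b := D.adjoint (P ρ)) (c := D.adjoint (P g))
    (by rw [hy2, map_add, map_add]) (h.adjoint_D_mem _) hy1 (hI ρ hρ y1 hy1 j)
    (fun z hz => h.abs_offPart_le_of_P hη hI hz j)
  have e3 := h.abs_offPart_le_add hy3 hm1' hy2 e2
    (fun z hz => h.abs_offPart_le_of_orthogonal hη hI hm1 hz j)
  have e4 := h.abs_offPart_le_add (x := x) (c := b2) (by rw [hx, hb1]; abel) hm2' hy3 e3
    (fun z hz => h.abs_offPart_le_of_ker hη hI hm2 hm2' hz j)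
  refine e4.trans ?_
  gcongr

end Design

end Irrepresentable

/-! ### Soft thresholding and the scalar Bregman divergence. -/

section Soft

/-- Scalar soft thresholding at level `1`. -/
noncomputable def soft (x : ℝ) : ℝ := Real.sign x * max (|x| - 1) 0

theorem abs_sub_soft_le (x : ℝ) : |x - soft x| ≤ 1 := by
  unfold soft
  rcases lt_trichotomy x 0 with hx | hx | hx
  · rw [Real.sign_of_neg hx, abs_of_neg hx]
    rcases max_cases (-x - 1) 0 with h | h <;> rw [h.1, abs_le] <;> constructor <;> linarith
  · simp [hx]
  · rw [Real.sign_of_pos hx, abs_of_pos hx]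
    rcases max_cases (x - 1) 0 with h | h <;> rw [h.1, abs_le] <;> constructor <;> linarith

/-- With `abs_sub_soft_le` this says that x - soft x is a subgradient of the absolute value at soft
x. -/
theorem sub_soft_mul_soft (x : ℝ) : (x - soft x) * soft x = |soft x| := by
  unfold soft
  rcases lt_trichotomy x 0 with hx | hx | hx
  · rw [Real.sign_of_neg hx, abs_of_neg hx]
    rcases max_cases (-x - 1) 0 with h | h
    · rw [h.1, abs_of_nonpos (by linarith)]; ring
    · rw [h.1]; simp
  · simp [hx]
  · rw [Real.sign_of_pos hx, abs_of_pos hx]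
    rcases max_cases (x - 1) 0 with h | h
    · rw [h.1, abs_of_nonneg (by linarith)]; ring
    · rw [h.1]; simp

theorem soft_eq_zero_of_abs_le {x : ℝ} (hx : |x| ≤ 1) : soft x = 0 := by
  rw [soft, max_eq_right (by linarith), mul_zero]

/-- `soft` is firmly nonexpansive. -/
theorem sq_soft_sub_le (x y : ℝ) : (soft y - soft x) ^ 2 ≤ (soft y - soft x) * (y - x) := by
  have hx := abs_le.1 (abs_sub_soft_le x)
  have hy := abs_le.1 (abs_sub_soft_le y)
  have h1 : (x - soft x) * soft y ≤ (y - soft y) * soft y := by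
    rw [sub_soft_mul_soft y]
    refine (le_abs_self _).trans ?_
    rw [abs_mul]
    exact mul_le_of_le_one_left (abs_nonneg _) (abs_sub_soft_le x)
  have h2 : (y - soft y) * soft x ≤ (x - soft x) * soft x := by
    rw [sub_soft_mul_soft x]
    refine (le_abs_self _).trans ?_
    rw [abs_mul]
    exact mul_le_of_le_one_left (abs_nonneg _) (abs_sub_soft_le y)
  nlinarith

/-- The descent inequality for soft²/2, whose derivative soft is 1-Lipschitz. -/
theorem sq_soft_le (x y : ℝ) :
    soft y ^ 2 ≤ soft x ^ 2 + 2 * soft x * (y - x) + (y - x) ^ 2 := by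
  have h1 : (x - soft x) * soft y ≤ |soft y| := by
    refine (le_abs_self _).trans ?_
    rw [abs_mul]
    exact mul_le_of_le_one_left (abs_nonneg _) (abs_sub_soft_le x)
  have h2 := sub_soft_mul_soft y
  nlinarith [sq_nonneg ((y - soft y) - (x - soft x))]

/-- The Bregman divergence term of one coordinate. -/
noncomputable def bregTerm (x o : ℝ) : ℝ := |o| - (x - soft x) * o

theorem bregTerm_nonneg (x o : ℝ) : 0 ≤ bregTerm x o := by
  have h1 : (x - soft x) * o ≤ |o| := by
    refine (le_abs_self _).trans ?_
    rw [abs_mul]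
    exact mul_le_of_le_one_left (abs_nonneg _) (abs_sub_soft_le x)
  unfold bregTerm; linarith

/-- An error below |o| forces soft x to have the sign of o, so the subgradient is that sign. -/
theorem bregTerm_eq_zero {κ x o : ℝ} (hκ : 0 < κ) (h : |κ * soft x - o| < |o|) :
    bregTerm x o = 0 := by
  have h1 := sub_soft_mul_soft x
  have h2 : 0 < soft x * o := by
    have h3 := sq_lt_sq.2 h
    have h4 : (0 : ℝ) < κ * (soft x * o) := by nlinarith [sq_nonneg (κ * soft x)]
    exact (mul_pos_iff_of_pos_left hκ).1 h4
  unfold bregTerm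
  rcases pos_and_pos_or_neg_and_neg_of_mul_pos h2 with ⟨h3, h4⟩ | ⟨h3, h4⟩
  · rw [abs_of_pos h3] at h1
    have h5 : x - soft x = 1 := by
      have : (x - soft x - 1) * soft x = 0 := by linarith
      rcases mul_eq_zero.1 this with h6 | h6 <;> linarith
    rw [h5, abs_of_pos h4]; ring
  · rw [abs_of_neg h3] at h1
    have h5 : x - soft x = -1 := by
      have : (x - soft x + 1) * soft x = 0 := by linarith
      rcases mul_eq_zero.1 this with h6 | h6 <;> linarith
    rw [h5, abs_of_neg h4]; ring

theorem bregTerm_le_two_mul (x o : ℝ) : bregTerm x o ≤ 2 * |o| := by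
  have h1 : -((x - soft x) * o) ≤ |o| := by
    refine (neg_le_abs _).trans ?_
    rw [abs_mul]
    exact mul_le_of_le_one_left (abs_nonneg _) (abs_sub_soft_le x)
  unfold bregTerm; linarith

theorem bregTerm_le {κ : ℝ} (hκ : 0 < κ) (x o : ℝ) : bregTerm x o ≤ 2 * |κ * soft x - o| := by
  by_cases h : |κ * soft x - o| < |o|
  · rw [bregTerm_eq_zero hκ h]; positivity
  · linarith [bregTerm_le_two_mul x o]

/-- Either the divergence vanishes or the error is at least |o| ≥ g, and then a factor g can be
traded for the error. -/
theorem mul_bregTerm_le {κ g : ℝ} (hκ : 0 < κ) (x o : ℝ) (hg : 0 ≤ g) (ho : g ≤ |o|) :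
    g * bregTerm x o ≤ 2 * (κ * soft x - o) ^ 2 := by
  by_cases h : |κ * soft x - o| < |o|
  · rw [bregTerm_eq_zero hκ h]; nlinarith [sq_nonneg (κ * soft x - o)]
  · have h1 := bregTerm_le_two_mul x o
    have h2 := bregTerm_nonneg x o
    rw [← sq_abs (κ * soft x - o)]
    nlinarith [abs_nonneg o]

/-- As a function of z the left side is -z o + (κ/2) soft(z)² plus a constant, so `sq_soft_le`
applies and no subgradient remains. -/
theorem bregTerm_step {κ : ℝ} (hκ : 0 < κ) (x y o : ℝ) :
    bregTerm y o + (κ * soft y - o) ^ 2 / (2 * κ)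
      ≤ bregTerm x o + (κ * soft x - o) ^ 2 / (2 * κ) + (y - x) * (κ * soft x - o)
        + κ / 2 * (y - x) ^ 2 := by
  have h1 := mul_le_mul_of_nonneg_left (sq_soft_le x y) (by positivity : 0 ≤ κ / 2)
  have h2 : ∀ t : ℝ, bregTerm t o + (κ * soft t - o) ^ 2 / (2 * κ)
      = |o| - t * o + κ / 2 * soft t ^ 2 + o ^ 2 / (2 * κ) := by
    intro t
    unfold bregTerm
    field_simp
    ring
  rw [h2, h2]
  linarith

end Soft

/-! ### The coordinate projection onto S. -/

section Mask

variable {m : ℕ}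

/-- The coordinate projection onto `S`. -/
noncomputable def mask (S : Finset (Fin m)) :
    EuclideanSpace ℝ (Fin m) →ₗ[ℝ] EuclideanSpace ℝ (Fin m) where
  toFun f := WithLp.toLp 2 fun j => if j ∈ S then f j else 0
  map_add' f g := by
    ext j
    by_cases hj : j ∈ S <;> simp [hj]
  map_smul' c f := by
    ext j
    by_cases hj : j ∈ S <;> simp [hj]

@[simp]
theorem mask_apply (S : Finset (Fin m)) (f : EuclideanSpace ℝ (Fin m)) (j : Fin m) :
    mask S f j = if j ∈ S then f j else 0 := rfl

theorem mask_isSymmetric (S : Finset (Fin m)) : (mask S).IsSymmetric := by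
  intro f g
  rw [PiLp.inner_apply, PiLp.inner_apply]
  refine Finset.sum_congr rfl fun j _ => ?_
  by_cases hj : j ∈ S <;> simp [hj]

theorem mask_mask (S : Finset (Fin m)) (f : EuclideanSpace ℝ (Fin m)) :
    mask S (mask S f) = mask S f := by
  ext j
  by_cases hj : j ∈ S <;> simp [hj]

theorem inner_mask_eq_sum (S : Finset (Fin m)) (f g : EuclideanSpace ℝ (Fin m)) :
    ⟪mask S f, g⟫ = ∑ j ∈ S, f j * g j := by
  rw [PiLp.inner_apply, ← Finset.sum_filter_add_sum_filter_not Finset.univ (· ∈ S)]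
  have h2 : (∑ j ∈ Finset.univ.filter (fun j => ¬ j ∈ S), ⟪mask S f j, g j⟫) = 0 :=
    Finset.sum_eq_zero fun j hj => by simp [(Finset.mem_filter.1 hj).2]
  rw [h2, add_zero, Finset.filter_mem_eq_inter, Finset.univ_inter]
  refine Finset.sum_congr rfl fun j hj => ?_
  simp [hj, mul_comm]

theorem norm_sq_mask (S : Finset (Fin m)) (f : EuclideanSpace ℝ (Fin m)) :
    ‖mask S f‖ ^ 2 = ∑ j ∈ S, f j ^ 2 := by
  rw [← real_inner_self_eq_norm_sq, inner_mask_eq_sum]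
  refine Finset.sum_congr rfl fun j hj => ?_
  simp [hj, sq]

theorem shrink_apply (z : EuclideanSpace ℝ (Fin m)) (j : Fin m) : shrink z 1 j = soft (z j) := rfl

end Mask

/-! ### The Hessian as a quadratic form and its two components. -/

section Energy

variable {E F G : Type*}
    [NormedAddCommGroup E] [InnerProductSpace ℝ E] [FiniteDimensional ℝ E]
    [NormedAddCommGroup F] [InnerProductSpace ℝ F] [FiniteDimensional ℝ F]
    [NormedAddCommGroup G] [InnerProductSpace ℝ G] [FiniteDimensional ℝ G]
    (B : E →ₗ[ℝ] G) (D : E →ₗ[ℝ] F) (ν : ℝ)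

/-- The quadratic form of the Hessian of the loss. -/
noncomputable def energy (x : E) (g : F) : ℝ := ‖B x‖ ^ 2 + 1 / ν * ‖g - D x‖ ^ 2

/-- The first component of the Hessian of the loss. -/
noncomputable def hessE (x : E) (g : F) : E :=
  B.adjoint (B x) + (1 / ν) • D.adjoint (D x - g)

/-- The second component of the Hessian of the loss. -/
noncomputable def hessF (x : E) (g : F) : F := (1 / ν) • (g - D x)

theorem energy_add (x x' : E) (g g' : F) :
    energy B D ν (x + x') (g + g') = energy B D ν x g
      + 2 * (⟪hessE B D ν x g, x'⟫ + ⟪hessF D ν x g, g'⟫) + energy B D ν x' g' := by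
  have h1 : g + g' - D (x + x') = (g - D x) + (g' - D x') := by rw [map_add]; abel
  have h2 : D x - g = -(g - D x) := by abel
  rw [energy, h1, map_add, norm_add_sq_real, norm_add_sq_real, hessE, hessF, inner_add_left,
    real_inner_smul_left, real_inner_smul_left, LinearMap.adjoint_inner_left,
    LinearMap.adjoint_inner_left, h2, inner_neg_left, inner_sub_right (g - D x), energy, energy]
  ring

theorem energy_smul (t : ℝ) (x : E) (g : F) :
    energy B D ν (t • x) (t • g) = t ^ 2 * energy B D ν x g := by
  rw [energy, energy, map_smul, map_smul, ← smul_sub, norm_smul, norm_smul, mul_pow, mul_pow,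
    Real.norm_eq_abs, sq_abs]
  ring

theorem inner_hess_self (x : E) (g : F) :
    ⟪hessE B D ν x g, x⟫ + ⟪hessF D ν x g, g⟫ = energy B D ν x g := by
  have h1 := energy_add B D ν x x g g
  have h2 := energy_smul B D ν 2 x g
  rw [two_smul, two_smul] at h2
  linarith

theorem energy_nonneg {ν : ℝ} (hν : 0 < ν) (x : E) (g : F) : 0 ≤ energy B D ν x g := by
  unfold energy; positivity

theorem energy_le {ν LamX LamD : ℝ} (hν : 0 < ν) (hB : ∀ x, ‖B x‖ ≤ LamX * ‖x‖)
    (hD : ∀ x, ‖D x‖ ≤ LamD * ‖x‖) (x : E) (g : F) :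
    energy B D ν x g ≤ 2 * (1 + ν * LamX ^ 2 + LamD ^ 2) / ν * (‖x‖ ^ 2 + ‖g‖ ^ 2) := by
  have h1 : ‖B x‖ ^ 2 ≤ LamX ^ 2 * ‖x‖ ^ 2 := by
    rw [← mul_pow]; exact pow_le_pow_left₀ (norm_nonneg _) (hB x) 2
  have h2 : ‖D x‖ ^ 2 ≤ LamD ^ 2 * ‖x‖ ^ 2 := by
    rw [← mul_pow]; exact pow_le_pow_left₀ (norm_nonneg _) (hD x) 2
  have h3 : ‖g - D x‖ ^ 2 ≤ 2 * (‖g‖ ^ 2 + LamD ^ 2 * ‖x‖ ^ 2) := by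
    have := pow_le_pow_left₀ (norm_nonneg _) (norm_sub_le g (D x)) 2
    nlinarith [sq_nonneg (‖g‖ - ‖D x‖)]
  have h4 : 1 / ν * ‖g - D x‖ ^ 2 ≤ 1 / ν * (2 * (‖g‖ ^ 2 + LamD ^ 2 * ‖x‖ ^ 2)) := by gcongr
  have h5 : 2 * (1 + ν * LamX ^ 2 + LamD ^ 2) / ν * (‖x‖ ^ 2 + ‖g‖ ^ 2)
      = LamX ^ 2 * ‖x‖ ^ 2 + 1 / ν * (2 * (‖g‖ ^ 2 + LamD ^ 2 * ‖x‖ ^ 2))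
        + (LamX ^ 2 * ‖x‖ ^ 2 + 2 * (LamX ^ 2 * ‖g‖ ^ 2)
          + 1 / ν * (2 * (‖x‖ ^ 2 + LamD ^ 2 * ‖g‖ ^ 2))) := by
    field_simp; ring
  have h6 : 0 ≤ LamX ^ 2 * ‖x‖ ^ 2 + 2 * (LamX ^ 2 * ‖g‖ ^ 2)
          + 1 / ν * (2 * (‖x‖ ^ 2 + LamD ^ 2 * ‖g‖ ^ 2)) := by positivity
  rw [energy]
  linarith

/-- The inequality A² ≤ h A for 0 ≤ A ≤ h, compressed by P: the form is nonnegative along the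
compressed gradient, and t = 1/h is the best step. -/
theorem norm_sq_hess_le {P : F →ₗ[ℝ] F} (hP : P.IsSymmetric) (hPi : ∀ f, P (P f) = P f) {h : ℝ}
    (hν : 0 < ν) (hh : ∀ x g, energy B D ν x g ≤ h * (‖x‖ ^ 2 + ‖g‖ ^ 2)) (x : E) (g : F) :
    ‖hessE B D ν x g‖ ^ 2 + ‖P (hessF D ν x g)‖ ^ 2 ≤ h * energy B D ν x g := by
  set u := hessE B D ν x g with hu
  set v := P (hessF D ν x g) with hv
  set N := ‖u‖ ^ 2 + ‖v‖ ^ 2 with hN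
  have hN0 : 0 ≤ N := by positivity
  have hq := energy_nonneg B D hν x g
  have key : ∀ t : ℝ, 0 ≤ energy B D ν x g - 2 * t * N + t ^ 2 * (h * N) := by
    intro t
    have h1 := energy_nonneg B D hν (x + (-t) • u) (g + (-t) • v)
    rw [energy_add, energy_smul, real_inner_smul_right, real_inner_smul_right, ← hu,
      real_inner_self_eq_norm_sq] at h1
    have h2 : ⟪hessF D ν x g, v⟫ = ‖v‖ ^ 2 := by
      rw [← real_inner_self_eq_norm_sq v, hv, hP, hPi]
    rw [h2] at h1
    have h3 := mul_le_mul_of_nonneg_left (hh u v) (sq_nonneg t)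
    nlinarith
  rcases hN0.eq_or_lt with h0 | h0
  · rw [← h0]
    have h2 := hh x g
    rcases le_or_gt 0 h with h3 | h3
    · positivity
    · have : energy B D ν x g ≤ 0 := h2.trans (mul_nonpos_of_nonpos_of_nonneg h3.le (by positivity))
      rw [le_antisymm this hq, mul_zero]
  · rcases le_or_gt h 0 with h3 | h3
    · have h4 := key ((energy B D ν x g + 1) / N)
      have h5 : (energy B D ν x g + 1) / N * N = energy B D ν x g + 1 := by field_simp
      have h6 : ((energy B D ν x g + 1) / N) ^ 2 * (h * N) ≤ 0 :=
        mul_nonpos_of_nonneg_of_nonpos (sq_nonneg _) (mul_nonpos_of_nonpos_of_nonneg h3 hN0)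
      nlinarith
    · have h4 := key (1 / h)
      have h5 : (1 / h) ^ 2 * (h * N) = 1 / h * N := by field_simp
      have h6 : 1 / h * N ≤ energy B D ν x g := by nlinarith
      rw [one_div, inv_mul_le_iff₀ h3] at h6
      exact h6

end Energy

/-! ### The oracle iteration: Bregman descent, monotone energy, summed equations. -/

section Path

variable {m : ℕ} {E G : Type*}
    [NormedAddCommGroup E] [InnerProductSpace ℝ E] [FiniteDimensional ℝ E]
    [NormedAddCommGroup G] [InnerProductSpace ℝ G] [FiniteDimensional ℝ G]

/-- The Split LBI iteration in which the sparse variable is kept supported in `S`. -/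
structure OraclePath (B : E →ₗ[ℝ] G) (D : E →ₗ[ℝ] EuclideanSpace ℝ (Fin m)) (S : Finset (Fin m))
    (ν κ α : ℝ) (w : G) (b : ℕ → E) (z g : ℕ → EuclideanSpace ℝ (Fin m)) : Prop where
  b_zero : b 0 = 0
  z_zero : z 0 = 0
  b_succ : ∀ k, b (k + 1) = b k - (κ * α) •
    (B.adjoint (B (b k) - w) + (1 / ν) • D.adjoint (D (b k) - g k))
  z_succ : ∀ k, z (k + 1) = z k - α • ((1 / ν) • (g k - D (b k)))
  g_eq : ∀ k, g k = mask S (κ • shrink (z k) 1)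

/-- The Bregman divergence from the state `(b, z)` to `(b₀, g₀)`. -/
noncomputable def breg (S : Finset (Fin m)) (κ : ℝ) (b₀ : E) (g₀ : EuclideanSpace ℝ (Fin m))
    (b : E) (z g : EuclideanSpace ℝ (Fin m)) : ℝ :=
  (∑ j ∈ S, bregTerm (z j) (g₀ j)) + (‖b - b₀‖ ^ 2 + ‖g - g₀‖ ^ 2) / (2 * κ)

namespace OraclePath

variable {B : E →ₗ[ℝ] G} {D : E →ₗ[ℝ] EuclideanSpace ℝ (Fin m)} {S : Finset (Fin m)}
  {ν κ α : ℝ} {w : G} {b : ℕ → E} {z g : ℕ → EuclideanSpace ℝ (Fin m)} {b₀ : E}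
  {g₀ : EuclideanSpace ℝ (Fin m)}
  (hp : OraclePath B D S ν κ α w b z g) (hb₀ : schur B D (mask S) ν b₀ = B.adjoint w)
  (hg₀ : g₀ = mask S (D b₀))

include hp

theorem g_apply (k : ℕ) (j : Fin m) : g k j = if j ∈ S then κ * soft (z k j) else 0 := by
  rw [hp.g_eq, mask_apply, PiLp.smul_apply, shrink_apply, smul_eq_mul]

theorem mask_g (k : ℕ) : mask S (g k) = g k := by
  rw [hp.g_eq, mask_mask]

include hb₀ hg₀

theorem mask_sub (k : ℕ) : mask S (g k - g₀) = g k - g₀ := by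
  rw [map_sub, hp.mask_g, hg₀, mask_mask]

omit hp in
theorem hessE_oracle : B.adjoint (B b₀ - w) + (1 / ν) • D.adjoint (D b₀ - g₀) = 0 := by
  have h1 : D.adjoint (D b₀ - g₀) = (offPart D (mask S)).adjoint (offPart D (mask S) b₀) := by
    refine ext_inner_right ℝ fun v => ?_
    rw [LinearMap.adjoint_inner_left, LinearMap.adjoint_inner_left, offPart_apply, offPart_apply,
      inner_sub_right, ← mask_isSymmetric, map_sub, mask_mask, sub_self, inner_zero_left, sub_zero,
      hg₀]
  rw [h1, map_sub, ← hb₀, schur_apply]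
  abel

/-- The oracle is a stationary point, so subtracting its vanishing gradient removes the data w. -/
theorem b_succ' (k : ℕ) : b (k + 1) - b₀ = (b k - b₀) + (-(κ * α)) •
    hessE B D ν (b k - b₀) (g k - g₀) := by
  have h1 : B.adjoint (B (b k) - w) + (1 / ν) • D.adjoint (D (b k) - g k)
      = hessE B D ν (b k - b₀) (g k - g₀) := by
    rw [← sub_zero (B.adjoint (B (b k) - w) + _), ← hessE_oracle hb₀ hg₀, hessE]
    simp only [map_sub, smul_sub]
    abel
  rw [hp.b_succ, h1, neg_smul]
  abel

theorem z_succ' (k : ℕ) {j : Fin m} (hj : j ∈ S) :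
    z (k + 1) j = z k j - α * hessF D ν (b k - b₀) (g k - g₀) j := by
  have h1 : g₀ j = D b₀ j := by rw [hg₀, mask_apply, if_pos hj]
  rw [hp.z_succ, hessF, map_sub]
  simp only [PiLp.sub_apply, PiLp.smul_apply, smul_eq_mul, h1]
  ring

theorem inner_mask_z (k : ℕ) (f : EuclideanSpace ℝ (Fin m)) :
    ∑ j ∈ S, (z (k + 1) j - z k j) * f j
      = -α * ⟪mask S (hessF D ν (b k - b₀) (g k - g₀)), f⟫ := by
  rw [inner_mask_eq_sum, Finset.mul_sum]
  refine Finset.sum_congr rfl fun j hj => ?_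
  rw [hp.z_succ' hb₀ hg₀ k hj]; ring

/-- The mirror descent step: first-order terms in both variables combine into the energy through
`inner_hess_self`, leaving the squared gradient. -/
theorem breg_step (hκ : 0 < κ) (k : ℕ) :
    breg S κ b₀ g₀ (b (k + 1)) (z (k + 1)) (g (k + 1)) ≤ breg S κ b₀ g₀ (b k) (z k) (g k)
      - α * energy B D ν (b k - b₀) (g k - g₀)
      + κ * α ^ 2 / 2 * (‖hessE B D ν (b k - b₀) (g k - g₀)‖ ^ 2
        + ‖mask S (hessF D ν (b k - b₀) (g k - g₀))‖ ^ 2) := by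
  have hg : ∀ i, ‖g i - g₀‖ ^ 2 = ∑ j ∈ S, (κ * soft (z i j) - g₀ j) ^ 2 := by
    intro i
    rw [← hp.mask_sub hb₀ hg₀, norm_sq_mask]
    refine Finset.sum_congr rfl fun j hj => ?_
    rw [PiLp.sub_apply, hp.g_apply, if_pos hj]
  have h1 : ∀ i, breg S κ b₀ g₀ (b i) (z i) (g i)
      = ∑ j ∈ S, (bregTerm (z i j) (g₀ j) + (κ * soft (z i j) - g₀ j) ^ 2 / (2 * κ))
        + ‖b i - b₀‖ ^ 2 / (2 * κ) := by
    intro i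
    rw [breg, hg, Finset.sum_add_distrib, ← Finset.sum_div]
    ring
  set u := hessE B D ν (b k - b₀) (g k - g₀) with hu
  set v := hessF D ν (b k - b₀) (g k - g₀) with hv
  have h2 := Finset.sum_le_sum fun j (_ : j ∈ S) => bregTerm_step hκ (z k j) (z (k + 1) j) (g₀ j)
  simp only [Finset.sum_add_distrib] at h2
  have h3 : ∑ j ∈ S, (z (k + 1) j - z k j) * (κ * soft (z k j) - g₀ j)
      = -α * ⟪v, g k - g₀⟫ := by
    have e1 : ⟪v, g k - g₀⟫ = ⟪mask S v, g k - g₀⟫ := by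
      rw [mask_isSymmetric, hp.mask_sub hb₀ hg₀]
    rw [e1, ← hp.inner_mask_z hb₀ hg₀]
    refine Finset.sum_congr rfl fun j hj => ?_
    rw [PiLp.sub_apply, hp.g_apply, if_pos hj]
  have h4 : ∑ j ∈ S, κ / 2 * (z (k + 1) j - z k j) ^ 2 = κ * α ^ 2 / 2 * ‖mask S v‖ ^ 2 := by
    rw [norm_sq_mask, Finset.mul_sum]
    refine Finset.sum_congr rfl fun j hj => ?_
    rw [hp.z_succ' hb₀ hg₀ k hj]; ring
  have h5 : ‖b (k + 1) - b₀‖ ^ 2 / (2 * κ)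
      = ‖b k - b₀‖ ^ 2 / (2 * κ) - α * ⟪u, b k - b₀⟫ + κ * α ^ 2 / 2 * ‖u‖ ^ 2 := by
    rw [hp.b_succ' hb₀ hg₀, ← hu, norm_add_sq_real, real_inner_smul_right, norm_smul, mul_pow,
      Real.norm_eq_abs, sq_abs, real_inner_comm u]
    field_simp
    ring
  have h6 := inner_hess_self B D ν (b k - b₀) (g k - g₀)
  rw [← hu, ← hv] at h6
  rw [h1, h1, h5, ← h6]
  simp only [Finset.sum_add_distrib]
  rw [h3, h4] at h2
  linarith

/-- The first-order terms lose 2κα‖u‖² and, as soft thresholding is firmly nonexpansive, at least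
2‖δ‖²/(κα). The condition κ α h ≤ 2 bounds the quadratic term by their sum. -/
theorem energy_step (hκ : 0 < κ) (hα : 0 < α) {h : ℝ}
    (hh : ∀ x g, energy B D ν x g ≤ h * (‖x‖ ^ 2 + ‖g‖ ^ 2)) (hh2 : κ * α * h ≤ 2) (k : ℕ) :
    energy B D ν (b (k + 1) - b₀) (g (k + 1) - g₀) ≤ energy B D ν (b k - b₀) (g k - g₀) := by
  set u := hessE B D ν (b k - b₀) (g k - g₀) with hu
  set v := hessF D ν (b k - b₀) (g k - g₀) with hv
  set δ := g (k + 1) - g k with hδ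
  have hg : g (k + 1) - g₀ = (g k - g₀) + δ := by rw [hδ]; abel
  have hκα : 0 < κ * α := mul_pos hκ hα
  rw [hg, hp.b_succ' hb₀ hg₀, energy_add, ← hu, ← hv, real_inner_smul_right,
    real_inner_self_eq_norm_sq]
  have h1 : κ * α * ⟪v, δ⟫ ≤ -‖δ‖ ^ 2 := by
    have hδm : mask S δ = δ := by rw [hδ, map_sub, hp.mask_g, hp.mask_g]
    have e1 : ⟪v, δ⟫ = ⟪mask S v, δ⟫ := by rw [mask_isSymmetric, hδm]
    have e2 : κ * α * ⟪v, δ⟫ = -(κ * ∑ j ∈ S, (z (k + 1) j - z k j) * δ j) := by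
      rw [hp.inner_mask_z hb₀ hg₀, e1]; ring
    rw [e2, neg_le_neg_iff, ← hδm, norm_sq_mask, hδm, Finset.mul_sum]
    refine Finset.sum_le_sum fun j hj => ?_
    have e3 : δ j = κ * (soft (z (k + 1) j) - soft (z k j)) := by
      rw [hδ, PiLp.sub_apply, hp.g_apply, hp.g_apply, if_pos hj, if_pos hj]; ring
    rw [e3]
    have := mul_le_mul_of_nonneg_left (sq_soft_sub_le (z k j) (z (k + 1) j)) (sq_nonneg κ)
    nlinarith
  have h2 := hh ((-(κ * α)) • u) δ
  have h3 : ‖(-(κ * α)) • u‖ ^ 2 = (κ * α) ^ 2 * ‖u‖ ^ 2 := by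
    rw [norm_smul, mul_pow, Real.norm_eq_abs, sq_abs]; ring
  rw [h3] at h2
  have h4 : κ * α * energy B D ν ((-(κ * α)) • u) δ ≤ 2 * ((κ * α) ^ 2 * ‖u‖ ^ 2 + ‖δ‖ ^ 2) := by
    have e1 := mul_le_mul_of_nonneg_left h2 hκα.le
    have e2 : κ * α * h * ((κ * α) ^ 2 * ‖u‖ ^ 2 + ‖δ‖ ^ 2)
        ≤ 2 * ((κ * α) ^ 2 * ‖u‖ ^ 2 + ‖δ‖ ^ 2) :=
      mul_le_mul_of_nonneg_right hh2 (by positivity)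
    linarith
  have h5 : κ * α * (2 * (-(κ * α) * ‖u‖ ^ 2 + ⟪v, δ⟫) + energy B D ν ((-(κ * α)) • u) δ) ≤ 0 := by
    nlinarith
  have h6 : 2 * (-(κ * α) * ‖u‖ ^ 2 + ⟪v, δ⟫) + energy B D ν ((-(κ * α)) • u) δ ≤ 0 := by
    by_contra hc
    exact absurd h5 (not_le.2 (mul_pos hκα (not_le.1 hc)))
  linarith

/-- The equation satisfied by the summed iterates. -/
theorem schur_sum (hκ : κ ≠ 0) (k : ℕ) :
    schur B D (mask S) ν (∑ i ∈ Finset.range k, α • (b₀ - b i))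
      = D.adjoint (mask S (z k)) + κ⁻¹ • b k := by
  induction k with
  | zero => simp [hp.b_zero, hp.z_zero]
  | succ k ih =>
    rw [Finset.sum_range_succ, map_add, ih]
    set x := b k - b₀ with hx
    set f := g k - g₀ with hf
    have h1 : mask S (z (k + 1)) = mask S (z k) - α • mask S (hessF D ν x f) := by
      ext j
      by_cases hj : j ∈ S
      · simp only [mask_apply, if_pos hj, PiLp.sub_apply, PiLp.smul_apply, smul_eq_mul]
        rw [hp.z_succ' hb₀ hg₀ k hj]
      · simp [hj]
    have h2 : κ⁻¹ • b (k + 1) = κ⁻¹ • b k - α • hessE B D ν x f := by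
      have h3 : b (k + 1) = b k + (-(κ * α)) • hessE B D ν x f := by
        have := hp.b_succ' hb₀ hg₀ k
        rw [← hx, ← hf] at this
        rw [← sub_add_cancel (b (k + 1)) b₀, this, hx]; abel
      rw [h3, smul_add, smul_smul]
      have : κ⁻¹ * -(κ * α) = -α := by field_simp
      rw [this, neg_smul, sub_eq_add_neg]
    -- Block elimination of γ: as f is supported in S, each summand becomes an increment of D†P z
    -- and of b/κ, and the sum telescopes.
    have h3 : schur B D (mask S) ν x = D.adjoint (mask S (hessF D ν x f)) + hessE B D ν x f := by
      have e1 : mask S f = f := hp.mask_sub hb₀ hg₀ k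
      clear_value x f
      refine ext_inner_right ℝ fun y => ?_
      rw [inner_schur_left, inner_add_left, LinearMap.adjoint_inner_left, hessE, inner_add_left,
        real_inner_smul_left, LinearMap.adjoint_inner_left, LinearMap.adjoint_inner_left, hessF,
        map_smul, real_inner_smul_left, map_sub (mask S), e1, offPart_apply, offPart_apply]
      have e2 : ⟪D x - mask S (D x), D y - mask S (D y)⟫ = ⟪D x - mask S (D x), D y⟫ := by
        rw [inner_sub_right, ← mask_isSymmetric, map_sub, mask_mask, sub_self, inner_zero_left,
          sub_zero]
      rw [e2, inner_sub_left, inner_sub_left, inner_sub_left]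
      ring
    have h4 : α • (b₀ - b k) = (-α) • x := by rw [hx, neg_smul, ← smul_neg, neg_sub]
    rw [h4, map_smul, h3, h1, h2, map_sub, map_smul, smul_add, neg_smul, neg_smul]
    abel

/-- Off S the sparse variable is zero, so z accumulates (α/ν) D b_i; each b_i is written as b₀ - (b₀
- b_i). -/
theorem off_sum (k : ℕ) {j : Fin m} (hj : j ∉ S) :
    z k j = (k * α) * (1 / ν * offPart D (mask S) b₀ j)
      - 1 / ν * offPart D (mask S) (∑ i ∈ Finset.range k, α • (b₀ - b i)) j := by
  induction k with
  | zero => simp [hp.z_zero]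
  | succ k ih =>
    have h1 : ∀ x, offPart D (mask S) x j = D x j := fun x => by
      rw [offPart_apply, PiLp.sub_apply, mask_apply, if_neg hj, sub_zero]
    have h2 : g k j = 0 := by rw [hp.g_apply, if_neg hj]
    rw [Finset.sum_range_succ, map_add, PiLp.add_apply, hp.z_succ, PiLp.sub_apply, ih]
    simp only [PiLp.smul_apply, PiLp.sub_apply, smul_eq_mul, h2, h1, map_smul, map_sub]
    push_cast
    ring

omit hb₀ hg₀ in
theorem b_mem (k : ℕ) : b k ∈ (LinearMap.ker B ⊓ LinearMap.ker D)ᗮ := by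
  induction k with
  | zero => rw [hp.b_zero]; exact Submodule.zero_mem _
  | succ k ih =>
    rw [hp.b_succ]
    refine Submodule.sub_mem _ ih (Submodule.smul_mem _ _ (Submodule.add_mem _ ?_
      (Submodule.smul_mem _ _ ?_)))
    · refine Submodule.orthogonal_le (inf_le_left : LinearMap.ker B ⊓ LinearMap.ker D ≤ _) ?_
      rw [LinearMap.orthogonal_ker]
      exact ⟨_, rfl⟩
    · refine Submodule.orthogonal_le (inf_le_right : LinearMap.ker B ⊓ LinearMap.ker D ≤ _) ?_
      rw [LinearMap.orthogonal_ker]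
      exact ⟨_, rfl⟩

/-- Cauchy-Schwarz over S; this is where √s enters the rates. -/
theorem sq_sum_bregTerm_le (hκ : 0 < κ) (k : ℕ) :
    ∑ j ∈ S, bregTerm (z k j) (g₀ j) ≤ 2 * (Real.sqrt S.card * ‖g k - g₀‖) := by
  have h1 : ∑ j ∈ S, bregTerm (z k j) (g₀ j) ≤ 2 * ∑ j ∈ S, |(g k - g₀) j| := by
    rw [Finset.mul_sum]
    refine Finset.sum_le_sum fun j hj => ?_
    rw [PiLp.sub_apply, hp.g_apply, if_pos hj]
    exact bregTerm_le hκ _ _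
  refine h1.trans (mul_le_mul_of_nonneg_left ?_ zero_le_two)
  refine le_of_sq_le_sq ?_ (by positivity)
  rw [mul_pow, Real.sq_sqrt (Nat.cast_nonneg _), ← hp.mask_sub hb₀ hg₀, norm_sq_mask]
  refine (sq_sum_le_card_mul_sum_sq).trans (le_of_eq ?_)
  congr 1
  refine Finset.sum_congr rfl fun j hj => ?_
  rw [sq_abs, mask_apply, if_pos hj]

theorem mul_sum_bregTerm_le (hκ : 0 < κ) {c : ℝ} (hc : 0 ≤ c) (hcS : ∀ j ∈ S, c ≤ |g₀ j|) (k : ℕ) :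
    c * ∑ j ∈ S, bregTerm (z k j) (g₀ j) ≤ 2 * ‖g k - g₀‖ ^ 2 := by
  rw [← hp.mask_sub hb₀ hg₀, norm_sq_mask, Finset.mul_sum, Finset.mul_sum]
  refine Finset.sum_le_sum fun j hj => ?_
  rw [PiLp.sub_apply, hp.g_apply, if_pos hj]
  exact mul_bregTerm_le hκ _ _ hc (hcS j hj)

end OraclePath

end Path

/-! ### Scalar recursions governing the decay. -/

section Sequences

/-- Discrete form of ψ' = -r ψ²: with x = r Ψ and k x ≤ 1, (k + 1) x (1 - x) ≤ (1 + x)(1 - x) ≤ 1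
when x ≤ 1. -/
theorem mul_le_one_of_quadratic_decay {Ψ : ℕ → ℝ} {r : ℝ} (hr : 0 ≤ r) (h0 : ∀ k, 0 ≤ Ψ k)
    {K : ℕ} (hs : ∀ k < K, Ψ (k + 1) ≤ Ψ k - r * Ψ k ^ 2) : ∀ k ≤ K, r * k * Ψ k ≤ 1 := by
  intro k
  induction k with
  | zero => intro _; simp
  | succ k ih =>
    intro hk
    have ih := ih (by omega)
    have h1 := hs k (by omega)
    set x := r * Ψ k with hx
    have hx0 : 0 ≤ x := mul_nonneg hr (h0 k)
    have hkx : (k : ℝ) * x ≤ 1 := by rw [hx]; linarith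
    have h2 : r * Ψ (k + 1) ≤ x * (1 - x) := by
      have := mul_le_mul_of_nonneg_left h1 hr
      have e : r * (Ψ k - r * Ψ k ^ 2) = x * (1 - x) := by rw [hx]; ring
      linarith
    have h3 : ((k : ℝ) + 1) * (x * (1 - x)) ≤ 1 := by
      rcases le_or_gt x 1 with hx1 | hx1
      · nlinarith
      · have : x * (1 - x) ≤ 0 := mul_nonpos_of_nonneg_of_nonpos hx0 (by linarith)
        nlinarith [(Nat.cast_nonneg k : (0 : ℝ) ≤ k)]
    push_cast
    calc r * ((k : ℝ) + 1) * Ψ (k + 1) = ((k : ℝ) + 1) * (r * Ψ (k + 1)) := by ring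
      _ ≤ ((k : ℝ) + 1) * (x * (1 - x)) := by gcongr
      _ ≤ 1 := h3

theorem le_sub_mul_of_step {Ψ x : ℕ → ℝ} {e c : ℝ} (he : 0 ≤ e)
    {K : ℕ} (hs : ∀ k < K, Ψ (k + 1) ≤ Ψ k - e * x k) (hc : ∀ k < K, c ≤ x k) (k i : ℕ)
    (hki : k + i ≤ K) : Ψ (k + i) ≤ Ψ k - i * (e * c) := by
  induction i with
  | zero => simp
  | succ i ih =>
    have h1 := ih (by omega)
    have h2 := hs (k + i) (by omega)
    have h3 := mul_le_mul_of_nonneg_left (hc (k + i) (by omega)) he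
    rw [← add_assoc]
    push_cast
    linarith

/-- A discrete Bihari-type inequality. -/
theorem bihari_bound {Ψ x : ℕ → ℝ} {e A : ℝ} (he : 0 < e) (hA : 0 < A) (h0 : ∀ k, 0 ≤ Ψ k)
    (hs : ∀ k, Ψ (k + 1) ≤ Ψ k - e * x k) (hx : Antitone x) (hΨ : ∀ k, Ψ k ^ 2 ≤ A * x k)
    (K : ℕ) : (e * K) ^ 2 * x K ≤ 4 * A := by
  have hx0 : ∀ k, 0 ≤ x k := fun k => by
    have := (sq_nonneg (Ψ k)).trans (hΨ k)
    exact (mul_nonneg_iff_of_pos_left hA).1 this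
  -- The first half of the steps makes Ψ k ≤ A/(e k); each of the remaining i steps loses at least e
  -- x_K. The two halves of K + 1 satisfy 4 k i ≥ K².
  set k := (K + 1) / 2 with hk
  obtain ⟨i, hi⟩ : ∃ i, k + i = K + 1 := ⟨K + 1 - k, by omega⟩
  have h1 := le_sub_mul_of_step he.le (K := K + 1) (c := x K) (fun j _ => hs j)
    (fun j hj => hx (by omega)) k i hi.le
  have h2 := mul_le_one_of_quadratic_decay (Ψ := Ψ) (r := e / A) (by positivity) h0 (K := k)
    (fun j _ => by
      refine (hs j).trans (sub_le_sub_left ?_ _)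
      rw [div_mul_eq_mul_div, div_le_iff₀ hA]
      nlinarith [hΨ j]) k le_rfl
  have h3 : (i : ℝ) * (e * x K) ≤ Ψ k := by linarith [h0 (k + i)]
  have h4 : (K : ℝ) ^ 2 ≤ 4 * (k * i) := by
    have : K ^ 2 ≤ 4 * (k * i) := by
      rcases Nat.even_or_odd K with ⟨t, ht⟩ | ⟨t, ht⟩
      · have e1 : k = t := by omega
        have e2 : i = t + 1 := by omega
        rw [e1, e2, ht]; nlinarith
      · have e1 : k = t + 1 := by omega
        have e2 : i = t + 1 := by omega
        rw [e1, e2, ht]; nlinarith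
    exact_mod_cast this
  have h5 : e * k * Ψ k ≤ A := by
    have e1 : e / A * k * Ψ k = e * k * Ψ k / A := by ring
    rwa [e1, div_le_one hA] at h2
  calc (e * K) ^ 2 * x K = e ^ 2 * x K * (K : ℝ) ^ 2 := by ring
    _ ≤ e ^ 2 * x K * (4 * (k * i)) :=
        mul_le_mul_of_nonneg_left h4 (mul_nonneg (sq_nonneg _) (hx0 K))
    _ = 4 * (e * k * (i * (e * x K))) := by ring
    _ ≤ 4 * (e * k * Ψ k) := by gcongr
    _ ≤ 4 * A := by linarith

/-- The time at which the error drops below the signal level. -/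
theorem lt_of_three_phases {Ψ x : ℕ → ℝ} {e a c s : ℝ} (he : 0 < e) (ha : 0 < a) (hc : 0 < c)
    (hs1 : 1 ≤ s) (h0 : ∀ k, 0 ≤ Ψ k) (hs : ∀ k, Ψ (k + 1) ≤ Ψ k - e * x k) (hx : Antitone x)
    (hΨ : ∀ k, Ψ k ^ 2 ≤ a ^ 2 * s * x k) (hΨ2 : ∀ k, c ^ 2 ≤ x k → c * Ψ k ≤ a * x k) {K : ℕ}
    (hK : a * (2 + Real.log s) ≤ e * c * (K + 1 - 4)) : x K < c ^ 2 := by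
  by_contra hcon
  have hxk : ∀ k < K + 1, c ^ 2 ≤ x k := fun k hk => (not_lt.1 hcon).trans (hx (by omega))
  set θ := e * c / a with hθ
  have hθ0 : 0 < θ := by positivity
  have hs0 : 0 < s := by linarith
  have hlog : 0 ≤ Real.log s := Real.log_nonneg hs1
  -- N1 steps bring Ψ to a c s, N2 steps of factor 1 - θ bring it to a c, and N3 steps losing θ a c
  -- each would make it negative.
  obtain ⟨N1, hN1⟩ : ∃ N : ℕ, N = ⌈1 / θ⌉₊ := ⟨_, rfl⟩
  obtain ⟨N2, hN2⟩ : ∃ N : ℕ, N = ⌈Real.log s / θ⌉₊ := ⟨_, rfl⟩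
  obtain ⟨N3, hN3⟩ : ∃ N : ℕ, N = ⌊1 / θ⌋₊ + 1 := ⟨_, rfl⟩
  have b1 : 1 / θ ≤ N1 := by rw [hN1]; exact Nat.le_ceil _
  have b1' : (N1 : ℝ) < 1 / θ + 1 := by rw [hN1]; exact Nat.ceil_lt_add_one (by positivity)
  have b2 : Real.log s / θ ≤ N2 := by rw [hN2]; exact Nat.le_ceil _
  have b2' : (N2 : ℝ) < Real.log s / θ + 1 := by
    rw [hN2]; exact Nat.ceil_lt_add_one (by positivity)
  have b3 : 1 / θ < N3 := by rw [hN3]; push_cast; exact Nat.lt_floor_add_one _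
  have b3' : (N3 : ℝ) ≤ 1 / θ + 1 := by
    rw [hN3]; push_cast
    have := Nat.floor_le (by positivity : 0 ≤ 1 / θ)
    linarith
  -- The three roundings cost less than 3 steps in total, within the 4 granted by `hK`.
  have hKθ : (2 + Real.log s) / θ + 4 ≤ K + 1 := by
    have h1 : (2 + Real.log s) / θ ≤ K + 1 - 4 := by
      rw [div_le_iff₀ hθ0, hθ]
      have : ((K : ℝ) + 1 - 4) * (e * c / a) = (e * c * (K + 1 - 4)) / a := by ring
      rw [this, le_div_iff₀ ha]
      linarith
    linarith
  have hsplit : (2 + Real.log s) / θ = 1 / θ + Real.log s / θ + 1 / θ := by ring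
  have hN : N1 + N2 + N3 ≤ K + 1 := by
    have : ((N1 + N2 + N3 : ℕ) : ℝ) ≤ ((K + 1 : ℕ) : ℝ) := by push_cast; linarith
    exact_mod_cast this
  -- first phase
  have p1 : Ψ N1 ≤ a * c * s := by
    have h1 := mul_le_one_of_quadratic_decay (Ψ := Ψ) (r := e / (a ^ 2 * s)) (by positivity) h0
      (K := N1) (fun j _ => by
        refine (hs j).trans (sub_le_sub_left ?_ _)
        rw [div_mul_eq_mul_div, div_le_iff₀ (by positivity)]
        nlinarith [hΨ j]) N1 le_rfl
    have e1 : 1 ≤ θ * N1 := by rwa [div_le_iff₀ hθ0, mul_comm] at b1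
    have e2 : e / (a ^ 2 * s) * N1 * Ψ N1 = θ * N1 * (Ψ N1 / (a * c * s)) := by
      rw [hθ]; field_simp
    rw [e2] at h1
    have e3 : 0 ≤ Ψ N1 / (a * c * s) := div_nonneg (h0 _) (by positivity)
    have e4 : Ψ N1 / (a * c * s) ≤ 1 := by nlinarith
    rwa [div_le_one (by positivity)] at e4
  -- second phase
  have p2 : ∀ i, N1 + i ≤ K + 1 → Ψ (N1 + i) ≤ a * c * s * Real.exp (-θ * i) := by
    intro i
    induction i with
    | zero => intro _; simpa using p1
    | succ i ih =>
      intro hi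
      have h1 := ih (by omega)
      have h2 := hs (N1 + i)
      have h3 := hΨ2 (N1 + i) (hxk _ (by omega))
      have h4 : Ψ (N1 + (i + 1)) ≤ Ψ (N1 + i) * (1 - θ) := by
        have e1 : θ * Ψ (N1 + i) ≤ e * x (N1 + i) := by
          rw [hθ, div_mul_eq_mul_div, div_le_iff₀ ha]
          nlinarith
        rw [← add_assoc]; linarith
      have h5 : 1 - θ ≤ Real.exp (-θ) := by have := Real.add_one_le_exp (-θ); linarith
      calc Ψ (N1 + (i + 1)) ≤ Ψ (N1 + i) * (1 - θ) := h4
        _ ≤ Ψ (N1 + i) * Real.exp (-θ) := mul_le_mul_of_nonneg_left h5 (h0 _)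
        _ ≤ a * c * s * Real.exp (-θ * i) * Real.exp (-θ) := by gcongr
        _ = a * c * s * Real.exp (-θ * ((i + 1 : ℕ) : ℝ)) := by
          rw [mul_assoc, ← Real.exp_add]; push_cast; ring_nf
  have p2' : Ψ (N1 + N2) ≤ a * c := by
    refine (p2 N2 (by omega)).trans ?_
    have e1 : Real.exp (-θ * N2) ≤ s⁻¹ := by
      rw [← Real.exp_log (inv_pos.2 hs0), Real.log_inv]
      refine Real.exp_le_exp.2 ?_
      rw [div_le_iff₀ hθ0] at b2
      linarith
    calc a * c * s * Real.exp (-θ * N2) ≤ a * c * s * s⁻¹ := by gcongr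
      _ = a * c := by field_simp
  -- third phase
  have p3 := le_sub_mul_of_step he.le (K := K + 1) (c := c ^ 2) (fun j _ => hs j) hxk
    (N1 + N2) N3 hN
  have e1 : 1 < θ * N3 := by rwa [div_lt_iff₀ hθ0, mul_comm] at b3
  have e2 : (N3 : ℝ) * (e * c ^ 2) = a * c * (θ * N3) := by rw [hθ]; field_simp
  rw [e2] at p3
  have e3 : 0 < a * c * (θ * N3 - 1) := by
    have := sub_pos.2 e1
    positivity
  linarith [h0 (N1 + N2 + N3)]

end Sequences

/-! ### Deterministic consistency: bounded iterates and no false positives. -/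

section Regime

variable {m : ℕ} {E G : Type*}
    [NormedAddCommGroup E] [InnerProductSpace ℝ E] [FiniteDimensional ℝ E]
    [NormedAddCommGroup G] [InnerProductSpace ℝ G] [FiniteDimensional ℝ G]

/-- The deterministic situation in which the path of Split LBI is consistent: the design satisfies
the assumptions, the parameters are in range, and the noise `e` is small in the required norms.
Here `x` is the displacement of the oracle estimator and `l = √(log m / n)`. -/
structure Regime (B : E →ₗ[ℝ] G) (D : E →ₗ[ℝ] EuclideanSpace ℝ (Fin m)) (S : Finset (Fin m))
    (ν lamD LamD LamX lamH i1 η σ κ α hn lamH' τ l pe : ℝ) (βs x : E) (e : G)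
    (b : ℕ → E) (z g : ℕ → EuclideanSpace ℝ (Fin m)) : Prop where
  design : Design B D (mask S) ν lamD LamX lamH i1
  irr : IrrSchur B D (mask S) ν η
  eta_pos : 0 < η
  eta_le : η ≤ 1
  sigma_pos : 0 < σ
  kappa_pos : 0 < κ
  alpha_pos : 0 < α
  D_le : ∀ x, ‖D x‖ ≤ LamD * ‖x‖
  lamD_le : lamD ≤ LamD
  hess : ∀ x g, energy B D ν x g ≤ hn * (‖x‖ ^ 2 + ‖g‖ ^ 2)
  hn_nonneg : 0 ≤ hn
  step : κ * α * hn < 2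
  lamH'_eq : lamH' = lamH * (1 - κ * α * hn / 2)
  tau_mul : τ * l = η * lamD / (8 * σ * LamX)
  tau_gt : 5 * α < τ
  kappa_ge : kappaLower σ η ν lamD LamD LamX i1 ‖βs‖ lamH' ≤ κ
  card_pos : 1 ≤ S.card
  βs_mem : βs ∈ (LinearMap.ker B ⊓ LinearMap.ker D)ᗮ
  off_βs : offPart D (mask S) βs = 0
  x_mem : x ∈ (LinearMap.ker B ⊓ LinearMap.ker D)ᗮ
  x_eq : schur B D (mask S) ν x = B.adjoint e
  path : OraclePath B D S ν κ α (B βs + e) b z g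
  e_le : ‖e‖ ≤ 2 * σ
  on_le : ∀ j ∈ S, lamH * |D x j| ≤ 2 * σ * (LamX / lamD) * l
  off_le : ∀ j ∉ S, 1 / ν * |offPart D (mask S) x j| ≤ 2 * σ * (LamX / lamD) * l
  proj_le : ‖(Submodule.map B (LinearMap.ker D)).starProjection e‖ ≤ pe

namespace Regime

variable {B : E →ₗ[ℝ] G} {D : E →ₗ[ℝ] EuclideanSpace ℝ (Fin m)} {S : Finset (Fin m)}
  {ν lamD LamD LamX lamH i1 η σ κ α hn lamH' τ l pe : ℝ} {βs x : E} {e : G}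
  {b : ℕ → E} {z g : ℕ → EuclideanSpace ℝ (Fin m)}
  (h : Regime B D S ν lamD LamD LamX lamH i1 η σ κ α hn lamH' τ l pe βs x e b z g)

include h

theorem lamH'_pos : 0 < lamH' := by
  rw [h.lamH'_eq]
  have := h.step
  exact mul_pos h.design.lamH_pos (by linarith)

theorem lamH'_le : lamH' ≤ lamH := by
  rw [h.lamH'_eq]
  have := mul_nonneg (mul_pos h.kappa_pos h.alpha_pos).le h.hn_nonneg
  have := h.design.lamH_pos
  nlinarith

theorem schur_oracle : schur B D (mask S) ν (βs + x) = B.adjoint (B βs + e) := by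
  rw [map_add, map_add, h.x_eq, schur_apply, h.off_βs, map_zero, smul_zero, add_zero]

theorem off_oracle : offPart D (mask S) (βs + x) = offPart D (mask S) x := by
  rw [map_add, h.off_βs, zero_add]

theorem mask_D_βs : mask S (D βs) = D βs := by
  have := h.off_βs
  rw [offPart_apply, sub_eq_zero] at this
  exact this.symm

theorem tau_pos : 0 < τ := by linarith [h.tau_gt, h.alpha_pos]

/-- The stopping time is tuned so that noise accumulated up to τ uses a quarter of the margin η. -/
theorem noise_eq : 2 * σ * (LamX / lamD) * l = η / (4 * τ) := by
  have h1 := h.tau_mul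
  have := h.tau_pos
  have := h.sigma_pos
  have := h.design.LamX_pos
  have := h.design.lamD_pos
  rw [eq_div_iff (by positivity)] at h1
  rw [eq_div_iff (by positivity)]
  field_simp
  linarith

/-- The size of the oracle estimator. -/
theorem oracle_le : ‖βs + x‖ + ‖mask S (D (βs + x))‖ ≤ (1 + LamD) * ‖βs‖ + 2 * σ / lamH' *
    (LamX / lamD + LamX / lamD ^ 2 + (lamH' * lamD ^ 2 + LamX ^ 2) * i1 / lamD ^ 2) := by
  have hl' := h.lamH'_pos
  have hle := h.lamH'_le
  have hσ := h.sigma_pos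
  have hX := h.design.LamX_pos
  have hD := h.design.lamD_pos
  have hi := h.design.i1_nonneg
  have h1 : ‖D x‖ ≤ 2 * σ * LamX / (lamD * lamH') := by
    have h2 := h.design.norm_D_le h.x_eq
    have h3 : lamH' * ‖D x‖ ≤ LamX / lamD * (2 * σ) :=
      (mul_le_mul_of_nonneg_right hle (norm_nonneg _)).trans
        (h2.trans (mul_le_mul_of_nonneg_left h.e_le (by positivity)))
    rw [mul_comm, ← le_div_iff₀ hl'] at h3
    refine h3.trans (le_of_eq ?_)
    field_simp
  have h4 : ‖x‖ ≤ lamD⁻¹ * (2 * σ * LamX / (lamD * lamH'))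
      + i1 * (2 * σ + LamX * (lamD⁻¹ * (2 * σ * LamX / (lamD * lamH')))) := by
    refine (h.design.norm_le_of_schur_eq h.x_eq h.x_mem).trans ?_
    have h5 := (Submodule.norm_starProjection_apply_le
      (Submodule.map B (LinearMap.ker D)) e).trans h.e_le
    gcongr
  have h6 : ‖mask S (D (βs + x))‖ ≤ LamD * ‖βs‖ + 2 * σ * LamX / (lamD * lamH') := by
    rw [map_add, map_add]
    exact (norm_add_le _ _).trans (add_le_add ((h.design.norm_P_le _).trans (h.D_le _))
      ((h.design.norm_P_le _).trans h1))
  have h7 := norm_add_le βs x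
  have h8 : (1 + LamD) * ‖βs‖ + 2 * σ / lamH' *
      (LamX / lamD + LamX / lamD ^ 2 + (lamH' * lamD ^ 2 + LamX ^ 2) * i1 / lamD ^ 2)
      = (‖βs‖ + (lamD⁻¹ * (2 * σ * LamX / (lamD * lamH'))
      + i1 * (2 * σ + LamX * (lamD⁻¹ * (2 * σ * LamX / (lamD * lamH'))))))
      + (LamD * ‖βs‖ + 2 * σ * LamX / (lamD * lamH')) := by
    field_simp
    ring
  rw [h8]
  linarith

/-- The energy never exceeds its initial value, and since the path starts at zero the initial error
is the oracle itself. -/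
theorem energy_zero_le {M₀ : ℝ} (hM : ‖βs + x‖ + ‖mask S (D (βs + x))‖ ≤ M₀) (k : ℕ) :
    Real.sqrt (energy B D ν (b k - (βs + x)) (g k - mask S (D (βs + x))) / lamH)
      ≤ Real.sqrt (2 * (1 + ν * LamX ^ 2 + LamD ^ 2) / (lamH' * ν)) * M₀ := by
  have hν := h.design.nu_pos
  have hl' := h.lamH'_pos
  have hle := h.lamH'_le
  have hlH := h.design.lamH_pos
  have hM0 : 0 ≤ M₀ := (by positivity : 0 ≤ ‖βs + x‖ + ‖mask S (D (βs + x))‖).trans hM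
  rw [← Real.sqrt_sq hM0, ← Real.sqrt_mul (by positivity)]
  refine Real.sqrt_le_sqrt ?_
  have h1 : Antitone fun k => energy B D ν (b k - (βs + x)) (g k - mask S (D (βs + x))) :=
    antitone_nat_of_succ_le fun k => h.path.energy_step h.schur_oracle rfl h.kappa_pos h.alpha_pos
      h.hess h.step.le k
  have h2 := h1 (Nat.zero_le k)
  have hg0 : g 0 = 0 := by
    ext j
    rw [h.path.g_apply, h.path.z_zero]
    simp [soft]
  simp only [hg0, h.path.b_zero, zero_sub] at h2
  have h3 := energy_le B D hν h.design.B_le h.D_le (-(βs + x)) (-mask S (D (βs + x)))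
  rw [norm_neg, norm_neg] at h3
  have h4 : ‖βs + x‖ ^ 2 + ‖mask S (D (βs + x))‖ ^ 2 ≤ M₀ ^ 2 := by
    have := pow_le_pow_left₀ (by positivity) hM 2
    nlinarith [mul_nonneg (norm_nonneg (βs + x)) (norm_nonneg (mask S (D (βs + x))))]
  have h5 := h2.trans (h3.trans (mul_le_mul_of_nonneg_left h4 (by positivity)))
  rw [div_le_iff₀ hlH]
  refine h5.trans ?_
  have h6 : 2 * (1 + ν * LamX ^ 2 + LamD ^ 2) / (lamH' * ν) * M₀ ^ 2 * lamH
      = 2 * (1 + ν * LamX ^ 2 + LamD ^ 2) / ν * M₀ ^ 2 * (lamH / lamH') := by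
    field_simp
  rw [h6]
  exact le_mul_of_one_le_right (by positivity) ((one_le_div hl').2 hle)

theorem norm_sq_le (k : ℕ) :
    ‖b k - (βs + x)‖ ^ 2 + ‖g k - mask S (D (βs + x))‖ ^ 2
      ≤ energy B D ν (b k - (βs + x)) (g k - mask S (D (βs + x))) / lamH := by
  rw [le_div_iff₀ h.design.lamH_pos, mul_comm]
  exact h.design.coercive _ (Submodule.sub_mem _ (h.path.b_mem k)
    (Submodule.add_mem _ h.βs_mem h.x_mem)) _ (h.path.mask_sub h.schur_oracle rfl k)

/-- A bound on all iterates which `κ` dominates. -/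
theorem exists_bound : ∃ M, 0 ≤ M ∧
    4 / η * (1 + 1 / lamD + LamX * i1 / lamD) * M ≤ κ ∧
    ‖mask S (D (βs + x))‖ ≤ M ∧ (∀ k, ‖b k‖ ≤ M) ∧ (∀ k, ‖g k‖ ≤ M) ∧
    ∀ k, Real.sqrt (energy B D ν (b k - (βs + x)) (g k - mask S (D (βs + x))) / lamH) ≤ M := by
  have hM := h.oracle_le
  set M₀ := (1 + LamD) * ‖βs‖ + 2 * σ / lamH' *
    (LamX / lamD + LamX / lamD ^ 2 + (lamH' * lamD ^ 2 + LamX ^ 2) * i1 / lamD ^ 2) with hM₀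
  set R := Real.sqrt (2 * (1 + ν * LamX ^ 2 + LamD ^ 2) / (lamH' * ν)) with hR
  have hR0 : 0 ≤ R := Real.sqrt_nonneg _
  have hM0 : 0 ≤ M₀ := (by positivity : 0 ≤ ‖βs + x‖ + ‖mask S (D (βs + x))‖).trans hM
  have hb1 : ∀ k, ‖b k - (βs + x)‖ ≤ R * M₀ := fun k => by
    refine le_trans (Real.le_sqrt_of_sq_le ?_) (h.energy_zero_le hM k)
    exact le_trans (le_add_of_nonneg_right (sq_nonneg _)) (h.norm_sq_le k)
  have hg1 : ∀ k, ‖g k - mask S (D (βs + x))‖ ≤ R * M₀ := fun k => by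
    refine le_trans (Real.le_sqrt_of_sq_le ?_) (h.energy_zero_le hM k)
    exact le_trans (le_add_of_nonneg_left (sq_nonneg _)) (h.norm_sq_le k)
  have n1 := norm_nonneg (βs + x)
  have n2 := norm_nonneg (mask S (D (βs + x)))
  have n3 : 0 ≤ R * M₀ := mul_nonneg hR0 hM0
  -- R M₀ bounds the distance to the oracle and M₀ the oracle; the product is the last two factors
  -- of `kappaLower`.
  refine ⟨(1 + R) * M₀, by positivity, ?_, by nlinarith, fun k => ?_, fun k => ?_, fun k => ?_⟩
  · have := h.kappa_ge
    rw [kappaLower, ← hM₀, ← hR, mul_assoc] at this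
    exact this
  · have := norm_add_le (b k - (βs + x)) (βs + x)
    rw [sub_add_cancel] at this
    linarith [hb1 k]
  · have := norm_add_le (g k - mask S (D (βs + x))) (mask S (D (βs + x)))
    rw [sub_add_cancel] at this
    linarith [hg1 k]
  · linarith [h.energy_zero_le hM k]

/-- No false positives along the oracle path. -/
theorem abs_z_le (k : ℕ) (hk : k * α ≤ τ) {j : Fin m} (hj : j ∉ S) : |z k j| ≤ 1 := by
  obtain ⟨M, hM0, hκM, -, hb, hg, -⟩ := h.exists_bound
  have hν := h.design.nu_pos
  have hκ := h.kappa_pos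
  have hη := h.eta_pos
  have hX := h.design.LamX_pos
  have hD := h.design.lamD_pos
  have hi := h.design.i1_nonneg
  have hτ := h.tau_pos
  have hα := h.alpha_pos
  rw [h.path.off_sum h.schur_oracle rfl k hj, h.off_oracle]
  have h1 := h.path.schur_sum h.schur_oracle rfl hκ.ne' k
  set Y := ∑ i ∈ Finset.range k, α • (βs + x - b i) with hY
  -- The subgradient, with entries in [-1, 1], plays the role of ρ in the irrepresentable condition;
  -- the rest is of order 1/κ.
  have h2 : mask S (z k) = mask S ((z k - shrink (z k) 1) + κ⁻¹ • g k) := by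
    ext i
    by_cases hi : i ∈ S
    · simp only [mask_apply, if_pos hi, PiLp.add_apply, PiLp.sub_apply, PiLp.smul_apply,
        h.path.g_apply, shrink_apply, smul_eq_mul]
      field_simp
      ring
    · simp [hi]
  rw [h2] at h1
  have h3 := h.design.abs_offPart_le hη.le h.irr (ρ := z k - shrink (z k) 1) (g := κ⁻¹ • g k)
    (b := κ⁻¹ • b k) (fun i => abs_sub_soft_le (z k i)) (Submodule.smul_mem _ _ (h.path.b_mem k))
    h1 j
  have h4 : ∀ v : E, ‖v‖ ≤ M → ‖κ⁻¹ • v‖ ≤ M / κ := fun v hv => by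
    rw [norm_smul, Real.norm_of_nonneg (by positivity), inv_mul_eq_div]
    gcongr
  have h4' : ‖κ⁻¹ • g k‖ ≤ M / κ := by
    rw [norm_smul, Real.norm_of_nonneg (by positivity), inv_mul_eq_div]
    gcongr
    exact hg k
  have h5 : 1 / ν * |offPart D (mask S) Y j| ≤ (1 - η) + M / κ + 2 * (lamD⁻¹ * (M / κ))
      + 3 * (LamX * i1 / lamD * (M / κ)) := by
    refine h3.trans ?_
    have := h4 _ (hb k)
    gcongr
  -- All coefficients are at most 3, while the bound on κ makes the unweighted sum at most η/4.
  have h6 : M / κ + 2 * (lamD⁻¹ * (M / κ)) + 3 * (LamX * i1 / lamD * (M / κ)) ≤ 3 * η / 4 := by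
    have h7 : (1 + 1 / lamD + LamX * i1 / lamD) * (M / κ) ≤ η / 4 := by
      rw [mul_div_assoc', div_le_iff₀ hκ]
      have : 4 / η * (1 + 1 / lamD + LamX * i1 / lamD) * M
          = (1 + 1 / lamD + LamX * i1 / lamD) * M / (η / 4) := by field_simp
      rw [this, div_le_iff₀ (by positivity)] at hκM
      linarith
    have h8 : 0 ≤ M / κ := by positivity
    have h9 : 0 ≤ lamD⁻¹ * (M / κ) := by positivity
    have h10 : (1 + 1 / lamD + LamX * i1 / lamD) * (M / κ)
      = M / κ + lamD⁻¹ * (M / κ) + LamX * i1 / lamD * (M / κ) := by ring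
    linarith
  have h11 := h.off_le j hj
  rw [h.noise_eq] at h11
  have h12 : (k * α) * (1 / ν * |offPart D (mask S) x j|) ≤ η / 4 := by
    calc (k * α) * (1 / ν * |offPart D (mask S) x j|) ≤ τ * (η / (4 * τ)) := by gcongr
      _ = η / 4 := by field_simp
  refine (abs_sub _ _).trans ?_
  rw [abs_mul ((k : ℝ) * α), abs_mul (1 / ν), abs_mul (1 / ν), abs_of_nonneg (by positivity : 0 ≤ (k : ℝ) * α),
    abs_of_pos (by positivity : 0 < 1 / ν)]
  linarith

end Regime

end Regime

/-! ### Deterministic consistency: signs and errors at the stopping time. -/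

section Regime

variable {m : ℕ} {E G : Type*}
    [NormedAddCommGroup E] [InnerProductSpace ℝ E] [FiniteDimensional ℝ E]
    [NormedAddCommGroup G] [InnerProductSpace ℝ G] [FiniteDimensional ℝ G]

theorem sign_eq_of_abs_sub_lt {a b : ℝ} (h : |a - b| < |b|) :
    SignType.sign a = SignType.sign b := by
  rcases lt_trichotomy b 0 with hb | hb | hb
  · rw [abs_of_neg hb, abs_lt] at h
    rw [sign_neg hb, sign_neg (by linarith)]
  · rw [hb, abs_zero] at h
    exact absurd h (not_lt.2 (abs_nonneg _))
  · rw [abs_of_pos hb, abs_lt] at h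
    rw [sign_pos hb, sign_pos (by linarith)]

namespace Regime

variable {B : E →ₗ[ℝ] G} {D : E →ₗ[ℝ] EuclideanSpace ℝ (Fin m)} {S : Finset (Fin m)}
  {ν lamD LamD LamX lamH i1 η σ κ α hn lamH' τ l pe : ℝ} {βs x : E} {e : G}
  {b : ℕ → E} {z g : ℕ → EuclideanSpace ℝ (Fin m)}
  (h : Regime B D S ν lamD LamD LamX lamH i1 η σ κ α hn lamH' τ l pe βs x e b z g)

include h

theorem breg_nonneg (k : ℕ) :
    0 ≤ breg S κ (βs + x) (mask S (D (βs + x))) (b k) (z k) (g k) := by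
  have := h.kappa_pos
  exact add_nonneg (Finset.sum_nonneg fun j _ => bregTerm_nonneg _ _) (by positivity)

/-- The squared gradient consumes the fraction κα‖H‖/2 of the decrease; what is left is the factor
in `lamH'`. -/
theorem breg_step (k : ℕ) :
    breg S κ (βs + x) (mask S (D (βs + x))) (b (k + 1)) (z (k + 1)) (g (k + 1))
      ≤ breg S κ (βs + x) (mask S (D (βs + x))) (b k) (z k) (g k) - α * lamH' *
        (energy B D ν (b k - (βs + x)) (g k - mask S (D (βs + x))) / lamH) := by
  have h1 := h.path.breg_step h.schur_oracle rfl h.kappa_pos k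
  have h2 := norm_sq_hess_le B D ν (mask_isSymmetric S) (mask_mask S) h.design.nu_pos h.hess
    (b k - (βs + x)) (g k - mask S (D (βs + x)))
  set q := energy B D ν (b k - (βs + x)) (g k - mask S (D (βs + x)))
  have h3 : 0 ≤ κ * α ^ 2 / 2 := by have := h.kappa_pos; positivity
  have h4 := mul_le_mul_of_nonneg_left h2 h3
  have hl := h.design.lamH_pos
  have h5 : α * lamH' * (q / lamH) = α * q - κ * α ^ 2 / 2 * (hn * q) := by
    rw [h.lamH'_eq]; field_simp
  rw [h5]
  linarith

theorem antitone_energy :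
    Antitone fun k => energy B D ν (b k - (βs + x)) (g k - mask S (D (βs + x))) / lamH :=
  antitone_nat_of_succ_le fun k => div_le_div_of_nonneg_right
    (h.path.energy_step h.schur_oracle rfl h.kappa_pos h.alpha_pos h.hess h.step.le k)
    h.design.lamH_pos.le

theorem energy_div_nonneg (k : ℕ) :
    0 ≤ energy B D ν (b k - (βs + x)) (g k - mask S (D (βs + x))) / lamH :=
  div_nonneg (energy_nonneg B D h.design.nu_pos _ _) h.design.lamH_pos.le

theorem exists_le_kappa : ∃ M, 4 * M ≤ κ ∧ ‖mask S (D (βs + x))‖ ≤ M ∧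
    ∀ k, Real.sqrt (energy B D ν (b k - (βs + x)) (g k - mask S (D (βs + x))) / lamH) ≤ M := by
  obtain ⟨M, hM0, hκM, hg0, -, -, hM⟩ := h.exists_bound
  refine ⟨M, le_trans (mul_le_mul_of_nonneg_right ?_ hM0) hκM, hg0, hM⟩
  have h1 : 4 ≤ 4 / η := by rw [le_div_iff₀ h.eta_pos]; nlinarith [h.eta_le]
  have hX := h.design.LamX_pos
  have hD := h.design.lamD_pos
  have hi := h.design.i1_nonneg
  have h2 : 1 ≤ 1 + 1 / lamD + LamX * i1 / lamD := by
    have : 0 ≤ 1 / lamD + LamX * i1 / lamD := by positivity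
    linarith
  nlinarith

/-- 17/8 = 2 + 1/8: the divergence terms give 2, and the quadratic term q/(2κ) gives 1/8 because √q
≤ M ≤ κ/4. -/
theorem sq_breg_le (k : ℕ) :
    breg S κ (βs + x) (mask S (D (βs + x))) (b k) (z k) (g k) ^ 2 ≤ (17 / 8) ^ 2 * S.card *
      (energy B D ν (b k - (βs + x)) (g k - mask S (D (βs + x))) / lamH) := by
  obtain ⟨M, hκM, -, hM⟩ := h.exists_le_kappa
  have hκ := h.kappa_pos
  have h1 := h.path.sq_sum_bregTerm_le h.schur_oracle rfl hκ k
  have h2 := h.norm_sq_le k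
  have hq := h.energy_div_nonneg k
  have hMk := hM k
  have h0 := h.breg_nonneg k
  rw [breg] at h0 ⊢
  set q := energy B D ν (b k - (βs + x)) (g k - mask S (D (βs + x))) / lamH
  have hr0 := Real.sqrt_nonneg q
  have hrq := Real.sq_sqrt hq
  have hg : ‖g k - mask S (D (βs + x))‖ ≤ Real.sqrt q :=
    Real.le_sqrt_of_sq_le (by nlinarith [sq_nonneg ‖b k - (βs + x)‖])
  have hs : 1 ≤ Real.sqrt S.card := by
    rw [Real.one_le_sqrt]; exact_mod_cast h.card_pos
  have h3 : (‖b k - (βs + x)‖ ^ 2 + ‖g k - mask S (D (βs + x))‖ ^ 2) / (2 * κ)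
      ≤ Real.sqrt q / 8 := by
    rw [div_le_iff₀ (by positivity)]
    nlinarith
  have h4 : ∑ j ∈ S, bregTerm (z k j) (mask S (D (βs + x)) j) +
      (‖b k - (βs + x)‖ ^ 2 + ‖g k - mask S (D (βs + x))‖ ^ 2) / (2 * κ)
      ≤ 17 / 8 * Real.sqrt S.card * Real.sqrt q := by
    have : Real.sqrt S.card * ‖g k - mask S (D (βs + x))‖ ≤ Real.sqrt S.card * Real.sqrt q := by
      gcongr
    nlinarith
  refine (pow_le_pow_left₀ h0 h4 2).trans (le_of_eq ?_)
  rw [mul_pow, mul_pow, hrq, Real.sq_sqrt (Nat.cast_nonneg _)]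

/-- The 1/8 now comes from 4c ≤ κ: as S is nonempty, c is at most an oracle coordinate, hence at
most M. -/
theorem mul_breg_le {c : ℝ} (hc : 0 < c) (hcS : ∀ j ∈ S, c ≤ |mask S (D (βs + x)) j|) (k : ℕ) :
    c * breg S κ (βs + x) (mask S (D (βs + x))) (b k) (z k) (g k) ≤ 17 / 8 *
      (energy B D ν (b k - (βs + x)) (g k - mask S (D (βs + x))) / lamH) := by
  obtain ⟨M, hκM, hgM, -⟩ := h.exists_le_kappa
  have hκ := h.kappa_pos
  have h1 := h.path.mul_sum_bregTerm_le h.schur_oracle rfl hκ hc.le hcS k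
  have h2 := h.norm_sq_le k
  obtain ⟨j, hj⟩ := Finset.card_pos.1 h.card_pos
  have h3 : 4 * c ≤ κ := by
    have := (hcS j hj).trans ((abs_apply_le_norm _ j).trans hgM)
    linarith
  have hq := h.energy_div_nonneg k
  rw [breg, mul_add]
  set q := energy B D ν (b k - (βs + x)) (g k - mask S (D (βs + x))) / lamH
  have h4 : c * ((‖b k - (βs + x)‖ ^ 2 + ‖g k - mask S (D (βs + x))‖ ^ 2) / (2 * κ)) ≤ q / 8 := by
    rw [mul_div_assoc', div_le_iff₀ (by positivity)]
    calc c * (‖b k - (βs + x)‖ ^ 2 + ‖g k - mask S (D (βs + x))‖ ^ 2) ≤ c * q := by gcongr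
      _ ≤ κ / 4 * q := by gcongr; linarith
      _ = q / 8 * (2 * κ) := by ring
  nlinarith [sq_nonneg ‖b k - (βs + x)‖]

theorem floor_bounds : τ - α < α * ⌊τ / α⌋₊ ∧ (⌊τ / α⌋₊ : ℝ) * α ≤ τ ∧
    τ < α * (⌊τ / α⌋₊ + 1) := by
  have hα := h.alpha_pos
  have h1 := Nat.lt_floor_add_one (τ / α)
  have h2 := Nat.floor_le (by have := h.tau_pos; positivity : 0 ≤ τ / α)
  rw [div_lt_iff₀ hα] at h1
  rw [le_div_iff₀ hα] at h2
  refine ⟨by linarith, h2, by linarith⟩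

/-- The distance to the oracle estimator at the stopping time. -/
theorem sqrt_energy_le :
    Real.sqrt (energy B D ν (b ⌊τ / α⌋₊ - (βs + x)) (g ⌊τ / α⌋₊ - mask S (D (βs + x))) / lamH)
      ≤ 17 / 4 * Real.sqrt S.card / (lamH' * (τ - α)) := by
  have hs : (1 : ℝ) ≤ S.card := by exact_mod_cast h.card_pos
  have hl' := h.lamH'_pos
  have hα := h.alpha_pos
  have hτ := h.tau_gt
  have h1 := bihari_bound (mul_pos hα hl') (by positivity) h.breg_nonneg h.breg_step
    h.antitone_energy h.sq_breg_le ⌊τ / α⌋₊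
  have hq := h.energy_div_nonneg ⌊τ / α⌋₊
  obtain ⟨h2, -, -⟩ := h.floor_bounds
  set q := energy B D ν (b ⌊τ / α⌋₊ - (βs + x)) (g ⌊τ / α⌋₊ - mask S (D (βs + x))) / lamH
  have hτα : 0 < τ - α := by linarith
  rw [le_div_iff₀ (by positivity)]
  refine le_of_sq_le_sq ?_ (by positivity)
  rw [mul_pow, mul_pow (17 / 4), Real.sq_sqrt hq, Real.sq_sqrt (by positivity)]
  have h3 : (lamH' * (τ - α)) ^ 2 ≤ (α * lamH' * ⌊τ / α⌋₊) ^ 2 := by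
    refine pow_le_pow_left₀ (by positivity) ?_ 2
    nlinarith
  nlinarith [mul_le_mul_of_nonneg_left h3 hq]

theorem on_le' {j : Fin m} (hj : j ∈ S) : |D x j| ≤ 1 / (4 * (lamH' * τ)) := by
  have hl := h.design.lamH_pos
  have hl' := h.lamH'_pos
  have hle := h.lamH'_le
  have hτ := h.tau_pos
  have h1 := h.on_le j hj
  rw [h.noise_eq] at h1
  have h2 : lamH' * |D x j| ≤ η / (4 * τ) :=
    (mul_le_mul_of_nonneg_right hle (abs_nonneg _)).trans h1
  rw [le_div_iff₀ (by positivity)] at h2 ⊢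
  linarith [h.eta_le]

/-- Sign consistency at the stopping time. -/
theorem sign_eq (hmin : ∀ j ∈ S, 16 * σ / (η * lamH' * (1 - 5 * α / τ))
      * (LamX * LamD / lamD ^ 2) * (2 * Real.log S.card + 5 + max 0 (Real.log (8 * LamD))) * l
      ≤ |D βs j|) (j : Fin m) :
    SignType.sign (g ⌊τ / α⌋₊ j) = SignType.sign (D βs j) := by
  by_cases hj : j ∈ S
  swap
  · rw [h.path.g_apply, if_neg hj, ← h.mask_D_βs, mask_apply, if_neg hj]
  have hs : (1 : ℝ) ≤ S.card := by exact_mod_cast h.card_pos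
  have hlog : 0 ≤ Real.log S.card := Real.log_nonneg hs
  have hl' := h.lamH'_pos
  have hα := h.alpha_pos
  have hτ := h.tau_gt
  have hτ0 := h.tau_pos
  have hσ := h.sigma_pos
  have hη := h.eta_pos
  have hX := h.design.LamX_pos
  have hD := h.design.lamD_pos
  have hDD := h.lamD_le
  have hτ5 : 0 < τ - 5 * α := by linarith
  -- The signal level 4 log s + 10 less the 1/4 that noise can remove (`on_le'`), so c bounds the
  -- oracle coordinates from below.
  set c := (4 * Real.log S.card + 10 - 1 / 4) / (lamH' * (τ - 5 * α)) with hc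
  have hc0 : 0 < c := div_pos (by linarith) (by positivity)
  have hsig : ∀ j ∈ S, (4 * Real.log S.card + 10) / (lamH' * (τ - 5 * α)) ≤ |D βs j| := by
    intro j hj
    refine le_trans ?_ (hmin j hj)
    have e1 : l = η * lamD / (8 * σ * LamX) / τ := by
      rw [eq_div_iff hτ0.ne', mul_comm, h.tau_mul]
    have e2 : 1 - 5 * α / τ = (τ - 5 * α) / τ := by field_simp
    have e3 : 16 * σ / (η * lamH' * (1 - 5 * α / τ))
        * (LamX * LamD / lamD ^ 2) * (2 * Real.log S.card + 5 + max 0 (Real.log (8 * LamD))) * l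
        = (LamD / lamD) * (2 * (2 * Real.log S.card + 5 + max 0 (Real.log (8 * LamD))))
          / (lamH' * (τ - 5 * α)) := by
      rw [e1, e2]
      field_simp
      ring
    rw [e3]
    gcongr
    have e4 : 1 ≤ LamD / lamD := (one_le_div hD).2 hDD
    have e5 : 0 ≤ max 0 (Real.log (8 * LamD)) := le_max_left _ _
    nlinarith
  have hdev : ∀ j ∈ S, |D x j| ≤ (1 / 4) / (lamH' * (τ - 5 * α)) := by
    intro j hj
    refine (h.on_le' hj).trans ?_
    have e1 : 1 / (4 * (lamH' * τ)) = (1 / 4) / (lamH' * τ) := by field_simp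
    rw [e1]
    gcongr
    linarith
  have hsub : (4 * Real.log S.card + 10) / (lamH' * (τ - 5 * α))
      = c + (1 / 4) / (lamH' * (τ - 5 * α)) := by rw [hc]; ring
  have hcS : ∀ j ∈ S, c ≤ |mask S (D (βs + x)) j| := by
    intro j hj
    have e1 := hsig j hj
    have e2 := hdev j hj
    rw [mask_apply, if_pos hj, map_add, PiLp.add_apply]
    have e3 := abs_sub_abs_le_abs_sub (D βs j) (-(D x j))
    rw [abs_neg, sub_neg_eq_add] at e3
    linarith
  obtain ⟨-, -, hfl⟩ := h.floor_bounds
  have hlt := lt_of_three_phases (mul_pos hα hl') (by norm_num : (0 : ℝ) < 17 / 8) hc0 hs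
    h.breg_nonneg h.breg_step h.antitone_energy h.sq_breg_le
    -- The floor gives τ - 5α ≤ α(K + 1 - 4), and (17/8)(2 + log s) is below 4 log s + 10 - 1/4.
    (fun k _ => h.mul_breg_le hc0 hcS k) (K := ⌊τ / α⌋₊) (by
      have e1 : lamH' * c * (τ - 5 * α) = 4 * Real.log S.card + 10 - 1 / 4 := by
        rw [hc]; field_simp
      have e2 : lamH' * c * (τ - 5 * α) ≤ lamH' * c * (α * (⌊τ / α⌋₊ + 1 - 4)) := by
        refine mul_le_mul_of_nonneg_left ?_ (by positivity)
        linarith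
      have e3 : α * lamH' * c * ((⌊τ / α⌋₊ : ℝ) + 1 - 4)
          = lamH' * c * (α * (⌊τ / α⌋₊ + 1 - 4)) := by ring
      rw [e3]
      linarith)
  have hnorm : ‖g ⌊τ / α⌋₊ - mask S (D (βs + x))‖ < c := by
    refine lt_of_pow_lt_pow_left₀ 2 hc0.le (lt_of_le_of_lt ?_ hlt)
    exact le_trans (le_add_of_nonneg_left (sq_nonneg _)) (h.norm_sq_le _)
  have hs1 : SignType.sign (g ⌊τ / α⌋₊ j) = SignType.sign (mask S (D (βs + x)) j) := by
    refine sign_eq_of_abs_sub_lt ?_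
    rw [← PiLp.sub_apply]
    exact ((abs_apply_le_norm _ j).trans_lt hnorm).trans_le (hcS j hj)
  rw [hs1]
  refine sign_eq_of_abs_sub_lt ?_
  rw [mask_apply, if_pos hj, map_add, PiLp.add_apply, add_sub_cancel_left]
  linarith [hsig j hj, hdev j hj]

theorem norm_mask_le : ‖mask S (D x)‖ ≤ 1 / 4 * Real.sqrt S.card / (lamH' * (τ - α)) := by
  have hl' := h.lamH'_pos
  have hα := h.alpha_pos
  have hτ := h.tau_gt
  have hτα : 0 < τ - α := by linarith
  refine le_of_sq_le_sq ?_ (by positivity)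
  have h1 : ∀ j ∈ S, D x j ^ 2 ≤ (1 / (4 * (lamH' * (τ - α)))) ^ 2 := by
    intro j hj
    rw [← sq_abs]
    refine pow_le_pow_left₀ (abs_nonneg _) ((h.on_le' hj).trans ?_) 2
    gcongr
    linarith
  rw [norm_sq_mask]
  refine (Finset.sum_le_card_nsmul S _ _ h1).trans (le_of_eq ?_)
  rw [nsmul_eq_mul, div_pow, div_pow, mul_pow (1 / 4), Real.sq_sqrt (Nat.cast_nonneg _)]
  field_simp

theorem rate_eq : 42 * σ / (η * lamH' * (1 - α / τ)) * (LamX / lamD) * (Real.sqrt S.card * l)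
    = 21 / 4 * Real.sqrt S.card / (lamH' * (τ - α)) := by
  have hl' := h.lamH'_pos
  have hα := h.alpha_pos
  have hτ := h.tau_gt
  have hτ0 := h.tau_pos
  have hσ := h.sigma_pos
  have hη := h.eta_pos
  have hX := h.design.LamX_pos
  have hD := h.design.lamD_pos
  have hτα : 0 < τ - α := by linarith
  have e1 : l = η * lamD / (8 * σ * LamX) / τ := by
    rw [eq_div_iff hτ0.ne', mul_comm, h.tau_mul]
  have e2 : 1 - α / τ = (τ - α) / τ := by field_simp
  rw [e1, e2]
  field_simp
  ring

/-- The error of the sparse variable at the stopping time. -/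
theorem norm_g_sub_le : ‖g ⌊τ / α⌋₊ - D βs‖
    ≤ 42 * σ / (η * lamH' * (1 - α / τ)) * (LamX / lamD) * (Real.sqrt S.card * l) := by
  rw [h.rate_eq]
  have h1 := h.sqrt_energy_le
  have h2 : ‖g ⌊τ / α⌋₊ - mask S (D (βs + x))‖ ≤ 17 / 4 * Real.sqrt S.card / (lamH' * (τ - α)) :=
    (Real.le_sqrt_of_sq_le (le_trans (le_add_of_nonneg_left (sq_nonneg _))
      (h.norm_sq_le _))).trans h1
  have h3 := h.norm_mask_le
  have h4 : g ⌊τ / α⌋₊ - D βs = (g ⌊τ / α⌋₊ - mask S (D (βs + x))) + mask S (D x) := by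
    rw [map_add, map_add, h.mask_D_βs]; abel
  rw [h4]
  have hl' := h.lamH'_pos
  have hτα : 0 < τ - α := by linarith [h.alpha_pos, h.tau_gt]
  have h5 : 21 / 4 * Real.sqrt S.card / (lamH' * (τ - α)) = 17 / 4 * Real.sqrt S.card /
      (lamH' * (τ - α)) + 1 / 4 * Real.sqrt S.card / (lamH' * (τ - α))
      + 3 / 4 * Real.sqrt S.card / (lamH' * (τ - α)) := by ring
  have h6 : 0 ≤ 3 / 4 * Real.sqrt S.card / (lamH' * (τ - α)) := by positivity
  have := norm_add_le (g ⌊τ / α⌋₊ - mask S (D (βs + x))) (mask S (D x))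
  linarith

/-- The error of the dense variable at the stopping time. -/
theorem norm_b_sub_le : ‖b ⌊τ / α⌋₊ - βs‖
    ≤ 42 * σ / (η * lamH' * (1 - α / τ)) * ((LamX * (1 + lamD) + LamX ^ 2 * i1) / lamD ^ 2)
        * (Real.sqrt S.card * l) + i1 * pe
      + ν * (2 * σ) * ((LamX + LamX ^ 2 * i1) / lamD ^ 2) := by
  have hl' := h.lamH'_pos
  have hα := h.alpha_pos
  have hσ := h.sigma_pos
  have hX := h.design.LamX_pos
  have hD := h.design.lamD_pos
  have hi := h.design.i1_nonneg
  have hν := h.design.nu_pos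
  have hτα : 0 < τ - α := by linarith [h.tau_gt]
  set R := 42 * σ / (η * lamH' * (1 - α / τ)) * (LamX / lamD) * (Real.sqrt S.card * l) with hR
  have hR' : R = 21 / 4 * Real.sqrt S.card / (lamH' * (τ - α)) := h.rate_eq
  have hR0 : 0 ≤ R := by rw [hR']; positivity
  have h1 : ‖b ⌊τ / α⌋₊ - (βs + x)‖ ≤ R := by
    refine (Real.le_sqrt_of_sq_le (le_trans (le_add_of_nonneg_right (sq_nonneg _))
      (h.norm_sq_le _))).trans (h.sqrt_energy_le.trans ?_)
    rw [hR']
    gcongr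
    norm_num
  have h2 : ‖mask S (D x)‖ ≤ R := by
    refine h.norm_mask_le.trans ?_
    rw [hR']
    gcongr
    norm_num
  -- The price of splitting: D x leaks outside S by order ν, which yields the last term of the
  -- bound.
  have h3 : ‖offPart D (mask S) x‖ ≤ ν * (LamX / lamD * (2 * σ)) := by
    have := (h.design.norm_offPart_le h.x_eq).trans
      (mul_le_mul_of_nonneg_left h.e_le (by positivity))
    rw [one_div, inv_mul_le_iff₀ hν] at this
    exact this
  have h4 : ‖D x‖ ≤ R + ν * (LamX / lamD * (2 * σ)) := by
    have e1 : D x = mask S (D x) + offPart D (mask S) x := by rw [offPart_apply]; abel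
    rw [e1]
    exact (norm_add_le _ _).trans (add_le_add h2 h3)
  have h5 : ‖x‖ ≤ lamD⁻¹ * (R + ν * (LamX / lamD * (2 * σ)))
      + i1 * (pe + LamX * (lamD⁻¹ * (R + ν * (LamX / lamD * (2 * σ))))) := by
    refine (h.design.norm_le_of_schur_eq h.x_eq h.x_mem).trans ?_
    have := h.proj_le
    gcongr
  have h6 : b ⌊τ / α⌋₊ - βs = (b ⌊τ / α⌋₊ - (βs + x)) + x := by abel
  rw [h6]
  refine (norm_add_le _ _).trans ((add_le_add h1 h5).trans (le_of_eq ?_))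
  have h7 : 42 * σ / (η * lamH' * (1 - α / τ)) * ((LamX * (1 + lamD) + LamX ^ 2 * i1) / lamD ^ 2)
        * (Real.sqrt S.card * l) = R * (1 + lamD⁻¹ + LamX * i1 * lamD⁻¹) := by
    rw [hR]; field_simp; ring
  rw [h7]
  clear_value R
  field_simp
  ring

end Regime

end Regime

/-! ### Concentration of sub-Gaussian vectors. -/

section Concentration

variable {Ω : Type*} [MeasurableSpace Ω] {μ : Measure Ω} [IsProbabilityMeasure μ]
  {H : Type*} [NormedAddCommGroup H] [InnerProductSpace ℝ H] [FiniteDimensional ℝ H]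

/-- All one-dimensional marginals of `V` are sub-Gaussian with parameter `σ`. -/
structure SubgaussianVector (V : Ω → H) (σ : ℝ) (μ : Measure Ω) : Prop where
  meas : ∀ a, Measurable fun ω => ⟪a, V ω⟫
  integrable : ∀ a, Integrable (fun ω => Real.exp ⟪a, V ω⟫) μ
  integral_le : ∀ a, ∫ ω, Real.exp ⟪a, V ω⟫ ∂μ ≤ Real.exp (σ ^ 2 * ‖a‖ ^ 2 / 2)

/-- The exponent 3/8 is chosen so that (1 - 3/4)^(-1/2) is exactly 2. -/
theorem integral_exp_sq_gaussianReal :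
    ∫ x, Real.exp (3 / 8 * x ^ 2) ∂(gaussianReal 0 1) = 2 := by
  rw [integral_gaussianReal_eq_integral_smul one_ne_zero]
  have h1 : ∀ x : ℝ, gaussianPDFReal 0 1 x • Real.exp (3 / 8 * x ^ 2)
      = (Real.sqrt (2 * Real.pi))⁻¹ * Real.exp (-(1 / 8) * x ^ 2) := by
    intro x
    rw [gaussianPDFReal, smul_eq_mul, mul_assoc, ← Real.exp_add]
    simp only [NNReal.coe_one, mul_one, sub_zero]
    congr 2
    ring
  simp_rw [h1]
  rw [integral_const_mul, integral_gaussian, ← Real.sqrt_inv, ← Real.sqrt_mul (by positivity)]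
  have : (2 * Real.pi)⁻¹ * (Real.pi / (1 / 8)) = 2 ^ 2 := by
    have := Real.pi_pos.ne'
    field_simp
    norm_num
  rw [this, Real.sqrt_sq zero_le_two]

theorem integrable_exp_sq_gaussianReal :
    Integrable (fun x => Real.exp (3 / 8 * x ^ 2)) (gaussianReal 0 1) := by
  by_contra h
  have := integral_undef h
  rw [integral_exp_sq_gaussianReal] at this
  norm_num at this

theorem integral_exp_mul_gaussianReal (t : ℝ) :
    ∫ x, Real.exp (t * x) ∂(gaussianReal 0 1) = Real.exp (t ^ 2 / 2) := by
  have := congrFun (mgf_id_gaussianReal (μ := 0) (v := 1)) t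
  simpa [mgf] using this

namespace SubgaussianVector

variable {V : Ω → H} {σ : ℝ} (hV : SubgaussianVector V σ μ)

include hV

/-- Gaussian linearisation: exp(s²a²/2) is the mean of exp(s a ξ) for a standard normal ξ. After
exchanging integrals the sub-Gaussian bound applies to linear forms only; s² = 3/(4σ²) leaves d
factors equal to 2. -/
theorem lintegral_exp_sum_sq_le (hσ : 0 < σ) {d : ℕ} {u : Fin d → H} (hu : Orthonormal ℝ u) :
    ∫⁻ ω, ENNReal.ofReal (Real.exp (3 / (8 * σ ^ 2) * ∑ i, ⟪u i, V ω⟫ ^ 2)) ∂μ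
      ≤ ENNReal.ofReal (2 ^ d) := by
  set γ : Measure (Fin d → ℝ) := Measure.pi fun _ => gaussianReal 0 1 with hγ
  set s := Real.sqrt (3 / (4 * σ ^ 2)) with hs
  have hs2 : s ^ 2 = 3 / (4 * σ ^ 2) := Real.sq_sqrt (by positivity)
  have h1 : ∀ ω, ENNReal.ofReal (Real.exp (3 / (8 * σ ^ 2) * ∑ i, ⟪u i, V ω⟫ ^ 2))
      = ∫⁻ x : Fin d → ℝ, ENNReal.ofReal (Real.exp ⟪∑ i, (s * x i) • u i, V ω⟫) ∂γ := by
    intro ω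
    have e1 : ∀ x : Fin d → ℝ, Real.exp ⟪∑ i, (s * x i) • u i, V ω⟫
        = ∏ i, Real.exp (s * ⟪u i, V ω⟫ * x i) := by
      intro x
      rw [sum_inner, Real.exp_sum]
      refine Finset.prod_congr rfl fun i _ => ?_
      rw [real_inner_smul_left]; ring_nf
    simp_rw [e1]
    rw [← ofReal_integral_eq_lintegral_ofReal
      (Integrable.fintype_prod fun i => integrable_exp_mul_gaussianReal _)
      (Filter.Eventually.of_forall fun x => Finset.prod_nonneg fun i _ => (Real.exp_pos _).le),
      integral_fintype_prod_eq_prod (fun i (y : ℝ) => Real.exp (s * ⟪u i, V ω⟫ * y))]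
    simp_rw [integral_exp_mul_gaussianReal]
    rw [← Real.exp_sum, Finset.mul_sum]
    congr 2
    refine Finset.sum_congr rfl fun i _ => ?_
    rw [mul_pow, hs2]
    field_simp
    ring
  simp_rw [h1]
  rw [lintegral_lintegral_swap]
  · have h2 : ∀ x : Fin d → ℝ, ∫⁻ ω, ENNReal.ofReal (Real.exp ⟪∑ i, (s * x i) • u i, V ω⟫) ∂μ
        ≤ ENNReal.ofReal (∏ i, Real.exp (3 / 8 * x i ^ 2)) := by
      intro x
      rw [← ofReal_integral_eq_lintegral_ofReal (hV.integrable _)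
        (Filter.Eventually.of_forall fun ω => (Real.exp_pos _).le)]
      refine ENNReal.ofReal_le_ofReal ((hV.integral_le _).trans (le_of_eq ?_))
      rw [← Real.exp_sum, ← Finset.mul_sum]
      congr 1
      have e2 : ‖∑ i, (s * x i) • u i‖ ^ 2 = s ^ 2 * ∑ i, x i ^ 2 := by
        rw [← real_inner_self_eq_norm_sq, hu.inner_sum, Finset.mul_sum]
        refine Finset.sum_congr rfl fun i _ => ?_
        simp only [conj_trivial]; ring
      rw [e2, hs2]
      field_simp
      ring
    refine (lintegral_mono h2).trans (le_of_eq ?_)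
    rw [← ofReal_integral_eq_lintegral_ofReal
      (Integrable.fintype_prod fun i => integrable_exp_sq_gaussianReal)
      (Filter.Eventually.of_forall fun x => Finset.prod_nonneg fun i _ => (Real.exp_pos _).le),
      integral_fintype_prod_eq_prod (fun _ (y : ℝ) => Real.exp (3 / 8 * y ^ 2))]
    simp_rw [integral_exp_sq_gaussianReal]
    simp
  · refine (ENNReal.measurable_ofReal.comp (Real.measurable_exp.comp ?_)).aemeasurable
    have e3 : (fun q : Ω × (Fin d → ℝ) => ⟪∑ i, (s * q.2 i) • u i, V q.1⟫)
        = fun q => ∑ i, (s * q.2 i) * ⟪u i, V q.1⟫ := by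
      funext q
      rw [sum_inner]
      refine Finset.sum_congr rfl fun i _ => ?_
      rw [real_inner_smul_left]
    change Measurable fun q : Ω × (Fin d → ℝ) => ⟪∑ i, (s * q.2 i) • u i, V q.1⟫
    rw [e3]
    refine Finset.measurable_sum _ fun i _ => Measurable.mul ?_ ((hV.meas (u i)).comp measurable_fst)
    fun_prop

/-- Markov's inequality for the exponential of the squared projection, in an orthonormal basis of W.
-/
theorem measure_projection_gt_le (hσ : 0 < σ) (W : Submodule ℝ H) {L : ℝ} (hL : 0 ≤ L) :
    μ.real {ω | 2 * σ * Real.sqrt (Module.finrank ℝ W * L) < ‖W.starProjection (V ω)‖}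
      ≤ (2 * Real.exp (-(3 / 2) * L)) ^ (Module.finrank ℝ W) := by
  set d := Module.finrank ℝ W with hd
  set w := stdOrthonormalBasis ℝ W with hw
  set u : Fin d → H := fun i => (w i : H) with hu
  have hu' : Orthonormal ℝ u := w.orthonormal.comp_linearIsometry W.subtypeₗᵢ
  have h1 : ∀ v : H, ‖W.starProjection v‖ ^ 2 = ∑ i, ⟪u i, v⟫ ^ 2 := by
    intro v
    have e1 : ‖W.starProjection v‖ = ‖W.orthogonalProjectionOnto v‖ := rfl
    rw [e1, ← w.sum_sq_inner_right]
    refine Finset.sum_congr rfl fun i _ => ?_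
    rw [Submodule.inner_orthogonalProjectionOnto_eq_of_mem_left]
  have h2 := mul_meas_ge_le_lintegral₀ (μ := μ)
    (f := fun ω => ENNReal.ofReal (Real.exp (3 / (8 * σ ^ 2) * ∑ i, ⟪u i, V ω⟫ ^ 2)))
    (ENNReal.measurable_ofReal.comp (Real.measurable_exp.comp
      ((Finset.measurable_sum _ fun i _ => (hV.meas (u i)).pow_const 2).const_mul _))).aemeasurable
    (ENNReal.ofReal (Real.exp (3 / 2 * (d * L))))
  have h3 := h2.trans (hV.lintegral_exp_sum_sq_le hσ hu')
  set A := {ω | 2 * σ * Real.sqrt (d * L) < ‖W.starProjection (V ω)‖} with hA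
  have h4 : A ⊆ {ω | ENNReal.ofReal (Real.exp (3 / 2 * (d * L)))
      ≤ ENNReal.ofReal (Real.exp (3 / (8 * σ ^ 2) * ∑ i, ⟪u i, V ω⟫ ^ 2))} := by
    intro ω hω
    refine ENNReal.ofReal_le_ofReal (Real.exp_le_exp.2 ?_)
    rw [← h1]
    have e0 : 2 * σ * Real.sqrt (d * L) < ‖W.starProjection (V ω)‖ := hω
    have e1 := pow_le_pow_left₀ (by positivity) e0.le 2
    rw [mul_pow, Real.sq_sqrt (by positivity)] at e1
    calc 3 / 2 * ((d : ℝ) * L) = 3 / (8 * σ ^ 2) * ((2 * σ) ^ 2 * (d * L)) := by field_simp; ring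
      _ ≤ _ := by gcongr
  have h5 : ENNReal.ofReal (Real.exp (3 / 2 * (d * L))) * μ A ≤ ENNReal.ofReal (2 ^ d) :=
    (mul_le_mul_right (measure_mono h4) _).trans h3
  have h6 := ENNReal.toReal_mono ENNReal.ofReal_ne_top h5
  rw [ENNReal.toReal_mul, ENNReal.toReal_ofReal (Real.exp_pos _).le,
    ENNReal.toReal_ofReal (by positivity)] at h6
  have h7 : Real.exp (-(3 / 2) * L) ^ d = (Real.exp (3 / 2 * (d * L)))⁻¹ := by
    rw [← Real.exp_nat_mul, ← Real.exp_neg]; ring_nf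
  rw [mul_pow, h7, ← div_eq_mul_inv, le_div_iff₀ (Real.exp_pos _), mul_comm]
  exact h6

theorem measure_abs_inner_ge_le (hσ : 0 < σ) {a : H} {K T : ℝ} (hK : 0 < K) (ha : ‖a‖ ≤ K)
    (hT : 0 ≤ T) :
    μ.real {ω | σ * K * T ≤ |⟪a, V ω⟫|} ≤ 2 * Real.exp (-T ^ 2 / 2) := by
  have hsub : ∀ a : H, ‖a‖ ≤ K →
      HasSubgaussianMGF (fun ω => ⟪a, V ω⟫) (Real.toNNReal ((σ * K) ^ 2)) μ := by
    intro a ha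
    have h1 : ∀ t : ℝ, (fun ω => Real.exp (t * ⟪a, V ω⟫)) = fun ω => Real.exp ⟪t • a, V ω⟫ := by
      intro t; funext ω; rw [real_inner_smul_left]
    refine ⟨fun t => by rw [h1]; exact hV.integrable _, fun t => ?_⟩
    rw [mgf, h1]
    refine (hV.integral_le _).trans (Real.exp_le_exp.2 ?_)
    rw [Real.coe_toNNReal _ (by positivity), norm_smul, mul_pow, Real.norm_eq_abs, sq_abs]
    have : ‖a‖ ^ 2 ≤ K ^ 2 := pow_le_pow_left₀ (norm_nonneg _) ha 2
    have h2 : σ ^ 2 * (t ^ 2 * ‖a‖ ^ 2) ≤ σ ^ 2 * (t ^ 2 * K ^ 2) := by gcongr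
    linarith [mul_pow σ K 2]
  have hexp : -(σ * K * T) ^ 2 / (2 * ((Real.toNNReal ((σ * K) ^ 2) : NNReal) : ℝ))
      = -T ^ 2 / 2 := by
    rw [Real.coe_toNNReal _ (by positivity)]
    field_simp
  have h1 := (hsub a ha).measure_ge_le (ε := σ * K * T) (by positivity)
  have h2 := (hsub (-a) (by rwa [norm_neg])).measure_ge_le (ε := σ * K * T) (by positivity)
  rw [hexp] at h1 h2
  have h3 : {ω | σ * K * T ≤ |⟪a, V ω⟫|}
      ⊆ {ω | σ * K * T ≤ ⟪a, V ω⟫} ∪ {ω | σ * K * T ≤ ⟪-a, V ω⟫} := by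
    intro ω hω
    rcases le_abs.1 (show σ * K * T ≤ |⟪a, V ω⟫| from hω) with h | h
    · exact Or.inl h
    · right
      change σ * K * T ≤ ⟪-a, V ω⟫
      rw [inner_neg_left]; exact h
  have h4 := (measureReal_mono (μ := μ) h3 (measure_ne_top _ _)).trans (measureReal_union_le _ _)
  linarith

end SubgaussianVector

/-- A vector with independent sub-Gaussian coordinates is sub-Gaussian. -/
theorem subgaussianVector_of_iIndepFun {n : ℕ} {ε : Fin n → Ω → ℝ} (hm : ∀ i, Measurable (ε i))
    (hi : iIndepFun ε μ) {σ : ℝ} (hs : ∀ i, HasSubgaussianMGF (ε i) (Real.toNNReal (σ ^ 2)) μ) :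
    SubgaussianVector (fun ω => (WithLp.toLp 2 fun i => ε i ω : EuclideanSpace ℝ (Fin n))) σ μ := by
  have h1 : ∀ (a : EuclideanSpace ℝ (Fin n)) (ω : Ω),
      ⟪a, (WithLp.toLp 2 fun i => ε i ω : EuclideanSpace ℝ (Fin n))⟫ = ∑ i, a i * ε i ω := by
    intro a ω
    rw [PiLp.inner_apply]
    refine Finset.sum_congr rfl fun i _ => ?_
    simp [mul_comm]
  have h2 : ∀ a : EuclideanSpace ℝ (Fin n), HasSubgaussianMGF (fun ω => ∑ i, a i * ε i ω)
      (∑ i, Real.toNNReal (a i ^ 2) * Real.toNNReal (σ ^ 2)) μ := by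
    intro a
    refine HasSubgaussianMGF.sum_of_iIndepFun
      (hi.comp (fun i y => a i * y) fun i => measurable_const_mul _) fun i _ => ?_
    rw [Real.toNNReal_of_nonneg (sq_nonneg (a i))]
    exact (hs i).const_mul (a i)
  refine ⟨fun a => ?_, fun a => ?_, fun a => ?_⟩
  · simp_rw [h1]
    exact Finset.measurable_sum _ fun i _ => (hm i).const_mul _
  · simp_rw [h1]
    simpa using (h2 a).integrable_exp_mul 1
  · simp_rw [h1]
    have h3 := (h2 a).mgf_le 1
    simp only [mgf, one_mul] at h3
    refine h3.trans (Real.exp_le_exp.2 (le_of_eq ?_))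
    rw [EuclideanSpace.real_norm_sq_eq, ← Finset.sum_mul, NNReal.coe_mul, NNReal.coe_sum,
      Real.coe_toNNReal _ (sq_nonneg σ)]
    simp_rw [Real.coe_toNNReal _ (sq_nonneg (_ : ℝ))]
    ring

end Concentration

/-! ### From matrices to operators: hypotheses of the theorem become a `Design`. -/

section Matrices

variable {n p m : ℕ} (X : Matrix (Fin n) (Fin p) ℝ) (D : Matrix (Fin m) (Fin p) ℝ)
  (S : Finset (Fin m)) (ν : ℝ)

/-- The operator `X / √n`. -/
noncomputable def scaledX : EuclideanSpace ℝ (Fin p) →ₗ[ℝ] EuclideanSpace ℝ (Fin n) :=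
  (Real.sqrt n)⁻¹ • X.toEuclideanLin

theorem scaledX_apply (x : EuclideanSpace ℝ (Fin p)) :
    scaledX X x = (Real.sqrt n)⁻¹ • X.toEuclideanLin x := rfl

theorem adjoint_toEuclideanLin {ι κ : Type*} [Fintype ι] [Fintype κ] [DecidableEq ι]
    [DecidableEq κ] (A : Matrix ι κ ℝ) : A.toEuclideanLin.adjoint = Aᵀ.toEuclideanLin := by
  rw [← Matrix.toEuclideanLin_conjTranspose_eq_adjoint,
    Matrix.conjTranspose_eq_transpose_of_trivial]

theorem adjoint_scaledX_smul (y : EuclideanSpace ℝ (Fin n)) :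
    (scaledX X).adjoint ((Real.sqrt n)⁻¹ • y) = (starMat X).toEuclideanLin y := by
  refine ext_inner_right ℝ fun v => ?_
  rw [LinearMap.adjoint_inner_left, scaledX_apply, real_inner_smul_left, real_inner_smul_right,
    starMat, map_smul, LinearMap.smul_apply, real_inner_smul_left, inner_transpose_toEuclideanLin,
    ← mul_assoc, ← mul_inv, Real.mul_self_sqrt (Nat.cast_nonneg n), one_div]

theorem toEuclideanLin_mul_apply {ι κ l : Type*} [Fintype ι] [Fintype κ] [Fintype l]
    [DecidableEq ι] [DecidableEq κ] [DecidableEq l] (A : Matrix ι κ ℝ) (B : Matrix κ l ℝ)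
    (x : EuclideanSpace ℝ l) :
    (A * B).toEuclideanLin x = A.toEuclideanLin (B.toEuclideanLin x) := by
  simp [Matrix.toLpLin_apply]

theorem starMat_mul_apply (x : EuclideanSpace ℝ (Fin p)) :
    (starMat X * X).toEuclideanLin x = (scaledX X).adjoint (scaledX X x) := by
  rw [scaledX_apply, adjoint_scaledX_smul, toEuclideanLin_mul_apply]

theorem inner_starMat_mul (x : EuclideanSpace ℝ (Fin p)) :
    ⟪x, (starMat X * X).toEuclideanLin x⟫ = ‖scaledX X x‖ ^ 2 := by
  rw [starMat_mul_apply, LinearMap.adjoint_inner_right, real_inner_self_eq_norm_sq]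

/-- Extension by zero of a vector indexed by `S`. -/
noncomputable def extS : EuclideanSpace ℝ {j // j ∈ S} →ₗ[ℝ] EuclideanSpace ℝ (Fin m) where
  toFun g := WithLp.toLp 2 fun j => if hj : j ∈ S then g ⟨j, hj⟩ else 0
  map_add' f g := by
    ext j
    by_cases hj : j ∈ S <;> simp [hj]
  map_smul' c f := by
    ext j
    by_cases hj : j ∈ S <;> simp [hj]

variable {S}

theorem extS_apply (g : EuclideanSpace ℝ {j // j ∈ S}) (j : Fin m) :
    extS S g j = if hj : j ∈ S then g ⟨j, hj⟩ else 0 := rfl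

theorem extS_apply_mem (g : EuclideanSpace ℝ {j // j ∈ S}) (j : {j // j ∈ S}) :
    extS S g j.1 = g j := by
  rw [extS_apply, dif_pos j.2]

theorem mask_extS (g : EuclideanSpace ℝ {j // j ∈ S}) : mask S (extS S g) = extS S g := by
  ext j
  by_cases hj : j ∈ S <;> simp [hj, extS_apply]

theorem sum_extS (F : Fin m → ℝ → ℝ) (hF : ∀ j, F j 0 = 0) (g : EuclideanSpace ℝ {j // j ∈ S}) :
    ∑ j, F j (extS S g j) = ∑ j : {j // j ∈ S}, F j.1 (g j) := by
  rw [← Finset.sum_subset (Finset.subset_univ S) (fun j _ hj => by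
    rw [extS_apply, dif_neg hj, hF]), ← Finset.sum_coe_sort S (fun j => F j (extS S g j))]
  refine Finset.sum_congr rfl fun j _ => ?_
  rw [extS_apply_mem]

theorem norm_extS (g : EuclideanSpace ℝ {j // j ∈ S}) : ‖extS S g‖ = ‖g‖ := by
  rw [EuclideanSpace.norm_eq, EuclideanSpace.norm_eq,
    sum_extS (fun _ t => ‖t‖ ^ 2) (fun _ => by simp)]

theorem exists_extS_eq {f : EuclideanSpace ℝ (Fin m)} (hf : mask S f = f) :
    ∃ g, extS S g = f ∧ ∀ j : {j // j ∈ S}, g j = f j.1 := by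
  refine ⟨WithLp.toLp 2 fun j => f j.1, ?_, fun j => rfl⟩
  ext j
  by_cases hj : j ∈ S
  · rw [extS_apply, dif_pos hj]
  · rw [extS_apply, dif_neg hj, ← hf, mask_apply, if_neg hj]

theorem submatrix_mulVec_extS {ι : Type*} (A : Matrix ι (Fin p ⊕ Fin m) ℝ)
    (x : EuclideanSpace ℝ (Fin p)) (g : EuclideanSpace ℝ {j // j ∈ S}) :
    A.submatrix id (Sum.map id Subtype.val) *ᵥ Sum.elim x.ofLp g.ofLp
      = A *ᵥ Sum.elim x.ofLp (extS S g).ofLp := by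
  funext i
  simp only [Matrix.mulVec, dotProduct, Fintype.sum_sum_type, Matrix.submatrix_apply, id_eq,
    Sum.map_inl, Sum.map_inr, Sum.elim_inl, Sum.elim_inr]
  rw [sum_extS (fun j t => A i (Sum.inr j) * t) (fun j => mul_zero _)]

theorem hessian_mulVec (x : EuclideanSpace ℝ (Fin p)) (f : EuclideanSpace ℝ (Fin m)) :
    hessian X D ν *ᵥ Sum.elim x.ofLp f.ofLp
      = Sum.elim (hessE (scaledX X) D.toEuclideanLin ν x f).ofLp
          (hessF D.toEuclideanLin ν x f).ofLp := by
  rw [hessian, Matrix.fromBlocks_mulVec]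
  congr 1
  · have h1 : (scaledX X).adjoint (scaledX X x) = (starMat X * X).toEuclideanLin x :=
      (starMat_mul_apply X x).symm
    rw [hessE, h1, adjoint_toEuclideanLin]
    simp only [Sum.elim_comp_inl, Sum.elim_comp_inr, Matrix.add_mulVec, Matrix.smul_mulVec,
      Matrix.neg_mulVec, ← Matrix.mulVec_mulVec, Matrix.toLpLin_apply, map_sub, smul_sub,
      WithLp.ofLp_add, WithLp.ofLp_sub, WithLp.ofLp_smul]
    abel
  · rw [hessF]
    simp only [Sum.elim_comp_inl, Sum.elim_comp_inr, Matrix.smul_mulVec,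
      Matrix.neg_mulVec, Matrix.toLpLin_apply, smul_sub, Matrix.one_mulVec,
      WithLp.ofLp_sub, WithLp.ofLp_smul]
    abel

theorem hessianSS_mulVec (x : EuclideanSpace ℝ (Fin p)) (g : EuclideanSpace ℝ {j // j ∈ S}) :
    hessianSS X D S ν *ᵥ Sum.elim x.ofLp g.ofLp
      = Sum.elim (hessE (scaledX X) D.toEuclideanLin ν x (extS S g)).ofLp
          (fun j : {j // j ∈ S} => hessF D.toEuclideanLin ν x (extS S g) j.1) := by
  have h1 : hessianSS X D S ν *ᵥ Sum.elim x.ofLp g.ofLp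
      = fun i => (hessian X D ν *ᵥ Sum.elim x.ofLp (extS S g).ofLp) (Sum.map id Subtype.val i) := by
    rw [← submatrix_mulVec_extS]; rfl
  rw [h1, hessian_mulVec]
  funext i
  cases i <;> rfl

theorem hessianCS_mulVec (x : EuclideanSpace ℝ (Fin p)) (g : EuclideanSpace ℝ {j // j ∈ S}) :
    hessianCS X D S ν *ᵥ Sum.elim x.ofLp g.ofLp
      = fun j : {j // j ∉ S} => hessF D.toEuclideanLin ν x (extS S g) j.1 := by
  have h1 : hessianCS X D S ν *ᵥ Sum.elim x.ofLp g.ofLp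
      = fun j => (hessian X D ν *ᵥ Sum.elim x.ofLp (extS S g).ofLp) (Sum.inr j.1) := by
    rw [← submatrix_mulVec_extS]; rfl
  rw [h1, hessian_mulVec]
  rfl

theorem dotProduct_ofLp {ι : Type*} [Fintype ι] (u v : EuclideanSpace ℝ ι) :
    u.ofLp ⬝ᵥ v.ofLp = ⟪v, u⟫ := by
  rw [EuclideanSpace.inner_eq_star_dotProduct, star_trivial]

theorem dotProduct_hessian (x : EuclideanSpace ℝ (Fin p)) (f : EuclideanSpace ℝ (Fin m)) :
    Sum.elim x.ofLp f.ofLp ⬝ᵥ (hessian X D ν *ᵥ Sum.elim x.ofLp f.ofLp)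
      = energy (scaledX X) D.toEuclideanLin ν x f := by
  rw [hessian_mulVec, sumElim_dotProduct_sumElim, dotProduct_ofLp, dotProduct_ofLp,
    inner_hess_self]

theorem dotProduct_hessianSS (x : EuclideanSpace ℝ (Fin p)) (g : EuclideanSpace ℝ {j // j ∈ S}) :
    Sum.elim x.ofLp g.ofLp ⬝ᵥ (hessianSS X D S ν *ᵥ Sum.elim x.ofLp g.ofLp)
      = energy (scaledX X) D.toEuclideanLin ν x (extS S g) := by
  rw [hessianSS_mulVec, sumElim_dotProduct_sumElim, ← inner_hess_self, dotProduct_ofLp]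
  congr 1
  rw [PiLp.inner_apply]
  have := sum_extS (S := S) (fun j t => hessF D.toEuclideanLin ν x (extS S g) j * t)
    (fun j => mul_zero _) g
  simp only [dotProduct]
  rw [Finset.sum_congr rfl fun j _ => mul_comm (g.ofLp j) _, ← this]
  refine Finset.sum_congr rfl fun j _ => ?_
  simp [mul_comm]

theorem energy_le_hessianNorm (x : EuclideanSpace ℝ (Fin p)) (f : EuclideanSpace ℝ (Fin m)) :
    energy (scaledX X) D.toEuclideanLin ν x f ≤ hessianNorm X D ν * (‖x‖ ^ 2 + ‖f‖ ^ 2) := by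
  set v : EuclideanSpace ℝ (Fin p ⊕ Fin m) := WithLp.toLp 2 (Sum.elim x.ofLp f.ofLp) with hv
  have h1 : ‖v‖ ^ 2 = ‖x‖ ^ 2 + ‖f‖ ^ 2 := by
    rw [EuclideanSpace.real_norm_sq_eq, EuclideanSpace.real_norm_sq_eq,
      EuclideanSpace.real_norm_sq_eq, Fintype.sum_sum_type]
    rfl
  have h2 : energy (scaledX X) D.toEuclideanLin ν x f
      = ⟪Matrix.toEuclideanCLM (𝕜 := ℝ) (hessian X D ν) v, v⟫ := by
    rw [← dotProduct_hessian, ← dotProduct_ofLp]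
    rfl
  rw [h2, ← h1, hessianNorm, sq, ← mul_assoc]
  exact (real_inner_le_norm _ _).trans
    (mul_le_mul_of_nonneg_right (ContinuousLinearMap.le_opNorm _ _) (norm_nonneg _))

theorem norm_rowsCompl_apply (x : EuclideanSpace ℝ (Fin p)) :
    ‖(rowsCompl D S).toEuclideanLin x‖ = ‖offPart D.toEuclideanLin (mask S) x‖ := by
  have h1 : ∀ j, offPart D.toEuclideanLin (mask S) x j
      = if j ∈ S then 0 else D.toEuclideanLin x j := by
    intro j
    rw [offPart_apply, PiLp.sub_apply, mask_apply]
    split_ifs <;> simp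
  rw [EuclideanSpace.norm_eq, EuclideanSpace.norm_eq]
  congr 1
  have h2 : ∑ j, ‖offPart D.toEuclideanLin (mask S) x j‖ ^ 2
      = ∑ j ∈ Finset.univ.filter (· ∉ S), ‖D.toEuclideanLin x j‖ ^ 2 := by
    rw [Finset.sum_filter]
    refine Finset.sum_congr rfl fun j _ => ?_
    rw [h1]
    by_cases hj : j ∈ S <;> simp [hj]
  rw [h2, Finset.sum_subtype (p := (· ∉ S)) (Finset.univ.filter (· ∉ S)) (by simp)]
  rfl

theorem ker_rowsCompl : LinearMap.ker (rowsCompl D S).toEuclideanLin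
    = LinearMap.ker (offPart D.toEuclideanLin (mask S)) := by
  ext x
  rw [LinearMap.mem_ker, LinearMap.mem_ker, ← norm_eq_zero, norm_rowsCompl_apply, norm_eq_zero]

variable {X D ν}

theorem IrrSchur.of_IRR (hν : 0 < ν) {η : ℝ} (h : IRR X D S ν η) :
    IrrSchur (scaledX X) D.toEuclideanLin (mask S) ν η := by
  intro ρ hρ x hx j
  by_cases hj : j ∈ S
  · have h0 : offPart D.toEuclideanLin (mask S) x j = 0 := by
      rw [offPart_apply, PiLp.sub_apply, mask_apply, if_pos hj, sub_self]
    have h1 := h (fun _ => (0 : ℝ)) (fun _ => ⟨by norm_num, by norm_num⟩)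
    rw [h0, abs_zero, mul_zero]
    exact (norm_nonneg _).trans h1
  -- Chosen so that the Hessian maps (x, f) to 0 in the β block and to ρ on S; off S its value is
  -- minus the off-part over ν.
  set f := mask S (D.toEuclideanLin x) + ν • mask S ρ with hf
  have hfm : mask S f = f := by rw [hf, map_add, map_smul, mask_mask, mask_mask]
  obtain ⟨g, hg, -⟩ := exists_extS_eq hfm
  set H := hessianSS X D S ν with hH
  set v := Sum.elim x.ofLp g.ofLp with hv
  have hE : hessE (scaledX X) D.toEuclideanLin ν x f = 0 := by
    have e1 : D.toEuclideanLin x - f = offPart D.toEuclideanLin (mask S) x - ν • mask S ρ := by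
      rw [hf, offPart_apply]; abel
    have e2 : D.toEuclideanLin.adjoint (offPart D.toEuclideanLin (mask S) x)
        = (offPart D.toEuclideanLin (mask S)).adjoint (offPart D.toEuclideanLin (mask S) x) := by
      refine ext_inner_right ℝ fun w => ?_
      rw [LinearMap.adjoint_inner_left, LinearMap.adjoint_inner_left, offPart_apply, offPart_apply,
        inner_sub_right _ (D.toEuclideanLin w), ← mask_isSymmetric, map_sub, mask_mask, sub_self,
        inner_zero_left, sub_zero]
    rw [hessE, e1, map_sub, map_smul, smul_sub, smul_smul, one_div_mul_cancel hν.ne', one_smul,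
      ← hx, e2, schur_apply]
    abel
  have hF : ∀ i, hessF D.toEuclideanLin ν x f i
      = if i ∈ S then ρ i else -(1 / ν * offPart D.toEuclideanLin (mask S) x i) := by
    intro i
    rw [hessF, PiLp.smul_apply, PiLp.sub_apply, hf, PiLp.add_apply, PiLp.smul_apply, mask_apply,
      mask_apply, offPart_apply, PiLp.sub_apply, mask_apply]
    split_ifs
    · simp only [smul_eq_mul, add_sub_cancel_left]; field_simp
    · simp
  have hHv : H *ᵥ v = Sum.elim (0 : Fin p → ℝ) (fun i : {j // j ∈ S} => ρ i.1) := by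
    rw [hH, hv, hessianSS_mulVec, hg, hE]
    congr 1
    funext i
    rw [hF, if_pos i.2]
  obtain ⟨hP, -, -, -⟩ := pinv_spec H
  have h1 := h (fun i => ρ i.1) (fun i => abs_le.1 (hρ i.1))
  rw [← hHv, ← hH] at h1
  set v' := pinv H *ᵥ (H *ᵥ v) with hv'
  have h2 : (hessianCS X D S ν * pinv H) *ᵥ (H *ᵥ v) = hessianCS X D S ν *ᵥ v' := by
    simp only [hv', Matrix.mulVec_mulVec, Matrix.mul_assoc]
  have h3 : H *ᵥ v' = H *ᵥ v := by
    rw [hv', Matrix.mulVec_mulVec, Matrix.mulVec_mulVec, hP]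
  set k1 : EuclideanSpace ℝ (Fin p) := WithLp.toLp 2 fun i => (v' - v) (Sum.inl i) with hk1
  set k2 : EuclideanSpace ℝ {j // j ∈ S} := WithLp.toLp 2 fun i => (v' - v) (Sum.inr i) with hk2
  have hk : v' - v = Sum.elim k1.ofLp k2.ofLp := by
    funext i; cases i <;> rfl
  -- The pseudoinverse may return another solution, but the difference has zero energy, so the rows
  -- outside S annihilate it.
  have h4 : energy (scaledX X) D.toEuclideanLin ν k1 (extS S k2) = 0 := by
    rw [← dotProduct_hessianSS, ← hk, ← hH, Matrix.mulVec_sub, h3, sub_self, dotProduct_zero]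
  have h5 : extS S k2 - D.toEuclideanLin k1 = 0 := by
    rw [energy] at h4
    have e1 : 0 ≤ 1 / ν * ‖extS S k2 - D.toEuclideanLin k1‖ ^ 2 := by positivity
    have e2 : 1 / ν * ‖extS S k2 - D.toEuclideanLin k1‖ ^ 2 = 0 := by
      nlinarith [sq_nonneg ‖scaledX X k1‖]
    have e3 : (1 / ν) ≠ 0 := by positivity
    simpa [hν.ne'] using e2
  have h6 : hessianCS X D S ν *ᵥ v' = hessianCS X D S ν *ᵥ v := by
    rw [← sub_eq_zero, ← Matrix.mulVec_sub, hk, hessianCS_mulVec]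
    funext i
    rw [hessF, h5, smul_zero]; rfl
  rw [h2, h6, hv, hessianCS_mulVec, hg] at h1
  have h7 := (norm_le_pi_norm (fun j : {j // j ∉ S} => hessF D.toEuclideanLin ν x f j.1)
    ⟨j, hj⟩).trans h1
  simp only [hF, if_neg hj, norm_neg, norm_mul, Real.norm_eq_abs] at h7
  rwa [abs_of_pos (by positivity : 0 < 1 / ν)] at h7

theorem ker_scaledX (hn : 0 < n) :
    LinearMap.ker (scaledX X) = LinearMap.ker X.toEuclideanLin := by
  have : (Real.sqrt n)⁻¹ ≠ 0 := by positivity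
  exact LinearMap.ker_smul _ _ this

/-- The assumptions of the consistency theorem give a `Design`. -/
theorem Design.of_isSpectralBound (hn : 0 < n) {lamD LamD LamX C : ℝ}
    (h : IsSpectralBound X D S lamD LamD LamX) (hν : 0 < ν) (hC : 0 < C) (hS : S.Nonempty)
    (hR : RSCNu X D S ν C) :
    Design (scaledX X) D.toEuclideanLin (mask S) ν lamD LamX (C / (1 + ν)) (invLamOne X D) where
  nu_pos := hν
  lamD_pos := h.lamD_pos
  LamX_pos := h.LamX_pos
  lamH_pos := by positivity
  i1_nonneg := ENNReal.toReal_nonneg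
  symm := mask_isSymmetric S
  idem := mask_mask S
  B_le x := by
    refine le_of_sq_le_sq ?_ (mul_nonneg h.LamX_pos.le (norm_nonneg _))
    rw [← inner_starMat_mul]
    refine (real_inner_le_norm _ _).trans ?_
    have h1 := (norm_apply_le_maxSingularValue (starMat X * X).toEuclideanLin x).trans
      (mul_le_mul_of_nonneg_right h.X_le (norm_nonneg _))
    nlinarith [norm_nonneg x]
  D_ge x hx := by
    have := mul_norm_le_of_ofReal_le_minPosSingularValue _ h.lamD_pos.le
      (h.le_min.trans (min_le_left _ _)) hx
    rwa [← div_eq_inv_mul, le_div_iff₀ h.lamD_pos, mul_comm]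
  off_ge x hx := by
    rw [← ker_rowsCompl] at hx
    have := mul_norm_le_of_ofReal_le_minPosSingularValue _ h.lamD_pos.le
      (h.le_min.trans (min_le_right _ _)) hx
    rw [norm_rowsCompl_apply] at this
    rwa [← div_eq_inv_mul, le_div_iff₀ h.lamD_pos, mul_comm]
  ker_ge x hx hxL := by
    have h1 := norm_le_inv_minPosSingularValue_mul
      ((scaledX X).domRestrict (LinearMap.ker D.toEuclideanLin)) (x := ⟨x, hx⟩) (by
        rw [Submodule.mem_orthogonal]
        intro v hv
        exact (Submodule.mem_orthogonal _ _).1 hxL v ⟨hv, v.2⟩)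
    exact h1
  coercive x hx f hf := by
    obtain ⟨g, hg, -⟩ := exists_extS_eq hf
    have h1 := hR x (by rw [subL, ← ker_scaledX hn]; exact hx) g
    rw [dotProduct_hessianSS, ← norm_extS g, hg] at h1
    exact h1
  lamH_mul_nu := by
    obtain ⟨j, hj⟩ := hS
    -- At β = 0 and a unit vector of ℝ^S the form equals 1/ν.
    have h1 := hR 0 (Submodule.zero_mem _) (EuclideanSpace.single ⟨j, hj⟩ 1)
    rw [dotProduct_hessianSS, energy, map_zero, map_zero, sub_zero, norm_extS] at h1
    simp only [norm_zero, PiLp.norm_single, norm_one] at h1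
    have h2 : C / (1 + ν) ≤ 1 / ν := by linarith
    rwa [le_div_iff₀ hν] at h2

/-- The map (β, γ) ↦ (Xβ/√n, γ - Dβ) does not involve ν. In its kernel Dβ is supported in S, so β ∈
𝓜 and RSC gives injectivity, hence an antilipschitz constant K. Bounding β and γ separately gives
2K², and both 1 and 1/ν are at least 1/(1 + ν). -/
theorem exists_RSCNu (h : RSC X D S) : ∃ C : ℝ, 0 < C ∧ ∀ ν' : ℝ, 0 < ν' → RSCNu X D S ν' C := by
  obtain ⟨lam, hlam, hR⟩ := h
  let T : (subL X D) × EuclideanSpace ℝ {j // j ∈ S} →ₗ[ℝ]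
      EuclideanSpace ℝ (Fin n) × EuclideanSpace ℝ (Fin m) :=
    LinearMap.prod (scaledX X ∘ₗ (subL X D).subtype ∘ₗ LinearMap.fst ℝ _ _)
      (extS S ∘ₗ LinearMap.snd ℝ _ _
        - D.toEuclideanLin ∘ₗ (subL X D).subtype ∘ₗ LinearMap.fst ℝ _ _)
  have hT : ∀ v, T v = (scaledX X v.1, extS S v.2 - D.toEuclideanLin v.1) := fun v => rfl
  have hker : LinearMap.ker T = ⊥ := by
    rw [LinearMap.ker_eq_bot']
    rintro ⟨⟨x, hx⟩, g⟩ hv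
    rw [hT, Prod.mk_eq_zero] at hv
    obtain ⟨h1, h2⟩ := hv
    simp only at h1 h2
    rw [sub_eq_zero] at h2
    have h3 : x ∈ subM D S := by
      rw [subM, ker_rowsCompl, LinearMap.mem_ker, offPart_apply, ← h2, mask_extS, sub_self]
    have h4 := hR x ⟨hx, h3⟩
    rw [inner_starMat_mul, h1, norm_zero] at h4
    have h5 : x = 0 := by
      by_contra hne
      have : 0 < ‖x‖ := norm_pos_iff.2 hne
      have : 0 < lam * ‖x‖ ^ 2 := by positivity
      norm_num at h4
      linarith
    subst h5
    rw [map_zero, ← norm_eq_zero, norm_extS, norm_eq_zero] at h2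
    subst h2
    rfl
  obtain ⟨K, hK0, hK⟩ := LinearMap.exists_antilipschitzWith T hker
  have hK0' : (0 : ℝ) < K := by exact_mod_cast hK0
  refine ⟨1 / (2 * K ^ 2), by positivity, fun ν' hν' x hx g => ?_⟩
  rw [dotProduct_hessianSS, energy]
  have h1 := hK.le_mul_norm_sub (⟨x, hx⟩, g) 0
  rw [map_zero, add_zero, add_zero, norm_neg, norm_neg, hT] at h1
  set A := ‖scaledX X x‖ with hA
  set B := ‖extS S g - D.toEuclideanLin x‖ with hB
  have h2 : ‖((scaledX X x, extS S g - D.toEuclideanLin x) :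
      EuclideanSpace ℝ (Fin n) × EuclideanSpace ℝ (Fin m))‖ = max A B := rfl
  simp only at h1
  rw [h2] at h1
  have hx1 : ‖x‖ ≤ K * max A B :=
    (norm_fst_le ((⟨x, hx⟩, g) : (subL X D) × EuclideanSpace ℝ {j // j ∈ S})).trans h1
  have hg1 : ‖g‖ ≤ K * max A B :=
    (norm_snd_le ((⟨x, hx⟩, g) : (subL X D) × EuclideanSpace ℝ {j // j ∈ S})).trans h1
  have h3 : (max A B) ^ 2 ≤ A ^ 2 + B ^ 2 := by
    rcases max_cases A B with h | h <;> rw [h.1] <;> nlinarith [sq_nonneg A, sq_nonneg B]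
  have h4 : ‖x‖ ^ 2 + ‖g‖ ^ 2 ≤ 2 * K ^ 2 * (A ^ 2 + B ^ 2) := by
    have e1 := pow_le_pow_left₀ (norm_nonneg _) hx1 2
    have e2 := pow_le_pow_left₀ (norm_nonneg _) hg1 2
    rw [mul_pow] at e1 e2
    have e3 := mul_le_mul_of_nonneg_left h3 (sq_nonneg (K : ℝ))
    linarith
  have h5 : 1 / (1 + ν') ≤ 1 := by rw [div_le_one (by positivity)]; linarith
  have h6 : 1 / (1 + ν') ≤ 1 / ν' := one_div_le_one_div_of_le hν' (by linarith)
  calc 1 / (2 * (K : ℝ) ^ 2) / (1 + ν') * (‖x‖ ^ 2 + ‖g‖ ^ 2)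
      ≤ 1 / (2 * (K : ℝ) ^ 2) / (1 + ν') * (2 * K ^ 2 * (A ^ 2 + B ^ 2)) := by gcongr
    _ = 1 / (1 + ν') * A ^ 2 + 1 / (1 + ν') * B ^ 2 := by field_simp
    _ ≤ 1 * A ^ 2 + 1 / ν' * B ^ 2 := by gcongr
    _ = A ^ 2 + 1 / ν' * B ^ 2 := by ring

end Matrices

/-! ### Linear functionals of the oracle as linear functionals of the noise. -/

section Functional

variable {E F G : Type*}
    [NormedAddCommGroup E] [InnerProductSpace ℝ E] [FiniteDimensional ℝ E]
    [NormedAddCommGroup F] [InnerProductSpace ℝ F] [FiniteDimensional ℝ F]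
    [NormedAddCommGroup G] [InnerProductSpace ℝ G] [FiniteDimensional ℝ G]
    {B : E →ₗ[ℝ] G} {D : E →ₗ[ℝ] F} {P : F →ₗ[ℝ] F} {ν lamD LamX lamH i1 : ℝ}

/-- Linear functionals of `D x`, where `x` solves the Schur equation with noise `e`, are linear
functionals of `e`, with the expected bound. -/
theorem Design.exists_inner_eq (h : Design B D P ν lamD LamX lamH i1) (f : F) {K : ℝ} (hK0 : 0 ≤ K)
    (hK : ∀ x e, schur B D P ν x = B.adjoint e → |⟪f, D x⟫| ≤ K * ‖e‖) :
    ∃ a : G, (∀ x e, schur B D P ν x = B.adjoint e → ⟪f, D x⟫ = ⟪a, e⟫) ∧ ‖a‖ ≤ K := by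
  -- Symmetry of the Schur complement moves it onto q, so the representer is B q; the noise e = B q
  -- then reveals its norm.
  obtain ⟨q, -, hq⟩ := h.exists_schur_eq (h.adjoint_D_mem f)
  have h1 : ∀ x e, schur B D P ν x = B.adjoint e → ⟪f, D x⟫ = ⟪B q, e⟫ := by
    intro x e hx
    rw [← LinearMap.adjoint_inner_left, ← hq, schur_isSymmetric, hx,
      LinearMap.adjoint_inner_right]
  refine ⟨B q, h1, ?_⟩
  obtain ⟨x, -, hx⟩ := h.exists_schur_eq (h.adjoint_B_mem (B q))
  have h2 := hK x _ hx
  rw [h1 x _ hx, real_inner_self_eq_norm_sq, abs_of_nonneg (sq_nonneg _), sq] at h2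
  rcases (norm_nonneg (B q)).eq_or_lt with h0 | h0
  · rwa [← h0]
  · exact le_of_mul_le_mul_right h2 h0

end Functional

/-! ### The oracle iteration in matrix form and its coincidence with Split LBI. -/

section Oracle

variable {n p m : ℕ} (X : Matrix (Fin n) (Fin p) ℝ) (D : Matrix (Fin m) (Fin p) ℝ)
  (S : Finset (Fin m)) (y : EuclideanSpace ℝ (Fin n)) (ν κ α : ℝ)

/-- The state of the oracle iteration, in which `γ` is set to zero outside `S`. -/
noncomputable def oracleState : ℕ → EuclideanSpace ℝ (Fin p) × EuclideanSpace ℝ (Fin m)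
  | 0 => (0, 0)
  | k + 1 =>
    ((oracleState k).1 - (κ * α) •
        gradBeta X D y ν (oracleState k).1 (mask S (κ • shrink (oracleState k).2 1)),
      (oracleState k).2 - α •
        gradGamma D ν (oracleState k).1 (mask S (κ • shrink (oracleState k).2 1)))

theorem gradBeta_eq (b : EuclideanSpace ℝ (Fin p)) (g : EuclideanSpace ℝ (Fin m)) :
    gradBeta X D y ν b g = (scaledX X).adjoint (scaledX X b - (Real.sqrt n)⁻¹ • y)
      + (1 / ν) • D.toEuclideanLin.adjoint (D.toEuclideanLin b - g) := by
  rw [gradBeta, scaledX_apply, ← smul_sub, adjoint_scaledX_smul, adjoint_toEuclideanLin]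

theorem oraclePath_oracleState :
    OraclePath (scaledX X) D.toEuclideanLin S ν κ α ((Real.sqrt n)⁻¹ • y)
      (fun k => (oracleState X D S y ν κ α k).1) (fun k => (oracleState X D S y ν κ α k).2)
      (fun k => mask S (κ • shrink (oracleState X D S y ν κ α k).2 1)) where
  b_zero := rfl
  z_zero := rfl
  b_succ k := by rw [← gradBeta_eq]; rfl
  z_succ k := rfl
  g_eq k := rfl

variable {X D S y ν κ α}

theorem mask_shrink {z : EuclideanSpace ℝ (Fin m)} (hz : ∀ j ∉ S, |z j| ≤ 1) :
    mask S (κ • shrink z 1) = κ • shrink z 1 := by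
  ext j
  rw [mask_apply]
  split_ifs with hj
  · rfl
  · rw [PiLp.smul_apply, shrink_apply, soft_eq_zero_of_abs_le (hz j hj), smul_zero]

/-- As long as |z| ≤ 1 off S, thresholding already vanishes there and the projection does nothing.
Only the oracle iterates need to be controlled. -/
theorem state_eq_oracleState (hα : 0 < α) {τ : ℝ}
    (h : ∀ k : ℕ, k * α ≤ τ → ∀ j ∉ S, |(oracleState X D S y ν κ α k).2 j| ≤ 1) (k : ℕ)
    (hk : k * α ≤ τ) : state X D y ν κ α k = oracleState X D S y ν κ α k := by
  induction k with
  | zero => rfl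
  | succ k ih =>
    have hk' : k * α ≤ τ := by push_cast at hk; linarith
    rw [state, oracleState, ih hk', mask_shrink (h k hk')]

end Oracle

/-! ### Union bound over the noise events. -/

section Noise

variable {Ω : Type*} [MeasurableSpace Ω] {μ : Measure Ω} [IsProbabilityMeasure μ]
  {H : Type*} [NormedAddCommGroup H] [InnerProductSpace ℝ H] [FiniteDimensional ℝ H]
  {V : Ω → H} {σ : ℝ}

/-- The probability that one of the noise terms is large. -/
theorem SubgaussianVector.measure_noise_le (hV : SubgaussianVector V σ μ) (hσ : 0 < σ) {m : ℕ}
    (hm : 7 ≤ m) (W : Submodule ℝ H) (a : Fin m → H) (K : Fin m → ℝ) (hK : ∀ j, 0 < K j)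
    (ha : ∀ j, ‖a j‖ ≤ K j) :
    μ.real {ω | 2 * σ * Real.sqrt (Module.finrank ℝ H) < ‖V ω‖ ∨
        2 * σ * Real.sqrt (Module.finrank ℝ W * Real.log m) < ‖W.starProjection (V ω)‖ ∨
        ∃ j, σ * K j * (2 * Real.sqrt (Real.log m)) ≤ |⟪a j, V ω⟫|}
      ≤ Real.exp (-(4 * (Module.finrank ℝ H : ℝ) / 5)) + 3 / m := by
  have hm0 : (0 : ℝ) < m := by positivity
  have hm1 : (7 : ℝ) ≤ m := by exact_mod_cast hm
  have hlog : 0 ≤ Real.log m := Real.log_natCast_nonneg m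
  have h1 : μ.real {ω | 2 * σ * Real.sqrt (Module.finrank ℝ H) < ‖V ω‖}
      ≤ Real.exp (-(4 * (Module.finrank ℝ H : ℝ) / 5)) := by
    have := hV.measure_projection_gt_le hσ ⊤ zero_le_one
    simp only [finrank_top, mul_one, Submodule.starProjection_top, ContinuousLinearMap.id_apply]
      at this
    refine this.trans ?_
    -- The rate 4/5 comes from log 2 < 7/10.
    have h2 : 2 * Real.exp (-(3 / 2)) ≤ Real.exp (-(4 / 5)) := by
      have : (2 : ℝ) ≤ Real.exp (7 / 10) := by
        rw [← Real.log_le_iff_le_exp (by norm_num)]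
        linarith [Real.log_two_lt_d9]
      calc 2 * Real.exp (-(3 / 2)) ≤ Real.exp (7 / 10) * Real.exp (-(3 / 2)) := by gcongr
        _ = Real.exp (-(4 / 5)) := by rw [← Real.exp_add]; norm_num
    refine (pow_le_pow_left₀ (by positivity) h2 _).trans_eq ?_
    rw [← Real.exp_nat_mul]
    congr 1
    ring
  have h2 : μ.real {ω | 2 * σ * Real.sqrt (Module.finrank ℝ W * Real.log m)
      < ‖W.starProjection (V ω)‖} ≤ 1 / m := by
    -- For W = 0 the event is empty, whereas the tail bound raised to the power 0 would only give 1.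
    rcases Nat.eq_zero_or_pos (Module.finrank ℝ W) with h0 | h0
    · rw [Submodule.finrank_eq_zero] at h0
      subst h0
      simp
    · refine (hV.measure_projection_gt_le hσ W hlog).trans ?_
      have h3 : 2 * Real.exp (-(3 / 2) * Real.log m) ≤ 1 / m := by
        have e1 : Real.exp (-(3 / 2) * Real.log m)
            = (m : ℝ)⁻¹ * Real.exp (-(1 / 2) * Real.log m) := by
          nth_rewrite 2 [← Real.exp_log hm0]
          rw [← Real.exp_neg, ← Real.exp_add]
          congr 1
          ring
        have e2 : 2 * Real.exp (-(1 / 2) * Real.log m) ≤ 1 := by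
          have h4 : 2 * Real.log 2 ≤ Real.log m := by
            rw [← Real.log_rpow two_pos]
            exact Real.log_le_log (by norm_num) (by norm_num; linarith)
          have h5 : Real.exp (-(1 / 2) * Real.log m) ≤ Real.exp (-Real.log 2) :=
            Real.exp_le_exp.2 (by linarith)
          rw [Real.exp_neg, Real.exp_log two_pos] at h5
          linarith
        rw [e1, one_div (m : ℝ)]
        have : (0 : ℝ) < (m : ℝ)⁻¹ := by positivity
        nlinarith
      refine (pow_le_of_le_one (by positivity) ?_ h0.ne').trans h3
      refine h3.trans ?_
      rw [div_le_one hm0]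
      linarith
  have h3 : μ.real (⋃ j, {ω | σ * K j * (2 * Real.sqrt (Real.log m)) ≤ |⟪a j, V ω⟫|}) ≤ 2 / m := by
    refine (measureReal_iUnion_fintype_le _).trans ?_
    have h4 : ∀ j, μ.real {ω | σ * K j * (2 * Real.sqrt (Real.log m)) ≤ |⟪a j, V ω⟫|}
        ≤ 2 * ((m : ℝ)⁻¹ * (m : ℝ)⁻¹) := by
      intro j
      refine (hV.measure_abs_inner_ge_le hσ (hK j) (ha j) (by positivity)).trans_eq ?_
      rw [mul_pow, Real.sq_sqrt hlog]
      nth_rewrite 2 [← Real.exp_log hm0]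
      nth_rewrite 3 [← Real.exp_log hm0]
      rw [← Real.exp_neg, ← Real.exp_add]
      congr 2
      ring
    refine (Finset.sum_le_sum fun j _ => h4 j).trans_eq ?_
    rw [Finset.sum_const, Finset.card_univ, Fintype.card_fin, nsmul_eq_mul]
    field_simp
  set A1 := {ω | 2 * σ * Real.sqrt (Module.finrank ℝ H) < ‖V ω‖}
  set A2 := {ω | 2 * σ * Real.sqrt (Module.finrank ℝ W * Real.log m) < ‖W.starProjection (V ω)‖}
  set A3 := ⋃ j, {ω | σ * K j * (2 * Real.sqrt (Real.log m)) ≤ |⟪a j, V ω⟫|}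
  have h4 : {ω | 2 * σ * Real.sqrt (Module.finrank ℝ H) < ‖V ω‖ ∨
        2 * σ * Real.sqrt (Module.finrank ℝ W * Real.log m) < ‖W.starProjection (V ω)‖ ∨
        ∃ j, σ * K j * (2 * Real.sqrt (Real.log m)) ≤ |⟪a j, V ω⟫|} ⊆ A1 ∪ (A2 ∪ A3) := by
    rintro ω (h | h | ⟨j, h⟩)
    · exact Or.inl h
    · exact Or.inr (Or.inl h)
    · exact Or.inr (Or.inr (Set.mem_iUnion.2 ⟨j, h⟩))
  have h5 := (measureReal_mono (μ := μ) h4).trans (measureReal_union_le _ _)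
  have h6 := measureReal_union_le (μ := μ) A2 A3
  have h7 : 3 / (m : ℝ) = 1 / m + 2 / m := by ring
  linarith

end Noise

/-! ### Assembly of the theorem. -/

section Main

variable {n p m : ℕ} {X : Matrix (Fin n) (Fin p) ℝ} {D : Matrix (Fin m) (Fin p) ℝ}
  {S : Finset (Fin m)} {ν : ℝ}

theorem map_scaledX (hn : 0 < n) (W : Submodule ℝ (EuclideanSpace ℝ (Fin p))) :
    Submodule.map (scaledX X) W = Submodule.map X.toEuclideanLin W := by
  have : (Real.sqrt n)⁻¹ ≠ 0 := by positivity
  exact Submodule.map_smul _ _ _ this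

theorem mem_supp {γ : EuclideanSpace ℝ (Fin m)} {j : Fin m} : j ∈ supp γ ↔ γ j ≠ 0 := by
  simp [supp]

theorem offPart_mask_supp {βs : EuclideanSpace ℝ (Fin p)} (hS : S = supp (D.toEuclideanLin βs)) :
    offPart D.toEuclideanLin (mask S) βs = 0 := by
  ext j
  rw [offPart_apply, PiLp.sub_apply, mask_apply, PiLp.zero_apply]
  split_ifs with hj
  · exact sub_self _
  · rw [hS, mem_supp, not_not] at hj
    rw [hj, sub_zero]

/-- The noise functionals for the coordinates of `D x`. -/
theorem Design.exists_coordinate_functional {lamD LamX lamH i1 : ℝ}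
    (h : Design (scaledX X) D.toEuclideanLin (mask S) ν lamD LamX lamH i1) (j : Fin m) :
    ∃ a : EuclideanSpace ℝ (Fin n),
      (∀ x e, schur (scaledX X) D.toEuclideanLin (mask S) ν x = (scaledX X).adjoint e →
        D.toEuclideanLin x j = ⟪a, e⟫) ∧
      ‖a‖ ≤ if j ∈ S then LamX / (lamD * lamH) else ν * LamX / lamD := by
  have hν := h.nu_pos
  have hl := h.lamD_pos
  have hX := h.LamX_pos
  have hH := h.lamH_pos
  have h1 : ∀ f : EuclideanSpace ℝ (Fin m), ⟪EuclideanSpace.single j (1 : ℝ), f⟫ = f j := by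
    intro f
    simp [EuclideanSpace.inner_single_left]
  simp_rw [← h1 (D.toEuclideanLin _)]
  refine h.exists_inner_eq _ (by split_ifs <;> positivity) fun x e hx => ?_
  rw [h1]
  split_ifs with hj
  · have h2 := h.norm_D_le hx
    have h3 := abs_apply_le_norm (D.toEuclideanLin x) j
    rw [← div_div, div_mul_eq_mul_div, le_div_iff₀ hH]
    nlinarith
  · have h2 := h.norm_offPart_le hx
    have h3 := abs_apply_le_norm (offPart D.toEuclideanLin (mask S) x) j
    rw [offPart_apply, PiLp.sub_apply, mask_apply, if_neg hj, sub_zero] at h3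
    rw [offPart_apply, one_div, inv_mul_le_iff₀ hν] at h2
    refine (h3.trans h2).trans_eq ?_
    ring

/-- Subadditivity of the outer measure on bad ∪ s; neither event has to be measurable. -/
theorem le_measureReal_of_forall_notMem {Ω : Type*} [MeasurableSpace Ω] {μ : Measure Ω}
    [IsProbabilityMeasure μ] {s bad : Set Ω} {c q : ℝ} (hbad : μ.real bad ≤ q) (hc : c ≤ 1 - q)
    (h : ∀ ω ∉ bad, ω ∈ s) : c ≤ μ.real s := by
  have h1 : (Set.univ : Set Ω) ⊆ bad ∪ s := fun ω _ => or_iff_not_imp_left.2 (h ω)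
  have h2 := (measureReal_mono (μ := μ) h1).trans (measureReal_union_le _ _)
  rw [probReal_univ] at h2
  linarith

end Main

end SplitLBI

theorem mainTheorem2 {n p m : ℕ}
    {Ω : Type*} [MeasurableSpace Ω] (μ : Measure Ω) [IsProbabilityMeasure μ]
    (X : Matrix (Fin n) (Fin p) ℝ) (D : Matrix (Fin m) (Fin p) ℝ)
    (βs : EuclideanSpace ℝ (Fin p)) (S : Finset (Fin m))
    (hS : S = supp (D.toEuclideanLin βs)) (hS0 : S.Nonempty) (hβs : βs ∈ subL X D)
    (σ : ℝ) (hσ : 0 < σ) (ε : Fin n → Ω → ℝ) (hεm : ∀ i, Measurable (ε i))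
    (hεindep : iIndepFun ε μ) (hεid : ∀ i j, IdentDistrib (ε i) (ε j) μ μ)
    (hεsub : ∀ i, HasSubgaussianMGF (ε i) (Real.toNNReal (σ ^ 2)) μ)
    (lamD LamD LamX : ℝ) (hconst : IsSpectralBound X D S lamD LamD LamX)
    (ν : ℝ) (hν : 0 < ν)
    (hRSC : RSC X D S)
    (η : ℝ) (hη : η ∈ Set.Ioc (0 : ℝ) 1) (hIRR : IRR X D S ν η) :
    (∃ C : ℝ, 0 < C ∧ ∀ ν' : ℝ, 0 < ν' → RSCNu X D S ν' C) ∧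
    ∀ C : ℝ, 0 < C → RSCNu X D S ν C →
    ∀ κ α : ℝ, 0 < κ → 0 < α →
    ∀ lamH' : ℝ, lamH' = C / (1 + ν) * (1 - κ * α * hessianNorm X D ν / 2) →
    ∀ τ : ℝ, τ = tauBar n m σ η lamD LamX →
    ∀ i1 : ℝ, i1 = invLamOne X D →
    κ * α * hessianNorm X D ν < 2 →
    kappaLower σ η ν lamD LamD LamX i1 ‖βs‖ lamH' ≤ κ →
    5 * α < τ →
    1 - 6 / (m : ℝ) - 3 * Real.exp (-(4 * (n : ℝ) / 5)) ≤
      μ.real {ω |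
        let y := observation X βs (fun i => ε i ω)
        let kbar := ⌊τ / α⌋₊
        -- no false positive
        (∀ k : ℕ, (k : ℝ) * α ≤ τ → supp (iterGamma X D y ν κ α k) ⊆ S) ∧
        -- sign consistency under the strong signal condition
        ((∀ j ∈ S, 16 * σ / (η * lamH' * (1 - 5 * α / τ)) * (LamX * LamD / lamD ^ 2)
              * (2 * Real.log S.card + 5 + max 0 (Real.log (8 * LamD)))
              * Real.sqrt (Real.log m / n) ≤ |D.toEuclideanLin βs j|) →
          ∀ j, SignType.sign (iterGamma X D y ν κ α kbar j)
            = SignType.sign (D.toEuclideanLin βs j)) ∧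
        -- bound for the gamma iterate
        (‖iterGamma X D y ν κ α kbar - D.toEuclideanLin βs‖ ≤
          42 * σ / (η * lamH' * (1 - α / τ)) * (LamX / lamD)
            * Real.sqrt (S.card * Real.log m / n)) ∧
        -- bound for the beta iterate
        (‖iterBeta X D y ν κ α kbar - βs‖ ≤
          42 * σ / (η * lamH' * (1 - α / τ))
              * ((LamX * (1 + lamD) + LamX ^ 2 * i1) / lamD ^ 2)
              * Real.sqrt (S.card * Real.log m / n)
            + 2 * σ * i1 * Real.sqrt (rPrime X D * Real.log m / n)
            + ν * (2 * σ) * ((LamX + LamX ^ 2 * i1) / lamD ^ 2))} := by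
  refine ⟨exists_RSCNu hRSC, ?_⟩
  intro C hC hR κ α hκ hα lamH' hlamH' τ hτ i1 hi1 hstep hkappa htau
  obtain hm | hm := Nat.lt_or_ge m 7
  -- For m ≤ 6 the claimed probability is at most zero.
  · have hm0 : 0 < m := by
      obtain ⟨j, -⟩ := hS0
      exact j.pos
    have h1 : (1 : ℝ) ≤ 6 / m := by
      rw [le_div_iff₀ (by positivity), one_mul]
      exact_mod_cast Nat.lt_succ_iff.1 hm
    have h2 := Real.exp_pos (-(4 * (n : ℝ) / 5))
    exact le_trans (by linarith) measureReal_nonneg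
  have hm1 : (7 : ℝ) ≤ m := by exact_mod_cast hm
  have hlog : 0 < Real.log m := Real.log_pos (by linarith)
  have hn : 0 < n := by
    -- With n = 0 the stopping time is 0, against 5α < τ.
    rcases Nat.eq_zero_or_pos n with h0 | h0
    · subst h0
      rw [tauBar, Nat.cast_zero, zero_div, Real.sqrt_zero, mul_zero] at hτ
      linarith
    · exact h0
  have hn' : (0 : ℝ) < n := by exact_mod_cast hn
  have hsn : 0 < Real.sqrt n := Real.sqrt_pos.2 hn'
  have hdes := Design.of_isSpectralBound hn hconst hν hC hS0 hR
  rw [← hi1] at hdes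
  have hlD := hdes.lamD_pos
  have hX := hdes.LamX_pos
  have hH := hdes.lamH_pos
  set lamH := C / (1 + ν) with hlamH
  set l := Real.sqrt (Real.log m / n) with hl
  have hD_le : ∀ x, ‖D.toEuclideanLin x‖ ≤ LamD * ‖x‖ := fun x =>
    (norm_apply_le_maxSingularValue _ x).trans
      (mul_le_mul_of_nonneg_right hconst.D_le (norm_nonneg _))
  -- S is nonempty, so D β* ≠ 0 and both spectral bounds apply to the component of β* orthogonal to
  -- ker D.
  have hlamD : lamD ≤ LamD := by
    obtain ⟨j, hj⟩ := hS0
    rw [hS, mem_supp] at hj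
    obtain ⟨u, hu, v, hv, huv⟩ := Submodule.exists_add_mem_mem_orthogonal
      (K := LinearMap.ker D.toEuclideanLin) βs
    have hDv : D.toEuclideanLin βs = D.toEuclideanLin v := by
      rw [huv, map_add, LinearMap.mem_ker.1 hu, zero_add]
    have hv0 : 0 < ‖v‖ := by
      rw [norm_pos_iff]
      rintro rfl
      rw [hDv, map_zero] at hj
      exact hj rfl
    have h1 := hdes.D_ge v hv
    rw [← div_eq_inv_mul, le_div_iff₀ hlD] at h1
    have h2 := h1.trans (hD_le v)
    rw [mul_comm] at h2
    exact le_of_mul_le_mul_right h2 hv0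
  choose a ha haK using hdes.exists_coordinate_functional
  set K : Fin m → ℝ := fun j => if j ∈ S then LamX / (lamD * lamH) else ν * LamX / lamD with hK
  have hK0 : ∀ j, 0 < K j := by
    intro j
    simp only [hK]
    split_ifs <;> positivity
  set V : Ω → EuclideanSpace ℝ (Fin n) := fun ω => WithLp.toLp 2 fun i => ε i ω with hV
  set W := Submodule.map (scaledX X) (LinearMap.ker D.toEuclideanLin) with hW
  have hWr : Module.finrank ℝ W = rPrime X D := by rw [hW, map_scaledX hn]; rfl
  have hbad := (subgaussianVector_of_iIndepFun hεm hεindep hεsub).measure_noise_le hσ hm W a K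
    hK0 haK
  rw [finrank_euclideanSpace_fin, hWr] at hbad
  set bad := {ω | 2 * σ * Real.sqrt n < ‖V ω‖ ∨
    2 * σ * Real.sqrt (rPrime X D * Real.log m) < ‖W.starProjection (V ω)‖ ∨
    ∃ j, σ * K j * (2 * Real.sqrt (Real.log m)) ≤ |⟪a j, V ω⟫|} with hbadset
  refine le_measureReal_of_forall_notMem hbad ?_ fun ω hω => ?_
  · have h3 := Real.exp_pos (-(4 * (n : ℝ) / 5))
    have h4 : 6 / (m : ℝ) = 3 / m + 3 / m := by ring
    have h5 : 0 < 3 / (m : ℝ) := by positivity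
    linarith
  simp only [hbadset, Set.mem_ofPred_eq, not_or, not_exists, not_lt, not_le] at hω
  obtain ⟨hω1, hω2, hω3⟩ := hω
  set e := (Real.sqrt n)⁻¹ • V ω with he
  set y := observation X βs (fun i => ε i ω) with hy
  obtain ⟨x, hx, hxe⟩ := hdes.exists_schur_eq (hdes.adjoint_B_mem e)
  have hDx : ∀ j, |D.toEuclideanLin x j| ≤ 2 * σ * K j * l := by
    intro j
    rw [ha j x e hxe, he, real_inner_smul_right, abs_mul, abs_of_pos (inv_pos.2 hsn),
      inv_mul_le_iff₀ hsn, hl, Real.sqrt_div hlog.le]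
    refine (hω3 j).le.trans_eq ?_
    field_simp
  have hpath := oraclePath_oracleState X D S y ν κ α
  have hw : (Real.sqrt n)⁻¹ • y = scaledX X βs + e := by
    rw [hy, observation, smul_add, scaledX_apply]
  rw [hw] at hpath
  have hreg : Regime (scaledX X) D.toEuclideanLin S ν lamD LamD LamX lamH i1 η σ κ α
      (hessianNorm X D ν) lamH' τ l (2 * σ * Real.sqrt (rPrime X D * Real.log m / n)) βs x e
      (fun k => (oracleState X D S y ν κ α k).1) (fun k => (oracleState X D S y ν κ α k).2)
      (fun k => mask S (κ • shrink (oracleState X D S y ν κ α k).2 1)) :=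
    { design := hdes
      irr := IrrSchur.of_IRR hν hIRR
      eta_pos := hη.1
      eta_le := hη.2
      sigma_pos := hσ
      kappa_pos := hκ
      alpha_pos := hα
      D_le := hD_le
      lamD_le := hlamD
      hess := energy_le_hessianNorm X D ν
      hn_nonneg := norm_nonneg _
      step := hstep
      lamH'_eq := hlamH'
      tau_mul := by
        have h1 : Real.sqrt ((n : ℝ) / Real.log m) * l = 1 := by
          rw [hl, ← Real.sqrt_mul (by positivity), div_mul_div_cancel₀ hlog.ne', div_self hn'.ne',
            Real.sqrt_one]
        rw [hτ, tauBar, mul_assoc, h1, mul_one]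
        field_simp
      tau_gt := htau
      kappa_ge := hkappa
      card_pos := Finset.card_pos.2 hS0
      βs_mem := by rw [ker_scaledX hn]; exact hβs
      off_βs := offPart_mask_supp hS
      x_mem := hx
      x_eq := hxe
      path := hpath
      e_le := by
        rw [he, norm_smul, Real.norm_of_nonneg (by positivity), inv_mul_le_iff₀ hsn, mul_comm]
        exact hω1
      on_le := by
        intro j hj
        have h1 := hDx j
        simp only [hK, if_pos hj] at h1
        refine (mul_le_mul_of_nonneg_left h1 hH.le).trans_eq ?_
        field_simp
      off_le := by
        intro j hj
        have h1 := hDx j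
        simp only [hK, if_neg hj] at h1
        rw [offPart_apply, PiLp.sub_apply, mask_apply, if_neg hj, sub_zero, one_div,
          inv_mul_le_iff₀ hν]
        refine h1.trans_eq ?_
        ring
      proj_le := by
        rw [he, map_smul, norm_smul, Real.norm_of_nonneg (by positivity), inv_mul_le_iff₀ hsn,
          Real.sqrt_div (by positivity)]
        refine hω2.trans_eq ?_
        field_simp }
  have hstate := state_eq_oracleState hα fun k hk j hj => hreg.abs_z_le k hk hj
  have hmask : ∀ k : ℕ, k * α ≤ τ →
      iterGamma X D y ν κ α k = mask S (κ • shrink (oracleState X D S y ν κ α k).2 1) := by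
    intro k hk
    rw [iterGamma, hstate k hk, mask_shrink fun j hj => hreg.abs_z_le k hk hj]
  obtain ⟨-, hfl, -⟩ := hreg.floor_bounds
  have hrate : Real.sqrt (S.card * Real.log m / n) = Real.sqrt S.card * l := by
    rw [hl, mul_div_assoc, Real.sqrt_mul (Nat.cast_nonneg _)]
  refine ⟨fun k hk j hj => ?_, fun hmin j => ?_, ?_, ?_⟩
  · by_contra hjS
    rw [mem_supp, hmask k hk, mask_apply, if_neg hjS] at hj
    exact hj rfl
  · rw [hmask _ hfl]
    exact hreg.sign_eq hmin j
  · rw [hmask _ hfl, hrate]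
    exact hreg.norm_g_sub_le
  · rw [iterBeta, hstate _ hfl, hrate]
    refine hreg.norm_b_sub_le.trans_eq ?_
    ring
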